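/- Let $G$ be a locally compact (Hausdorff) group, let $A$ and $B$ be $C^*$-algebras, let $X$ be a $B$–$A$ imprimitivity bimodule, let $I$ be a closed two-sided ideal of $A$, and let $J=\overline{\operatorname{span}}\,{}_B\langle X\cdot I,X\rangle$ be the ideal of $B$ associated to $I$ by the Rieffel correspondence. (a) Let $\alpha$ and $\beta$ be (strongly continuous) actions of $G$ on $A$ and $B$ by $*$-automorphisms, and suppose that there is a $\beta$–$\alpha$ compatible action $\gamma$ of $G$ on $X$, i.e. a homomorphism $\gamma$ from $G$ to the invertible linear maps of $X$, with $s\mapsto\gamma_s(x)$ continuous for all $x$, such that $\gamma_s(b\cdot x\cdot a)=\beta_s(b)\cdot\gamma_s(x)\cdot\alpha_s(a)$ and $\langle\gamma_s(x),\gamma_s(y)\rangle_A=\alpha_s(\langle x,y\rangle_A)$. Then $\alpha_s(I)\subseteq I$ for all $s\in G$ if and only if $\beta_s(J)\subseteq J$ for all $s\in G$. (b) Let $\delta$ and $\varepsilon$ be coactions of $G$ on $A$ and $B$, and suppose that there is a nondegenerate $\varepsilon$–$\delta$ compatible coaction $\zeta$ of $G$ on $X$. Then $I$ is $\delta$-invariant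 if and only if $J$ is $\varepsilon$-invariant. Here $\otimes$ is the minimal $C^*$-tensor product, $C^*(G)$ is the full group $C^*$-algebra, and $\delta_G\colon C^*(G)\to M(C^*(G)\otimes C^*(G))$ is the integrated form of $s\mapsto s\otimes s$. A coaction of $G$ on $A$ is an injective nondegenerate homomorphism $\delta\colon A\to M(A\otimes C^*(G))$ such that $\overline{\operatorname{span}}\,\delta(A)(1\otimes C^*(G))=A\otimes C^*(G)$ and $(\delta\otimes\mathrm{id})\circ\delta=(\mathrm{id}\otimes\delta_G)\circ\delta$. The ideal $I$ is $\delta$-invariant if $\delta$ restricts to a coaction on $I$: the restriction to $I$ is injective and nondegenerate as a map into $M(I\otimes C^*(G))$, satisfies the coaction identity on $I$, and $\overline{\operatorname{span}}\,\delta(I)(1\otimes C^*(G))=I\otimes C^*(G)$ inside $M(A\otimes C^*(G))$. An $\varepsilon$–$\delta$ compatible coaction on $X$ is a linear map $\zeta\colon X\to M(X\otimes C^*(G))$ (the adjointable operators from $A\otimes C^*(G)$ to $X\otimes C^*(G)$) such that $\zeta(b\cdot x\cdot a)=\varepsilon(b)\zeta(x)\delta(a)$, $\zeta(x)^*\zeta(y)=\delta(\langle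 x,y\rangle_A)$, $\overline{\operatorname{span}}\,\zeta(X)(A\otimes C^*(G))=X\otimes C^*(G)$, $(1\otimes C^*(G))\zeta(X)\subseteq X\otimes C^*(G)$ and $(\zeta\otimes\mathrm{id})\circ\zeta=(\mathrm{id}\otimes\delta_G)\circ\zeta$. It is nondegenerate if $\overline{\operatorname{span}}\,(1\otimes C^*(G))\zeta(X)=X\otimes C^*(G)$. -/

import Mathlib

open scoped TensorProduct MultiplierAlgebra ENNReal
open UniformSpace

universe u

noncomputable section

namespace CStarCoaction

section BilinearExtension

variable {E F G : Type*} [SeminormedAddCommGroup E] [NormedSpace ℂ E]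
  [SeminormedAddCommGroup F] [NormedSpace ℂ F] [SeminormedAddCommGroup G] [NormedSpace ℂ G]
  {σ : ℂ →+* ℂ}

/-- For `x` fixed, the extension of `f x` to the completions. -/
def extAux (f : E →ₛₗ[σ] F →ₗ[ℂ] G) (hf : ∀ x y, ‖f x y‖ ≤ ‖x‖ * ‖y‖) (x : E) :
    Completion F →L[ℂ] Completion G :=
  ((f x).mkContinuous ‖x‖ (hf x)).completion

theorem extAux_coe (f : E →ₛₗ[σ] F →ₗ[ℂ] G) (hf : ∀ x y, ‖f x y‖ ≤ ‖x‖ * ‖y‖) (x : E) (y : F) :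
    extAux f hf x (y : Completion F) = ((f x y : G) : Completion G) := by
  simp [extAux]

theorem extAux_bound (f : E →ₛₗ[σ] F →ₗ[ℂ] G) (hf : ∀ x y, ‖f x y‖ ≤ ‖x‖ * ‖y‖) (x : E)
    (y : Completion F) : ‖extAux f hf x y‖ ≤ ‖x‖ * ‖y‖ := by
  induction y using Completion.induction_on with
  | hp => exact isClosed_le (by fun_prop) (by fun_prop)
  | ih y => rw [extAux_coe, Completion.norm_coe, Completion.norm_coe]; exact hf x y

theorem extAux_add (f : E →ₛₗ[σ] F →ₗ[ℂ] G) (hf : ∀ x y, ‖f x y‖ ≤ ‖x‖ * ‖y‖) (x x' : E)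
    (y : Completion F) : extAux f hf (x + x') y = extAux f hf x y + extAux f hf x' y := by
  induction y using Completion.induction_on with
  | hp => exact isClosed_eq (by fun_prop) (by fun_prop)
  | ih y =>
    rw [extAux_coe, extAux_coe, extAux_coe, map_add, LinearMap.add_apply, Completion.coe_add]

theorem extAux_smul (f : E →ₛₗ[σ] F →ₗ[ℂ] G) (hf : ∀ x y, ‖f x y‖ ≤ ‖x‖ * ‖y‖) (c : ℂ) (x : E)
    (y : Completion F) : extAux f hf (c • x) y = σ c • extAux f hf x y := by
  induction y using Completion.induction_on with
  | hp => exact isClosed_eq (extAux f hf (c • x)).continuous (σ c • extAux f hf x).continuous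
  | ih y => rw [extAux_coe, extAux_coe, map_smulₛₗ, LinearMap.smul_apply, Completion.coe_smul]

variable [RingHomIsometric σ]

/-- `extAux` as a continuous (semi)linear map. -/
def extAuxL (f : E →ₛₗ[σ] F →ₗ[ℂ] G) (hf : ∀ x y, ‖f x y‖ ≤ ‖x‖ * ‖y‖) :
    E →SL[σ] (Completion F →L[ℂ] Completion G) :=
  LinearMap.mkContinuous (E := E) (F := Completion F →L[ℂ] Completion G)
    { toFun := extAux f hf
      map_add' := fun x x' => ContinuousLinearMap.ext (extAux_add f hf x x')
      map_smul' := fun c x => ContinuousLinearMap.ext (extAux_smul f hf c x) }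
    1 (fun x => by
      rw [one_mul]
      exact ContinuousLinearMap.opNorm_le_bound _ (norm_nonneg _) (extAux_bound f hf x))

/-- A bilinear (or sesquilinear) map of norm at most one between seminormed spaces, extended to the
completions by continuity. -/
def bilinExt (f : E →ₛₗ[σ] F →ₗ[ℂ] G) (hf : ∀ x y, ‖f x y‖ ≤ ‖x‖ * ‖y‖) :
    Completion E →SL[σ] Completion F →L[ℂ] Completion G :=
  (extAuxL f hf).extend (Completion.toComplL : E →L[ℂ] Completion E)

theorem bilinExt_coe (f : E →ₛₗ[σ] F →ₗ[ℂ] G) (hf : ∀ x y, ‖f x y‖ ≤ ‖x‖ * ‖y‖) (x : E) (y : F) :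
    bilinExt f hf (x : Completion E) (y : Completion F) = ((f x y : G) : Completion G) := by
  have h := ContinuousLinearMap.extend_eq (extAuxL f hf)
    (e := (Completion.toComplL : E →L[ℂ] Completion E))
    (Completion.denseRange_coe) (Completion.isUniformInducing_coe E) x
  exact (DFunLike.congr_fun h (y : Completion F)).trans (extAux_coe f hf x y)

theorem bilinExt_bound (f : E →ₛₗ[σ] F →ₗ[ℂ] G) (hf : ∀ x y, ‖f x y‖ ≤ ‖x‖ * ‖y‖)
    (x : Completion E) (y : Completion F) : ‖bilinExt f hf x y‖ ≤ ‖x‖ * ‖y‖ := by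
  induction x, y using Completion.induction_on₂ with
  | hp => exact isClosed_le (by fun_prop) (by fun_prop)
  | ih x y => simpa [bilinExt_coe] using hf x y

end BilinearExtension

section OperatorTensor

variable {H H' K K' : Type*} [NormedAddCommGroup H] [InnerProductSpace ℂ H]
  [NormedAddCommGroup H'] [InnerProductSpace ℂ H'] [NormedAddCommGroup K] [InnerProductSpace ℂ K]

theorem inner_map_left (T : H →ₗ[ℂ] H) (T' : H →ₗ[ℂ] H) (S S' : K →ₗ[ℂ] K)
    (hT : ∀ x y, inner ℂ (T x) y = inner ℂ x (T' y)) (hS : ∀ x y, inner ℂ (S x) y = inner ℂ x (S' y))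
    (v w : H ⊗[ℂ] K) :
    inner ℂ (TensorProduct.map T S v) w = inner ℂ v (TensorProduct.map T' S' w) := by
  induction v with
  | zero => simp
  | add v₁ v₂ h₁ h₂ => simp [inner_add_left, h₁, h₂]
  | tmul x y =>
    induction w with
    | zero => simp
    | add w₁ w₂ h₁ h₂ => rw [inner_add_right, map_add, inner_add_right, h₁, h₂]
    | tmul x' y' => simp [hT, hS]

theorem tensor_inner_self (w : H ⊗[ℂ] K) : inner ℂ w w = ((‖w‖ : ℝ) : ℂ) ^ 2 :=
  inner_self_eq_norm_sq_to_K (𝕜 := ℂ) w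

theorem map_sub_left' (T S : H →ₗ[ℂ] H) (v : H ⊗[ℂ] K) :
    TensorProduct.map (T - S) (LinearMap.id : K →ₗ[ℂ] K) v =
      TensorProduct.map T LinearMap.id v - TensorProduct.map S LinearMap.id v := by
  rw [eq_sub_iff_add_eq, ← LinearMap.add_apply, ← TensorProduct.map_add_left, sub_add_cancel]

theorem norm_map_id_le [CompleteSpace H] (T : H →L[ℂ] H) (v : H ⊗[ℂ] K) :
    ‖TensorProduct.map (T : H →ₗ[ℂ] H) (LinearMap.id : K →ₗ[ℂ] K) v‖ ≤ ‖T‖ * ‖v‖ := by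
  have h1 : (0 : H →L[ℂ] H) ≤ algebraMap ℝ (H →L[ℂ] H) ‖star T * T‖ - star T * T :=
    sub_nonneg.2 (IsSelfAdjoint.le_algebraMap_norm_self (.star_mul_self T))
  obtain ⟨D, hD⟩ := CStarAlgebra.nonneg_iff_eq_star_mul_self.1 h1
  have key : ∀ R : H →L[ℂ] H, inner ℂ (TensorProduct.map (R : H →ₗ[ℂ] H) (LinearMap.id : K →ₗ[ℂ] K) v)
      (TensorProduct.map (R : H →ₗ[ℂ] H) (LinearMap.id : K →ₗ[ℂ] K) v) =
      inner ℂ v (TensorProduct.map ((star R * R : H →L[ℂ] H) : H →ₗ[ℂ] H)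
        (LinearMap.id : K →ₗ[ℂ] K) v) := by
    intro R
    rw [inner_map_left (R : H →ₗ[ℂ] H) ((star R : H →L[ℂ] H) : H →ₗ[ℂ] H) LinearMap.id LinearMap.id
      (fun x y => by
        simp [ContinuousLinearMap.star_eq_adjoint, ContinuousLinearMap.adjoint_inner_right])
      (fun _ _ => rfl)]
    rw [← LinearMap.comp_apply, ← TensorProduct.map_comp]
    rfl
  have h2 : ((star D * D : H →L[ℂ] H) : H →ₗ[ℂ] H) =
      ((‖T‖ ^ 2 : ℝ) : ℂ) • LinearMap.id - ((star T * T : H →L[ℂ] H) : H →ₗ[ℂ] H) := by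
    rw [← hD, CStarRing.norm_star_mul_self, ← sq]
    ext x
    simp [Algebra.algebraMap_eq_smul_one, ← Complex.coe_smul]
  have e : ∀ w : H ⊗[ℂ] K, inner ℂ w w = ((‖w‖ : ℝ) : ℂ) ^ 2 := tensor_inner_self
  have h3 := key D
  rw [h2, map_sub_left', TensorProduct.map_smul_left,
    inner_sub_right, ← key T, e, e] at h3
  simp only [TensorProduct.map_id, LinearMap.smul_apply, LinearMap.id_apply, inner_smul_right, e] at h3
  norm_cast at h3
  have h4 : ‖TensorProduct.map (T : H →ₗ[ℂ] H) (LinearMap.id : K →ₗ[ℂ] K) v‖ ^ 2 ≤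
      (‖T‖ * ‖v‖) ^ 2 := by
    have := sq_nonneg ‖TensorProduct.map (D : H →ₗ[ℂ] H) (LinearMap.id : K →ₗ[ℂ] K) v‖
    rw [mul_pow]
    linarith
  exact le_of_sq_le_sq h4 (by positivity)

theorem norm_id_map_le [CompleteSpace K] (S : K →L[ℂ] K) (v : H ⊗[ℂ] K) :
    ‖TensorProduct.map (LinearMap.id : H →ₗ[ℂ] H) (S : K →ₗ[ℂ] K) v‖ ≤ ‖S‖ * ‖v‖ := by
  have h := norm_map_id_le (K := H) S (TensorProduct.comm ℂ H K v)
  rwa [TensorProduct.norm_comm, TensorProduct.map_comm, TensorProduct.norm_comm] at h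

/-- `T ⊗ S` is bounded on the (uncompleted) Hilbert space tensor product. -/
theorem norm_map_le [CompleteSpace H] [CompleteSpace K] (T : H →L[ℂ] H) (S : K →L[ℂ] K)
    (v : H ⊗[ℂ] K) :
    ‖TensorProduct.map (T : H →ₗ[ℂ] H) (S : K →ₗ[ℂ] K) v‖ ≤ ‖T‖ * ‖S‖ * ‖v‖ := by
  have h : TensorProduct.map (T : H →ₗ[ℂ] H) (S : K →ₗ[ℂ] K) =
      TensorProduct.map (T : H →ₗ[ℂ] H) LinearMap.id ∘ₗ TensorProduct.map LinearMap.id (S : K →ₗ[ℂ] K) := by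
    rw [← TensorProduct.map_comp]; simp
  rw [h, LinearMap.comp_apply, mul_assoc]
  exact (norm_map_id_le T _).trans (mul_le_mul_of_nonneg_left (norm_id_map_le S v) (norm_nonneg _))

end OperatorTensor

section MinimalTensorProduct

variable {A C : Type u} [NonUnitalCStarAlgebra A] [NonUnitalCStarAlgebra C]

section RepTensor

variable {H K : Type u} [NormedAddCommGroup H] [InnerProductSpace ℂ H] [CompleteSpace H]
  [NormedAddCommGroup K] [InnerProductSpace ℂ K] [CompleteSpace K]

/-- A representation of a C*-algebra on a Hilbert space, viewed as a bilinear map. -/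
def repBilin (π : A →⋆ₙₐ[ℂ] (H →L[ℂ] H)) : A →ₗ[ℂ] H →ₗ[ℂ] H where
  toFun a := (π a : H →ₗ[ℂ] H)
  map_add' a b := by ext; simp
  map_smul' c a := by ext; simp

/-- The tensor product of representations `π` of `A` and `σ` of `C`: `a ⊗ c` acts on `H ⊗ K`
by `π a ⊗ σ c`. -/
def repTensor (π : A →⋆ₙₐ[ℂ] (H →L[ℂ] H)) (σ : C →⋆ₙₐ[ℂ] (K →L[ℂ] K)) :
    A ⊗[ℂ] C →ₗ[ℂ] H ⊗[ℂ] K →ₗ[ℂ] H ⊗[ℂ] K :=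
  TensorProduct.map₂ (repBilin π) (repBilin σ)

variable (π : A →⋆ₙₐ[ℂ] (H →L[ℂ] H)) (σ : C →⋆ₙₐ[ℂ] (K →L[ℂ] K))

@[simp] theorem repBilin_apply (a : A) (h : H) : repBilin π a h = π a h := rfl

@[simp] theorem repTensor_tmul_tmul (a : A) (c : C) (h : H) (k : K) :
    repTensor π σ (a ⊗ₜ c) (h ⊗ₜ k) = π a h ⊗ₜ σ c k := rfl

theorem repTensor_tmul (a : A) (c : C) :
    repTensor π σ (a ⊗ₜ c) = TensorProduct.map (π a : H →ₗ[ℂ] H) (σ c : K →ₗ[ℂ] K) := by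
  ext h k; rfl

theorem repTensor_mul (s t : A ⊗[ℂ] C) (v : H ⊗[ℂ] K) :
    repTensor π σ (s * t) v = repTensor π σ s (repTensor π σ t v) := by
  induction s with
  | zero => simp
  | add s₁ s₂ h₁ h₂ => rw [add_mul, map_add, LinearMap.add_apply, h₁, h₂, map_add]; rfl
  | tmul a c =>
    induction t with
    | zero => simp
    | add t₁ t₂ h₁ h₂ => rw [mul_add, map_add, LinearMap.add_apply, h₁, h₂, map_add, ← map_add]; rfl
    | tmul a' c' =>
      induction v with
      | zero => simp
      | add v₁ v₂ h₁ h₂ => rw [map_add, h₁, h₂, map_add, map_add]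
      | tmul h k => simp

theorem inner_repTensor_left (t : A ⊗[ℂ] C) (v w : H ⊗[ℂ] K) :
    inner ℂ (repTensor π σ t v) w = inner ℂ v (repTensor π σ (star t) w) := by
  induction t with
  | zero => simp
  | add s₁ s₂ h₁ h₂ =>
    rw [star_add, map_add, map_add, LinearMap.add_apply, LinearMap.add_apply, inner_add_left,
      inner_add_right, h₁, h₂]
  | tmul a c =>
    rw [TensorProduct.star_tmul, repTensor_tmul, repTensor_tmul]
    exact inner_map_left _ _ _ _
      (fun x y => by
        simp [map_star, ContinuousLinearMap.star_eq_adjoint,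
          ContinuousLinearMap.adjoint_inner_right])
      (fun x y => by
        simp [map_star, ContinuousLinearMap.star_eq_adjoint,
          ContinuousLinearMap.adjoint_inner_right]) v w

end RepTensor

/-- The minimal (spatial) C*-norm on the algebraic tensor product `A ⊙ C`: the supremum over all
pairs of representations `π` of `A` on `H` and `σ` of `C` on `K` of the operator norm of
`(π ⊗ σ)(t)` on the Hilbert space tensor product of `H` and `K` (the operator norm is computed on
the dense subspace `H ⊙ K`). -/
def minNorm (t : A ⊗[ℂ] C) : ℝ :=
  sSup {r : ℝ | ∃ (H K : Type u) (_ : NormedAddCommGroup H) (_ : InnerProductSpace ℂ H)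
    (_ : CompleteSpace H) (_ : NormedAddCommGroup K) (_ : InnerProductSpace ℂ K)
    (_ : CompleteSpace K) (π : A →⋆ₙₐ[ℂ] (H →L[ℂ] H)) (σ : C →⋆ₙₐ[ℂ] (K →L[ℂ] K))
    (v : H ⊗[ℂ] K), ‖v‖ ≤ 1 ∧ r = ‖repTensor π σ t v‖}

theorem exists_repTensor_bound (t : A ⊗[ℂ] C) : ∃ M : ℝ, 0 ≤ M ∧ ∀ (H K : Type u)
    [NormedAddCommGroup H] [InnerProductSpace ℂ H] [CompleteSpace H] [NormedAddCommGroup K]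
    [InnerProductSpace ℂ K] [CompleteSpace K] (π : A →⋆ₙₐ[ℂ] (H →L[ℂ] H))
    (σ : C →⋆ₙₐ[ℂ] (K →L[ℂ] K)) (v : H ⊗[ℂ] K), ‖repTensor π σ t v‖ ≤ M * ‖v‖ := by
  induction t with
  | zero => exact ⟨0, le_rfl, by intros; simp⟩
  | add s t hs ht =>
    obtain ⟨M, hM, h⟩ := hs
    obtain ⟨N, hN, h'⟩ := ht
    refine ⟨M + N, add_nonneg hM hN, ?_⟩
    intro H K _ _ _ _ _ _ π σ v
    rw [map_add, LinearMap.add_apply, add_mul]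
    exact (norm_add_le _ _).trans (add_le_add (h H K π σ v) (h' H K π σ v))
  | tmul a c =>
    refine ⟨‖a‖ * ‖c‖, by positivity, ?_⟩
    intro H K _ _ _ _ _ _ π σ v
    rw [repTensor_tmul]
    refine (norm_map_le _ _ _).trans (mul_le_mul_of_nonneg_right ?_ (norm_nonneg _))
    exact mul_le_mul (NonUnitalStarAlgHom.norm_apply_le π a) (NonUnitalStarAlgHom.norm_apply_le σ c)
      (norm_nonneg _) (norm_nonneg _)

theorem le_minNorm_of_le_one {H K : Type u} [NormedAddCommGroup H] [InnerProductSpace ℂ H]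
    [CompleteSpace H] [NormedAddCommGroup K] [InnerProductSpace ℂ K] [CompleteSpace K]
    (π : A →⋆ₙₐ[ℂ] (H →L[ℂ] H)) (σ : C →⋆ₙₐ[ℂ] (K →L[ℂ] K)) (t : A ⊗[ℂ] C) (v : H ⊗[ℂ] K)
    (hv : ‖v‖ ≤ 1) : ‖repTensor π σ t v‖ ≤ minNorm t := by
  obtain ⟨M, hM, h⟩ := exists_repTensor_bound t
  refine le_csSup ⟨M, ?_⟩ ⟨H, K, _, _, ‹_›, _, _, ‹_›, π, σ, v, hv, rfl⟩
  rintro r ⟨H, K, _, _, _, _, _, _, π, σ, v, hv, rfl⟩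
  exact (h H K π σ v).trans (mul_le_of_le_one_right hM hv)

theorem minNorm_nonneg (t : A ⊗[ℂ] C) : 0 ≤ minNorm t :=
  Real.sSup_nonneg (by rintro r ⟨H, K, _, _, _, _, _, _, π, σ, v, hv, rfl⟩; exact norm_nonneg _)

theorem repTensor_le_minNorm {H K : Type u} [NormedAddCommGroup H] [InnerProductSpace ℂ H]
    [CompleteSpace H] [NormedAddCommGroup K] [InnerProductSpace ℂ K] [CompleteSpace K]
    (π : A →⋆ₙₐ[ℂ] (H →L[ℂ] H)) (σ : C →⋆ₙₐ[ℂ] (K →L[ℂ] K)) (t : A ⊗[ℂ] C) (v : H ⊗[ℂ] K) :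
    ‖repTensor π σ t v‖ ≤ minNorm t * ‖v‖ := by
  rcases eq_or_ne v 0 with rfl | hv
  · simp
  have hv' : 0 < ‖v‖ := norm_pos_iff.2 hv
  have h := le_minNorm_of_le_one π σ t (((‖v‖⁻¹ : ℝ) : ℂ) • v)
    (by rw [norm_smul]; simp [hv'.ne'])
  rw [map_smul, norm_smul] at h
  simp only [Complex.norm_real, norm_inv, norm_norm] at h
  rwa [inv_mul_le_iff₀ hv', mul_comm] at h

theorem minNorm_le {t : A ⊗[ℂ] C} {M : ℝ} (hM : 0 ≤ M) (h : ∀ (H K : Type u)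
    [NormedAddCommGroup H] [InnerProductSpace ℂ H] [CompleteSpace H] [NormedAddCommGroup K]
    [InnerProductSpace ℂ K] [CompleteSpace K] (π : A →⋆ₙₐ[ℂ] (H →L[ℂ] H))
    (σ : C →⋆ₙₐ[ℂ] (K →L[ℂ] K)) (v : H ⊗[ℂ] K), ‖repTensor π σ t v‖ ≤ M * ‖v‖) :
    minNorm t ≤ M := by
  refine Real.sSup_le ?_ hM
  rintro r ⟨H, K, _, _, _, _, _, _, π, σ, v, hv, rfl⟩
  exact (h H K π σ v).trans (mul_le_of_le_one_right hM hv)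

theorem minNorm_add_le (s t : A ⊗[ℂ] C) : minNorm (s + t) ≤ minNorm s + minNorm t := by
  refine minNorm_le (add_nonneg (minNorm_nonneg _) (minNorm_nonneg _)) ?_
  intro H K _ _ _ _ _ _ π σ v
  rw [map_add, LinearMap.add_apply, add_mul]
  exact (norm_add_le _ _).trans
    (add_le_add (repTensor_le_minNorm π σ s v) (repTensor_le_minNorm π σ t v))

theorem minNorm_smul_le (c : ℂ) (t : A ⊗[ℂ] C) : minNorm (c • t) ≤ ‖c‖ * minNorm t := by
  refine minNorm_le (mul_nonneg (norm_nonneg _) (minNorm_nonneg _)) ?_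
  intro H K _ _ _ _ _ _ π σ v
  rw [map_smul, LinearMap.smul_apply, norm_smul, mul_assoc]
  exact mul_le_mul_of_nonneg_left (repTensor_le_minNorm π σ t v) (norm_nonneg _)

theorem minNorm_mul_le (s t : A ⊗[ℂ] C) : minNorm (s * t) ≤ minNorm s * minNorm t := by
  refine minNorm_le (mul_nonneg (minNorm_nonneg _) (minNorm_nonneg _)) ?_
  intro H K _ _ _ _ _ _ π σ v
  rw [repTensor_mul, mul_assoc]
  exact (repTensor_le_minNorm π σ s _).trans
    (mul_le_mul_of_nonneg_left (repTensor_le_minNorm π σ t v) (minNorm_nonneg _))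

theorem norm_inner_repTensor_le {H K : Type u} [NormedAddCommGroup H] [InnerProductSpace ℂ H]
    [CompleteSpace H] [NormedAddCommGroup K] [InnerProductSpace ℂ K] [CompleteSpace K]
    (π : A →⋆ₙₐ[ℂ] (H →L[ℂ] H)) (σ : C →⋆ₙₐ[ℂ] (K →L[ℂ] K)) (t : A ⊗[ℂ] C) (v w : H ⊗[ℂ] K) :
    ‖(inner ℂ v (repTensor π σ t w) : ℂ)‖ ≤ ‖v‖ * (minNorm t * ‖w‖) :=
  (norm_inner_le_norm (𝕜 := ℂ) _ _).trans
    (mul_le_mul_of_nonneg_left (repTensor_le_minNorm π σ t w) (norm_nonneg _))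

/-- To bound `minNorm t` it suffices to bound the sesquilinear forms `⟨v, (π ⊗ σ)(t) w⟩`. -/
theorem minNorm_le_of_inner {t : A ⊗[ℂ] C} {M : ℝ} (hM : 0 ≤ M) (h : ∀ (H K : Type u)
    [NormedAddCommGroup H] [InnerProductSpace ℂ H] [CompleteSpace H] [NormedAddCommGroup K]
    [InnerProductSpace ℂ K] [CompleteSpace K] (π : A →⋆ₙₐ[ℂ] (H →L[ℂ] H))
    (σ : C →⋆ₙₐ[ℂ] (K →L[ℂ] K)) (v w : H ⊗[ℂ] K),
    ‖(inner ℂ v (repTensor π σ t w) : ℂ)‖ ≤ M * ‖v‖ * ‖w‖) :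
    minNorm t ≤ M := by
  refine minNorm_le hM ?_
  intro H K _ _ _ _ _ _ π σ w
  have h1 := h H K π σ (repTensor π σ t w) w
  have e : inner ℂ (repTensor π σ t w) (repTensor π σ t w) =
    ((‖repTensor π σ t w‖ : ℝ) : ℂ) ^ 2 := tensor_inner_self _
  rw [e, norm_pow, Complex.norm_real, norm_norm] at h1
  by_contra hlt
  push Not at hlt
  have : 0 < ‖repTensor π σ t w‖ := lt_of_le_of_lt (by positivity) hlt
  nlinarith

theorem minNorm_star_le (t : A ⊗[ℂ] C) : minNorm (star t) ≤ minNorm t := by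
  refine minNorm_le_of_inner (minNorm_nonneg _) ?_
  intro H K _ _ _ _ _ _ π σ v w
  rw [← inner_repTensor_left]
  calc _ ≤ ‖repTensor π σ t v‖ * ‖w‖ := norm_inner_le_norm (𝕜 := ℂ) _ _
    _ ≤ _ := mul_le_mul_of_nonneg_right (repTensor_le_minNorm π σ t v) (norm_nonneg _)

theorem minNorm_star (t : A ⊗[ℂ] C) : minNorm (star t) = minNorm t :=
  le_antisymm (minNorm_star_le t) (by simpa using minNorm_star_le (star t))

theorem minNorm_sq_le (t : A ⊗[ℂ] C) : minNorm t * minNorm t ≤ minNorm (star t * t) := by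
  have h : minNorm t ≤ √(minNorm (star t * t)) := by
    refine minNorm_le (Real.sqrt_nonneg _) ?_
    intro H K _ _ _ _ _ _ π σ v
    refine Real.le_sqrt_of_sq_le ?_ |>.trans (b := √(minNorm (star t * t) * ‖v‖ ^ 2)) ?_
    · have e : inner ℂ (repTensor π σ t v) (repTensor π σ t v) =
        ((‖repTensor π σ t v‖ : ℝ) : ℂ) ^ 2 := tensor_inner_self _
      have h1 := norm_inner_repTensor_le π σ (star t * t) v v
      rw [repTensor_mul, ← inner_repTensor_left, e, norm_pow, Complex.norm_real, norm_norm] at h1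
      linarith
    · rw [Real.sqrt_mul (minNorm_nonneg _), Real.sqrt_sq (norm_nonneg _)]
  calc minNorm t * minNorm t ≤ √(minNorm (star t * t)) * √(minNorm (star t * t)) :=
        mul_self_le_mul_self (minNorm_nonneg _) h
    _ = _ := Real.mul_self_sqrt (minNorm_nonneg _)

variable (A C) in
/-- The algebraic tensor product `A ⊙ C`, as a type carrying the minimal C*-norm. -/
def MinPre : Type u := A ⊗[ℂ] C

instance : NonUnitalRing (MinPre A C) := inferInstanceAs (NonUnitalRing (A ⊗[ℂ] C))
instance : StarRing (MinPre A C) := inferInstanceAs (StarRing (A ⊗[ℂ] C))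
instance : Module ℂ (MinPre A C) := inferInstanceAs (Module ℂ (A ⊗[ℂ] C))
instance : StarModule ℂ (MinPre A C) := inferInstanceAs (StarModule ℂ (A ⊗[ℂ] C))
instance : IsScalarTower ℂ (MinPre A C) (MinPre A C) :=
  inferInstanceAs (IsScalarTower ℂ (A ⊗[ℂ] C) (A ⊗[ℂ] C))
instance : SMulCommClass ℂ (MinPre A C) (MinPre A C) :=
  inferInstanceAs (SMulCommClass ℂ (A ⊗[ℂ] C) (A ⊗[ℂ] C))

instance : SeminormedAddCommGroup (MinPre A C) :=
  AddGroupSeminorm.toSeminormedAddCommGroup (E := MinPre A C)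
    { toFun := fun t => minNorm (A := A) (C := C) t
      map_zero' := le_antisymm (by
        have h := minNorm_smul_le (A := A) (C := C) 0 0
        simp only [zero_smul, norm_zero, zero_mul] at h
        exact h) (minNorm_nonneg _)
      add_le' := minNorm_add_le (A := A) (C := C)
      neg' := fun t => by
        have h : ∀ s : A ⊗[ℂ] C, minNorm (-s) ≤ minNorm s := fun s => by
          have := minNorm_smul_le (-1) s
          rwa [neg_one_smul, norm_neg, norm_one, one_mul] at this
        exact le_antisymm (h t)
          ((congrArg minNorm (neg_neg (G := A ⊗[ℂ] C) t)).symm.le.trans (h (-t))) }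

theorem minPre_norm_def (t : MinPre A C) : ‖t‖ = minNorm (A := A) (C := C) t := rfl

instance : NormedSpace ℂ (MinPre A C) where
  norm_smul_le := minNorm_smul_le (A := A) (C := C)

/-- The multiplication of `A ⊙ C` as a bilinear map. -/
def minPreMul : MinPre A C →ₗ[ℂ] MinPre A C →ₗ[ℂ] MinPre A C := LinearMap.mul ℂ (MinPre A C)

theorem minPreMul_bound (s t : MinPre A C) : ‖minPreMul s t‖ ≤ ‖s‖ * ‖t‖ :=
  minNorm_mul_le (A := A) (C := C) s t

/-- The involution of `A ⊙ C`. -/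
def minPreStar : MinPre A C →SL[starRingEnd ℂ] MinPre A C :=
  LinearMap.mkContinuous
    { toFun := star
      map_add' := star_add
      map_smul' := fun c t => star_smul c t } 1
    (fun t => by rw [one_mul]; exact (minNorm_star (A := A) (C := C) t).le)

variable (A C) in
/-- The minimal tensor product `A ⊗ C` of C*-algebras: the completion of the algebraic tensor
product in the minimal C*-norm. -/
def MinTensor : Type u := Completion (MinPre A C)

namespace MinTensor

instance : NormedAddCommGroup (MinTensor A C) :=
  inferInstanceAs (NormedAddCommGroup (Completion (MinPre A C)))
instance : NormedSpace ℂ (MinTensor A C) :=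
  inferInstanceAs (NormedSpace ℂ (Completion (MinPre A C)))
instance : CompleteSpace (MinTensor A C) :=
  inferInstanceAs (CompleteSpace (Completion (MinPre A C)))

/-- The canonical map of the algebraic tensor product into the minimal one. -/
def of : A ⊗[ℂ] C →ₗ[ℂ] MinTensor A C :=
  (Completion.toComplL : MinPre A C →L[ℂ] Completion (MinPre A C)).toLinearMap

/-- The elementary tensor `a ⊗ c`. -/
def tmul (a : A) (c : C) : MinTensor A C := of (a ⊗ₜ[ℂ] c)

theorem norm_of (t : A ⊗[ℂ] C) : ‖of t‖ = minNorm t := Completion.norm_coe (E := MinPre A C) t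

theorem denseRange_of : DenseRange (of : A ⊗[ℂ] C → MinTensor A C) :=
  Completion.denseRange_coe (α := MinPre A C)

theorem induction {p : MinTensor A C → Prop} (x : MinTensor A C) (hp : IsClosed {x | p x})
    (ih : ∀ t : A ⊗[ℂ] C, p (of t)) : p x :=
  Completion.induction_on (α := MinPre A C) x hp ih

theorem induction₂ {p : MinTensor A C → MinTensor A C → Prop} (x y : MinTensor A C)
    (hp : IsClosed {x : MinTensor A C × MinTensor A C | p x.1 x.2})
    (ih : ∀ s t : A ⊗[ℂ] C, p (of s) (of t)) : p x y :=
  Completion.induction_on₂ (α := MinPre A C) (β := MinPre A C) x y hp ih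

theorem induction₃ {p : MinTensor A C → MinTensor A C → MinTensor A C → Prop}
    (x y z : MinTensor A C)
    (hp : IsClosed {x : MinTensor A C × MinTensor A C × MinTensor A C | p x.1 x.2.1 x.2.2})
    (ih : ∀ s t r : A ⊗[ℂ] C, p (of s) (of t) (of r)) : p x y z :=
  Completion.induction_on₃ (α := MinPre A C) (β := MinPre A C) (γ := MinPre A C) x y z hp ih

/-- Multiplication as a continuous bilinear map. -/
def mulL : MinTensor A C →L[ℂ] MinTensor A C →L[ℂ] MinTensor A C :=
  bilinExt minPreMul minPreMul_bound

/-- The involution as a continuous conjugate-linear map. -/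
def starL : MinTensor A C →SL[starRingEnd ℂ] MinTensor A C := minPreStar.completion

theorem mulL_of (s t : A ⊗[ℂ] C) : mulL (of s) (of t) = of (s * t) :=
  bilinExt_coe minPreMul minPreMul_bound s t

theorem starL_of (t : A ⊗[ℂ] C) : starL (of t) = of (star t) :=
  ContinuousLinearMap.completion_apply_coe (minPreStar (A := A) (C := C)) t

instance : NonUnitalNormedRing (MinTensor A C) where
  __ := (inferInstance : NormedAddCommGroup (MinTensor A C))
  mul x y := mulL x y
  left_distrib x y z := map_add (mulL x) y z
  right_distrib x y z := by
    change mulL (x + y) z = mulL x z + mulL y z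
    rw [map_add]; rfl
  zero_mul x := by
    change mulL 0 x = 0
    rw [map_zero]; rfl
  mul_zero x := map_zero (mulL x)
  mul_assoc x y z := by
    change mulL (mulL x y) z = mulL x (mulL y z)
    refine induction₃ (p := fun x y z => mulL (mulL x y) z = mulL x (mulL y z)) x y z
      (isClosed_eq (by fun_prop) (by fun_prop)) fun s t r => ?_
    rw [mulL_of, mulL_of, mulL_of, mulL_of, mul_assoc]
  norm_mul_le x y := bilinExt_bound minPreMul minPreMul_bound x y

theorem mul_def (x y : MinTensor A C) : x * y = mulL x y := rfl

instance : StarRing (MinTensor A C) where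
  star x := starL x
  star_involutive x := by
    change starL (starL x) = x
    refine induction (p := fun x => starL (starL x) = x) x (isClosed_eq (by fun_prop) (by fun_prop)) fun t => ?_
    rw [starL_of, starL_of, star_star]
  star_mul x y := by
    change starL (mulL x y) = mulL (starL y) (starL x)
    refine induction₂ (p := fun x y => starL (mulL x y) = mulL (starL y) (starL x)) x y
      (isClosed_eq (by fun_prop) (by fun_prop)) fun s t => ?_
    rw [mulL_of, starL_of, starL_of, starL_of, mulL_of, star_mul]
  star_add x y := map_add starL x y

theorem star_def (x : MinTensor A C) : star x = starL x := rfl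

instance : NonUnitalCStarAlgebra (MinTensor A C) where
  norm_mul_self_le x := by
    change ‖x‖ * ‖x‖ ≤ ‖mulL (starL x) x‖
    refine induction (p := fun x => ‖x‖ * ‖x‖ ≤ ‖mulL (starL x) x‖) x
      (isClosed_le (by fun_prop) (by fun_prop)) fun t => ?_
    rw [starL_of, mulL_of, norm_of, norm_of]
    exact minNorm_sq_le t
  smul_assoc c x y := by
    change mulL (c • x) y = c • mulL x y
    rw [map_smul]; rfl
  smul_comm c x y := (map_smul (mulL x) c y).symm
  star_smul c x := map_smulₛₗ starL c x

theorem of_mul (s t : A ⊗[ℂ] C) : of (s * t) = of s * of t := (mulL_of s t).symm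

theorem of_star (t : A ⊗[ℂ] C) : of (star t) = star (of t) := (starL_of t).symm

end MinTensor

end MinimalTensorProduct

section HilbertModules

/-- A (right) Hilbert module `X` over a C*-algebra `A`: a right `A`-module with an `A`-valued inner
product which is conjugate-linear in the first and `A`-linear in the second variable, positive, and
induces the (complete) norm of `X`. -/
class HilbertModule (A X : Type*) [NonUnitalCStarAlgebra A] [NormedAddCommGroup X]
    [NormedSpace ℂ X] [CompleteSpace X] where
  /-- the right action `x · a` -/
  act : X →ₗ[ℂ] A →ₗ[ℂ] X
  /-- the inner product `⟨x, y⟩_A` -/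
  inner : X →ₗ⋆[ℂ] X →ₗ[ℂ] A
  act_mul : ∀ x a b, act x (a * b) = act (act x a) b
  inner_act : ∀ x y a, inner x (act y a) = inner x y * a
  star_inner : ∀ x y, star (inner x y) = inner y x
  inner_self_pos : ∀ x, ∃ a, inner x x = star a * a
  norm_sq : ∀ x, ‖x‖ ^ 2 = ‖inner x x‖

/-- A left action of a C*-algebra `B` by adjointable operators on a Hilbert `A`-module `X`. -/
structure LeftAction (B A X : Type*) [NonUnitalCStarAlgebra B] [NonUnitalCStarAlgebra A]
    [NormedAddCommGroup X] [NormedSpace ℂ X] [CompleteSpace X] [HilbertModule A X] where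
  /-- the left action `b · x` -/
  act : B →ₗ[ℂ] X →ₗ[ℂ] X
  mul_act : ∀ b c x, act (b * c) x = act b (act c x)
  inner_act_left : ∀ b x y, HilbertModule.inner (A := A) (act b x) y =
    HilbertModule.inner (A := A) x (act (star b) y)

variable {A X : Type u} [NonUnitalCStarAlgebra A] [NormedAddCommGroup X] [NormedSpace ℂ X]
  [CompleteSpace X] [HilbertModule A X]

theorem sum_star_mul_self_eq_zero {D : Type*} [NonUnitalCStarAlgebra D] {n : ℕ} (r : Fin n → D)
    (d : D) (h : ∑ k, star (r k) * r k + star d * d = 0) (k : Fin n) : r k = 0 := by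
  let _ := CStarAlgebra.spectralOrder D
  have _ := CStarAlgebra.spectralOrderedRing D
  have h0 : ∀ i ∈ Finset.univ, 0 ≤ star (r i) * r i := fun i _ => star_mul_self_nonneg _
  have h1 := ((add_eq_zero_iff_of_nonneg (Finset.sum_nonneg h0) (star_mul_self_nonneg d)).1 h).1
  exact CStarRing.star_mul_self_eq_zero_iff _ |>.1
    ((Finset.sum_eq_zero_iff_of_nonneg h0).1 h1 k (Finset.mem_univ k))

theorem exists_negPart {D : Type*} [NonUnitalCStarAlgebra D] (M : D) (hM : IsSelfAdjoint M) :
    ∃ P Q : D, star P = P ∧ P * M * P = - (star (Q * P) * (Q * P)) ∧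
      (Q * P = 0 → ∃ N, M = star N * N) := by
  let _ := CStarAlgebra.spectralOrder D
  have _ := CStarAlgebra.spectralOrderedRing D
  have hP0 : 0 ≤ M⁻ := CFC.negPart_nonneg M
  have hPs : star (M⁻) = M⁻ := hP0.isSelfAdjoint
  obtain ⟨Q, hQ⟩ := CStarAlgebra.nonneg_iff_eq_star_mul_self.1 hP0
  refine ⟨M⁻, Q, hPs, ?_, fun hR => ?_⟩
  · have h1 : M⁻ * M = - (M⁻ * M⁻) := by
      calc M⁻ * M = M⁻ * (M⁺ - M⁻) := by rw [CFC.posPart_sub_negPart M hM]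
        _ = _ := by rw [mul_sub, CFC.negPart_mul_posPart, zero_sub]
    calc M⁻ * M * M⁻ = - (M⁻ * M⁻ * M⁻) := by rw [h1, neg_mul]
      _ = - (M⁻ * (star Q * Q) * M⁻) := by rw [← hQ]
      _ = _ := by rw [star_mul, hPs]; simp only [mul_assoc]
  · have hP : M⁻ = 0 := by
      have h1 : M⁻ * M⁻ = 0 := by
        calc M⁻ * M⁻ = star Q * Q * M⁻ := by rw [← hQ]
          _ = 0 := by rw [mul_assoc, hR, mul_zero]
      have h2 : star (M⁻) * M⁻ = 0 := by rw [hPs, h1]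
      exact CStarRing.star_mul_self_eq_zero_iff _ |>.1 h2
    have hM0 : 0 ≤ M := by
      have h1 := CFC.posPart_sub_negPart M hM
      rw [hP, sub_zero] at h1
      rw [← h1]; exact CFC.posPart_nonneg M
    exact CStarAlgebra.nonneg_iff_eq_star_mul_self.1 hM0

/-- Positivity of the Gram matrix of a finite family in a Hilbert module. -/
theorem exists_gram {n : ℕ} (x : Fin n → X) : ∃ N : Fin n → Fin n → A,
    ∀ i j, HilbertModule.inner (A := A) (x i) (x j) = ∑ k, star (N k i) * N k j := by
  let _ := CStarAlgebra.spectralOrder A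
  have _ := CStarAlgebra.spectralOrderedRing A
  let M : CStarMatrix (Fin n) (Fin n) A :=
    CStarMatrix.ofMatrix (Matrix.of fun i j => HilbertModule.inner (A := A) (x i) (x j))
  have hM : IsSelfAdjoint M := by
    ext i j
    exact HilbertModule.star_inner (A := A) (x j) (x i)
  obtain ⟨P, Q, hPs, hMP, hN⟩ := exists_negPart M hM
  have hR : Q * P = 0 := by
    ext k i
    let y : X := ∑ j, HilbertModule.act (A := A) (x j) (P j i)
    obtain ⟨d, hd⟩ := HilbertModule.inner_self_pos (A := A) y
    have h1 : (P * M * P) i i = star d * d := by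
      rw [← hd]
      have hst : ∀ j, P i j = star (P j i) := fun j => by
        conv_lhs => rw [← hPs]
        rfl
      have hl : ∀ z j, HilbertModule.inner (A := A) (HilbertModule.act (A := A) (x j) (P j i)) z
          = star (P j i) * HilbertModule.inner (A := A) (x j) z := fun z j => by
        rw [← HilbertModule.star_inner, HilbertModule.inner_act, star_mul,
          HilbertModule.star_inner]
      simp only [y, map_sum, LinearMap.sum_apply, CStarMatrix.mul_apply, Finset.sum_mul,
        HilbertModule.inner_act, hl, hst, mul_assoc]
      rfl
    have h2 : (star (Q * P) * (Q * P)) i i = ∑ k, star ((Q * P) k i) * (Q * P) k i := by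
      rw [CStarMatrix.mul_apply]; rfl
    refine sum_star_mul_self_eq_zero (fun k => (Q * P) k i) d ?_ k
    rw [← h2, ← h1, hMP]
    exact add_neg_cancel _
  obtain ⟨N, hN⟩ := hN hR
  refine ⟨fun k i => N k i, fun i j => ?_⟩
  have h1 : M i j = (star N * N) i j := by rw [← hN]
  rw [CStarMatrix.mul_apply] at h1
  exact h1

section InducedRepresentation

variable {H : Type u} [NormedAddCommGroup H] [InnerProductSpace ℂ H] [CompleteSpace H]

variable (X) in
/-- `X ⊗ H` with the semi-inner product `⟨x ⊗ h, y ⊗ k⟩ = ⟨h, π(⟨x, y⟩) k⟩` for a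
representation `π` of `A` on `H`; its completion carries the representation induced by `π`. -/
@[nolint unusedArguments]
def IndPre (_π : A →⋆ₙₐ[ℂ] (H →L[ℂ] H)) : Type u := X ⊗[ℂ] H

variable (π : A →⋆ₙₐ[ℂ] (H →L[ℂ] H))

instance : AddCommGroup (IndPre X π) := inferInstanceAs (AddCommGroup (X ⊗[ℂ] H))
instance : Module ℂ (IndPre X π) := inferInstanceAs (Module ℂ (X ⊗[ℂ] H))

/-- `x ⊗ h ↦ (y ↦ π(⟨y, x⟩) h)` -/
def indAux : X ⊗[ℂ] H →ₗ[ℂ] X →ₗ⋆[ℂ] H :=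
  TensorProduct.lift (LinearMap.mk₂'ₛₗ (RingHom.id ℂ) (RingHom.id ℂ)
    (fun x h =>
      { toFun := fun y => π (HilbertModule.inner (A := A) y x) h
        map_add' := fun y z => by simp
        map_smul' := fun c y => by simp })
    (fun x y h => by ext; simp) (fun c x h => by ext; simp) (fun x h k => by ext; simp)
    (fun c x h => by ext; simp))

/-- The semi-inner product of `IndPre X π`. -/
def indForm : X ⊗[ℂ] H →ₗ⋆[ℂ] X ⊗[ℂ] H →ₗ[ℂ] ℂ :=
  LinearMap.compl₂ (TensorProduct.lift (LinearMap.mk₂'ₛₗ (starRingEnd ℂ) (starRingEnd ℂ)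
    (fun (y : X) (k : H) =>
      ({ toFun := fun f => inner ℂ k (f y)
         map_add' := fun f g => by simp
         map_smul' := fun c f => by simp } : (X →ₗ⋆[ℂ] H) →ₗ[ℂ] ℂ))
    (fun x y h => by ext; simp) (fun c x h => by ext; simp)
    (fun x h k => by ext; simp) (fun c x h => by ext; simp [mul_comm]))) (indAux π)

theorem indForm_tmul (x y : X) (h k : H) : indForm π (x ⊗ₜ h) (y ⊗ₜ k) =
    inner ℂ h (π (HilbertModule.inner (A := A) x y) k) := rfl

theorem indForm_conj (u v : X ⊗[ℂ] H) :
    starRingEnd ℂ (indForm π v u) = indForm π u v := by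
  induction u with
  | zero => simp
  | add u₁ u₂ h₁ h₂ => simp [h₁, h₂]
  | tmul x h =>
    induction v with
    | zero => simp
    | add v₁ v₂ h₁ h₂ => simp [h₁, h₂]
    | tmul y k =>
      rw [indForm_tmul, indForm_tmul, inner_conj_symm, ← HilbertModule.star_inner, map_star,
        ContinuousLinearMap.star_eq_adjoint, ContinuousLinearMap.adjoint_inner_left]

theorem indForm_nonneg (u : X ⊗[ℂ] H) : 0 ≤ (indForm π u u).re := by
  obtain ⟨n, x, h, rfl⟩ : ∃ (n : ℕ) (x : Fin n → X) (h : Fin n → H), u = ∑ i, x i ⊗ₜ[ℂ] h i := by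
    obtain ⟨s, rfl⟩ := TensorProduct.exists_finset u
    refine ⟨s.card, fun i => (s.equivFin.symm i).1.1, fun i => (s.equivFin.symm i).1.2, ?_⟩
    rw [← Finset.sum_coe_sort s (fun p : X × H => p.1 ⊗ₜ[ℂ] p.2)]
    exact (Equiv.sum_comp s.equivFin.symm (fun p : s => p.1.1 ⊗ₜ[ℂ] p.1.2)).symm
  obtain ⟨N, hN⟩ := exists_gram (A := A) x
  have h1 : indForm π (∑ i, x i ⊗ₜ[ℂ] h i) (∑ i, x i ⊗ₜ[ℂ] h i) =
      ∑ k, inner ℂ (∑ i, π (N k i) (h i)) (∑ i, π (N k i) (h i)) := by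
    simp only [map_sum, LinearMap.sum_apply, indForm_tmul, hN, sum_inner, inner_sum,
      _root_.sum_apply, map_mul, map_star, mul_apply_eq_comp,
      ContinuousLinearMap.star_eq_adjoint, ContinuousLinearMap.adjoint_inner_right]
    rw [Finset.sum_comm]
    conv_lhs => enter [2, y]; rw [Finset.sum_comm]
    rw [Finset.sum_comm]
    refine Finset.sum_congr rfl fun k _ => ?_
    rw [Finset.sum_comm]
  rw [h1, Complex.re_sum]
  exact Finset.sum_nonneg fun k _ => inner_self_nonneg (𝕜 := ℂ)

/-- The semi-inner product space structure of `IndPre X π`. -/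
abbrev indCore : PreInnerProductSpace.Core ℂ (IndPre X π) where
  inner u v := indForm π u v
  conj_inner_symm u v := indForm_conj π u v
  re_inner_nonneg u := indForm_nonneg π u
  add_left u v w := LinearMap.map_add₂ (indForm π) u v w
  smul_left u v c := LinearMap.map_smulₛₗ₂ (indForm π) c u v

instance : SeminormedAddCommGroup (IndPre X π) :=
  InnerProductSpace.Core.toSeminormedAddCommGroup (c := indCore π)
instance : InnerProductSpace ℂ (IndPre X π) := InnerProductSpace.ofCore (indCore π)

theorem indPre_inner_def (u v : IndPre X π) : inner ℂ u v = indForm π u v := rfl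

variable (X) in
/-- The Hilbert space of the representation induced by `π` via `X`. -/
abbrev Ind : Type u := Completion (IndPre X π)

/-- The canonical map `X ⊙ H → Ind X π`. -/
def toInd : X ⊗[ℂ] H →ₗ[ℂ] Ind X π :=
  (Completion.toComplL : IndPre X π →L[ℂ] Completion (IndPre X π)).toLinearMap

theorem inner_toInd (u v : X ⊗[ℂ] H) : inner ℂ (toInd π u) (toInd π v) = indForm π u v :=
  Completion.inner_coe (𝕜 := ℂ) (E := IndPre X π) u v

/-- `h ↦ x ⊗ h` -/
def kmap : X →ₗ[ℂ] H →ₗ[ℂ] Ind X π := (TensorProduct.mk ℂ X H).compr₂ (toInd π)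

theorem inner_kmap (x y : X) (h k : H) :
    inner ℂ (kmap π x h) (kmap π y k) = inner ℂ h (π (HilbertModule.inner (A := A) x y) k) :=
   inner_toInd π (x ⊗ₜ h) (y ⊗ₜ k)

section LeftAct

variable {B : Type u} [NonUnitalCStarAlgebra B] (L : LeftAction B A X)

/-- The operators `b ⊗ 1` on `X ⊗ H`. -/
def indActAux : B →ₙₐ[ℂ] Module.End ℂ (X ⊗[ℂ] H) where
  toFun b := TensorProduct.map (L.act b) LinearMap.id
  map_smul' c b := by ext; simp [TensorProduct.smul_tmul']
  map_zero' := by ext; simp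
  map_add' b c := by ext; simp [TensorProduct.add_tmul]
  map_mul' b c := by ext; simp [L.mul_act]

theorem indForm_indActAux (b : B) (u v : X ⊗[ℂ] H) :
    indForm π (indActAux L b u) v = indForm π u (indActAux L (star b) v) := by
  induction u with
  | zero => simp
  | add u₁ u₂ h₁ h₂ => rw [map_add, map_add, map_add, LinearMap.add_apply, LinearMap.add_apply, h₁, h₂]
  | tmul x h =>
    induction v with
    | zero => simp
    | add v₁ v₂ h₁ h₂ => rw [map_add, h₁, h₂, map_add, map_add]
    | tmul y k =>
      change indForm π (L.act b x ⊗ₜ h) (y ⊗ₜ k) = indForm π (x ⊗ₜ h) (L.act (star b) y ⊗ₜ k)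
      rw [indForm_tmul, indForm_tmul, L.inner_act_left]

/-- The action of the unitization. -/
def indActUnit : Unitization ℂ B →ₐ[ℂ] Module.End ℂ (X ⊗[ℂ] H) :=
  Unitization.lift (indActAux L)

theorem indForm_indActUnit (b : Unitization ℂ B) (u v : X ⊗[ℂ] H) :
    indForm π (indActUnit L b u) v = indForm π u (indActUnit L (star b) v) := by
  induction b with
  | inl_add_inr r b =>
    have h1 : ∀ (s : ℂ) (c : B) (w : X ⊗[ℂ] H),
        indActUnit L (Unitization.inl s + (c : Unitization ℂ B)) w = s • w + indActAux L c w := by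
      intro s c w
      simp [indActUnit, Unitization.lift]
    have h2 : star (Unitization.inl r + (b : Unitization ℂ B)) =
        Unitization.inl (star r) + ((star b : B) : Unitization ℂ B) := by
      rw [star_add, Unitization.inr_star]; congr 1; ext <;> simp
    rw [h2, h1, h1]
    simp [indForm_indActAux]

theorem indForm_bound (b : B) (u : X ⊗[ℂ] H) :
    (indForm π (indActAux L b u) (indActAux L b u)).re ≤ ‖b‖ ^ 2 * (indForm π u u).re := by
  let _ := CStarAlgebra.spectralOrder (Unitization ℂ B)
  have _ := CStarAlgebra.spectralOrderedRing (Unitization ℂ B)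
  set β : Unitization ℂ B := (b : Unitization ℂ B)
  have h1 : (0 : Unitization ℂ B) ≤ algebraMap ℝ (Unitization ℂ B) ‖star β * β‖ - star β * β :=
    sub_nonneg.2 (IsSelfAdjoint.le_algebraMap_norm_self (.star_mul_self β))
  obtain ⟨D, hD⟩ := CStarAlgebra.nonneg_iff_eq_star_mul_self.1 h1
  have h2 := indForm_nonneg π (indActUnit L D u)
  have h3 : indActUnit L β = indActAux (H := H) L b := by
    ext; simp [indActUnit, β]
  rw [indForm_indActUnit, ← Module.End.mul_apply, ← map_mul, ← hD, CStarRing.norm_star_mul_self,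
    map_sub, LinearMap.sub_apply, map_sub, map_mul (indActUnit L) (star β), Module.End.mul_apply,
    ← indForm_indActUnit, h3, Unitization.norm_inr] at h2
  have h4 : indActUnit (H := H) L (algebraMap ℝ (Unitization ℂ B) (‖b‖ * ‖b‖)) u =
      ((‖b‖ ^ 2 : ℝ) : ℂ) • u := by
    have : algebraMap ℝ (Unitization ℂ B) (‖b‖ * ‖b‖) =
        algebraMap ℂ (Unitization ℂ B) ((‖b‖ ^ 2 : ℝ) : ℂ) := by
      rw [Algebra.algebraMap_eq_smul_one, Algebra.algebraMap_eq_smul_one, ← sq, Complex.coe_smul]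
    rw [this, AlgHom.commutes]; rfl
  rw [h4, map_smul, smul_eq_mul, Complex.sub_re, Complex.re_ofReal_mul] at h2
  linarith

/-- The operator `b ⊗ 1` on `IndPre X π`. -/
def indActPre (b : B) : IndPre X π →L[ℂ] IndPre X π :=
  LinearMap.mkContinuous (E := IndPre X π) (F := IndPre X π) (indActAux L b) ‖b‖ fun u => by
    have h := indForm_bound π L b u
    have e : ∀ w : IndPre X π, ‖w‖ ^ 2 = (indForm π w w).re := fun w =>
      norm_sq_eq_re_inner (𝕜 := ℂ) w
    refine le_of_sq_le_sq ?_ (by positivity)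
    rw [mul_pow, e, e]
    exact h

theorem indActPre_apply (b : B) (u : IndPre X π) : indActPre π L b u = indActAux L b u := rfl

/-- The representation of `B` induced by the representation `π` of `A` via `X`. -/
def indRep : B →⋆ₙₐ[ℂ] (Ind X π →L[ℂ] Ind X π) where
  toFun b := (indActPre π L b).completion
  map_smul' c b := by
    ext z
    induction z using Completion.induction_on with
    | hp => exact isClosed_eq (indActPre π L (c • b)).completion.continuous
              (c • (indActPre π L b).completion).continuous
    | ih z =>
      rw [ContinuousLinearMap.completion_apply_coe, MonoidHom.id_apply,
        _root_.smul_apply, ContinuousLinearMap.completion_apply_coe,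
        ← Completion.coe_smul]
      simp only [indActPre_apply, map_smul]
      rfl
  map_zero' := by
    ext z
    induction z using Completion.induction_on with
    | hp => exact isClosed_eq (indActPre π L 0).completion.continuous (by fun_prop)
    | ih z =>
      rw [ContinuousLinearMap.completion_apply_coe, indActPre_apply, map_zero]
      rfl
  map_add' b c := by
    ext z
    induction z using Completion.induction_on with
    | hp => apply isClosed_eq <;> fun_prop
    | ih z =>
      rw [ContinuousLinearMap.completion_apply_coe, _root_.add_apply,
        ContinuousLinearMap.completion_apply_coe, ContinuousLinearMap.completion_apply_coe,
        ← Completion.coe_add]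
      simp only [indActPre_apply, map_add]
      rfl
  map_mul' b c := by
    ext z
    induction z using Completion.induction_on with
    | hp => apply isClosed_eq <;> fun_prop
    | ih z =>
      rw [ContinuousLinearMap.completion_apply_coe, mul_apply_eq_comp,
        ContinuousLinearMap.completion_apply_coe, ContinuousLinearMap.completion_apply_coe]
      simp only [indActPre_apply, map_mul]
      rfl
  map_star' b := by
    refine (ContinuousLinearMap.eq_adjoint_iff (indActPre π L (star b)).completion
      (indActPre π L b).completion).mpr ?_
    intro x y
    induction x, y using Completion.induction_on₂ with
    | hp => apply isClosed_eq <;> fun_prop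
    | ih x y =>
      rw [ContinuousLinearMap.completion_apply_coe, ContinuousLinearMap.completion_apply_coe,
        Completion.inner_coe, Completion.inner_coe, indPre_inner_def, indPre_inner_def,
        indActPre_apply, indActPre_apply]
      exact (indForm_indActAux π L (star b) x y).trans (by rw [star_star])

theorem indRep_kmap (b : B) (x : X) (h : H) :
    indRep π L b (kmap π x h) = kmap π (L.act b x) h := by
  change (indActPre π L b).completion _ = _
  exact ContinuousLinearMap.completion_apply_coe _ _

end LeftAct

end InducedRepresentation

section ExternalTensorProduct

variable {C : Type u} [NonUnitalCStarAlgebra C]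

section Comparison

variable {H K : Type u} [NormedAddCommGroup H] [InnerProductSpace ℂ H] [CompleteSpace H]
  [NormedAddCommGroup K] [InnerProductSpace ℂ K] [CompleteSpace K]
  (π : A →⋆ₙₐ[ℂ] (H →L[ℂ] H)) (σ : C →⋆ₙₐ[ℂ] (K →L[ℂ] K))

theorem kmap_act (x : X) (a : A) (h : H) :
    kmap π (HilbertModule.act x a) h = kmap π x (π a h) := by
  have hl : ∀ z, HilbertModule.inner (A := A) (HilbertModule.act (A := A) x a) z
      = star a * HilbertModule.inner (A := A) x z := fun z => by
    rw [← HilbertModule.star_inner, HilbertModule.inner_act, star_mul, HilbertModule.star_inner]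
  rw [← sub_eq_zero, ← inner_self_eq_zero (𝕜 := ℂ)]
  simp only [inner_sub_left, inner_sub_right, inner_kmap, HilbertModule.inner_act, hl, map_mul,
    mul_apply_eq_comp, map_star, ContinuousLinearMap.star_eq_adjoint,
    ContinuousLinearMap.adjoint_inner_right, sub_self]

/-- The operator `H ⊗ K → (X ⊗ H) ⊗ K` determined by an element of `X ⊙ C`. -/
def kTensor : X ⊗[ℂ] C →ₗ[ℂ] H ⊗[ℂ] K →ₗ[ℂ] Ind X π ⊗[ℂ] K :=
  TensorProduct.map₂ (kmap π) (repBilin σ)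

/-- `(c, d) ↦ c* d` -/
def starMul : C →ₗ⋆[ℂ] C →ₗ[ℂ] C :=
  LinearMap.mk₂'ₛₗ (starRingEnd ℂ) (RingHom.id ℂ) (fun c d => star c * d)
    (fun a b c => by rw [star_add, add_mul]) (fun r a b => by rw [star_smul, smul_mul_assoc]; rfl)
    (fun a b c => mul_add _ _ _) (fun r a b => mul_smul_comm _ _ _)

variable (A X C) in
/-- The `A ⊙ C`-valued inner product on `X ⊙ C`. -/
def tInner : X ⊗[ℂ] C →ₗ⋆[ℂ] X ⊗[ℂ] C →ₗ[ℂ] A ⊗[ℂ] C :=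
  TensorProduct.map₂ HilbertModule.inner starMul

variable (A X C) in
/-- The right action of `A ⊙ C` on `X ⊙ C`. -/
def tAct : X ⊗[ℂ] C →ₗ[ℂ] A ⊗[ℂ] C →ₗ[ℂ] X ⊗[ℂ] C :=
  TensorProduct.map₂ HilbertModule.act (LinearMap.mul ℂ C)

theorem tInner_tmul (x y : X) (c d : C) : tInner A X C (x ⊗ₜ c) (y ⊗ₜ d) =
    HilbertModule.inner (A := A) x y ⊗ₜ (star c * d) := rfl

theorem tAct_tmul (x : X) (a : A) (c d : C) : tAct A X C (x ⊗ₜ c) (a ⊗ₜ d) =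
    HilbertModule.act x a ⊗ₜ (c * d) := rfl

theorem kTensor_tmul (x : X) (c : C) (h : H) (k : K) :
    kTensor π σ (x ⊗ₜ c) (h ⊗ₜ k) = kmap π x h ⊗ₜ σ c k := rfl

theorem inner_kTensor (u w : X ⊗[ℂ] C) (v v' : H ⊗[ℂ] K) :
    inner ℂ (kTensor π σ u v) (kTensor π σ w v') =
      inner ℂ v (repTensor π σ (tInner A X C u w) v') := by
  induction u with
  | zero => simp
  | add u₁ u₂ h₁ h₂ =>
    simp only [map_add, LinearMap.add_apply, inner_add_left, inner_add_right, h₁, h₂]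
  | tmul x c =>
    induction w with
    | zero => simp
    | add w₁ w₂ h₁ h₂ =>
      simp only [map_add, LinearMap.add_apply, inner_add_right, h₁, h₂]
    | tmul y d =>
      induction v with
      | zero => simp
      | add v₁ v₂ h₁ h₂ => simp only [map_add, inner_add_left, h₁, h₂]
      | tmul h k =>
        induction v' with
        | zero => simp
        | add v₁ v₂ h₁ h₂ => simp only [map_add, inner_add_right, h₁, h₂]
        | tmul h' k' =>
          rw [kTensor_tmul, kTensor_tmul, tInner_tmul, repTensor_tmul_tmul,
            TensorProduct.inner_tmul, TensorProduct.inner_tmul, inner_kmap, map_mul, map_star,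
            mul_apply_eq_comp, ContinuousLinearMap.star_eq_adjoint,
            ContinuousLinearMap.adjoint_inner_right]

theorem kTensor_act (u : X ⊗[ℂ] C) (t : A ⊗[ℂ] C) (v : H ⊗[ℂ] K) :
    kTensor π σ (tAct A X C u t) v = kTensor π σ u (repTensor π σ t v) := by
  induction u with
  | zero => simp
  | add u₁ u₂ h₁ h₂ => simp only [map_add, LinearMap.add_apply, h₁, h₂]
  | tmul x c =>
    induction t with
    | zero => simp
    | add w₁ w₂ h₁ h₂ => simp only [map_add, LinearMap.add_apply, h₁, h₂]
    | tmul a d =>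
      induction v with
      | zero => simp
      | add v₁ v₂ h₁ h₂ => simp only [map_add, h₁, h₂]
      | tmul h k =>
        rw [tAct_tmul, kTensor_tmul, repTensor_tmul_tmul, kTensor_tmul, kmap_act, map_mul,
          mul_apply_eq_comp]

end Comparison

/-- The norm `‖⟨u, u⟩‖^{1/2}` on `X ⊙ C`. -/
def hNorm (A : Type u) {X C : Type u} [NonUnitalCStarAlgebra A] [NonUnitalCStarAlgebra C]
    [NormedAddCommGroup X] [NormedSpace ℂ X] [CompleteSpace X] [HilbertModule A X]
    (u : X ⊗[ℂ] C) : ℝ := √(minNorm (tInner A X C u u))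

theorem hNorm_nonneg (u : X ⊗[ℂ] C) : 0 ≤ hNorm A u := Real.sqrt_nonneg _

theorem hNorm_sq (u : X ⊗[ℂ] C) : hNorm A u ^ 2 = minNorm (tInner A X C u u) :=
  Real.sq_sqrt (minNorm_nonneg _)

theorem norm_kTensor_le {H K : Type u} [NormedAddCommGroup H] [InnerProductSpace ℂ H]
    [CompleteSpace H] [NormedAddCommGroup K] [InnerProductSpace ℂ K] [CompleteSpace K]
    (π : A →⋆ₙₐ[ℂ] (H →L[ℂ] H)) (σ : C →⋆ₙₐ[ℂ] (K →L[ℂ] K)) (u : X ⊗[ℂ] C) (v : H ⊗[ℂ] K) :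
    ‖kTensor π σ u v‖ ≤ hNorm A u * ‖v‖ := by
  refine le_of_sq_le_sq ?_ (mul_nonneg (hNorm_nonneg u) (norm_nonneg v))
  rw [mul_pow, hNorm_sq]
  have h := norm_inner_repTensor_le π σ (tInner A X C u u) v v
  have e : inner ℂ (kTensor π σ u v) (kTensor π σ u v) =
    ((‖kTensor π σ u v‖ : ℝ) : ℂ) ^ 2 := tensor_inner_self _
  rw [← inner_kTensor, e, norm_pow, Complex.norm_real, norm_norm] at h
  linarith

theorem hNorm_le {u : X ⊗[ℂ] C} {M : ℝ} (hM : 0 ≤ M) (h : ∀ (H K : Type u)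
    [NormedAddCommGroup H] [InnerProductSpace ℂ H] [CompleteSpace H] [NormedAddCommGroup K]
    [InnerProductSpace ℂ K] [CompleteSpace K] (π : A →⋆ₙₐ[ℂ] (H →L[ℂ] H))
    (σ : C →⋆ₙₐ[ℂ] (K →L[ℂ] K)) (v : H ⊗[ℂ] K), ‖kTensor π σ u v‖ ≤ M * ‖v‖) :
    hNorm A u ≤ M := by
  refine le_of_sq_le_sq ?_ hM
  rw [hNorm_sq]
  refine minNorm_le_of_inner (by positivity) ?_
  intro H K _ _ _ _ _ _ π σ v w
  rw [← inner_kTensor]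
  calc _ ≤ ‖kTensor π σ u v‖ * ‖kTensor π σ u w‖ := norm_inner_le_norm (𝕜 := ℂ) _ _
    _ ≤ (M * ‖v‖) * (M * ‖w‖) :=
      mul_le_mul (h H K π σ v) (h H K π σ w) (norm_nonneg _) (by positivity)
    _ = _ := by ring

theorem hNorm_add_le (u w : X ⊗[ℂ] C) : hNorm A (u + w) ≤ hNorm A u + hNorm A w := by
  refine hNorm_le (add_nonneg (hNorm_nonneg _) (hNorm_nonneg _)) ?_
  intro H K _ _ _ _ _ _ π σ v
  rw [map_add, LinearMap.add_apply, add_mul]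
  exact (norm_add_le _ _).trans (add_le_add (norm_kTensor_le π σ u v) (norm_kTensor_le π σ w v))

theorem hNorm_smul_le (c : ℂ) (u : X ⊗[ℂ] C) : hNorm A (c • u) ≤ ‖c‖ * hNorm A u := by
  refine hNorm_le (mul_nonneg (norm_nonneg _) (hNorm_nonneg _)) ?_
  intro H K _ _ _ _ _ _ π σ v
  rw [map_smul, LinearMap.smul_apply, norm_smul, mul_assoc]
  exact mul_le_mul_of_nonneg_left (norm_kTensor_le π σ u v) (norm_nonneg _)

theorem minNorm_tInner_le (u w : X ⊗[ℂ] C) :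
    minNorm (tInner A X C u w) ≤ hNorm A u * hNorm A w := by
  refine minNorm_le_of_inner (mul_nonneg (hNorm_nonneg _) (hNorm_nonneg _)) ?_
  intro H K _ _ _ _ _ _ π σ v v'
  rw [← inner_kTensor]
  calc _ ≤ ‖kTensor π σ u v‖ * ‖kTensor π σ w v'‖ := norm_inner_le_norm (𝕜 := ℂ) _ _
    _ ≤ (hNorm A u * ‖v‖) * (hNorm A w * ‖v'‖) :=
      mul_le_mul (norm_kTensor_le π σ u v) (norm_kTensor_le π σ w v') (norm_nonneg _)
        (mul_nonneg (hNorm_nonneg _) (norm_nonneg _))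
    _ = _ := by ring

theorem hNorm_tAct_le (u : X ⊗[ℂ] C) (t : A ⊗[ℂ] C) :
    hNorm A (tAct A X C u t) ≤ hNorm A u * minNorm t := by
  refine hNorm_le (mul_nonneg (hNorm_nonneg _) (minNorm_nonneg _)) ?_
  intro H K _ _ _ _ _ _ π σ v
  rw [kTensor_act, mul_assoc]
  exact (norm_kTensor_le π σ u _).trans
    (mul_le_mul_of_nonneg_left (repTensor_le_minNorm π σ t v) (hNorm_nonneg _))

variable (X C) in
/-- The operators `1 ⊗ c` on `X ⊙ C`. -/
def tOne : C →ₗ[ℂ] X ⊗[ℂ] C →ₗ[ℂ] X ⊗[ℂ] C :=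
  LinearMap.lTensorHom X ∘ₗ LinearMap.mul ℂ C

theorem tOne_tmul (c d : C) (x : X) : tOne X C c (x ⊗ₜ d) = x ⊗ₜ (c * d) := rfl

theorem kTensor_tOne {H K : Type u} [NormedAddCommGroup H] [InnerProductSpace ℂ H]
    [CompleteSpace H] [NormedAddCommGroup K] [InnerProductSpace ℂ K] [CompleteSpace K]
    (π : A →⋆ₙₐ[ℂ] (H →L[ℂ] H)) (σ : C →⋆ₙₐ[ℂ] (K →L[ℂ] K)) (c : C) (u : X ⊗[ℂ] C)
    (v : H ⊗[ℂ] K) : kTensor π σ (tOne X C c u) v =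
      TensorProduct.map LinearMap.id (σ c : K →ₗ[ℂ] K) (kTensor π σ u v) := by
  induction u with
  | zero => simp
  | add u₁ u₂ h₁ h₂ => simp only [map_add, LinearMap.add_apply, h₁, h₂]
  | tmul x d =>
    induction v with
    | zero => simp
    | add v₁ v₂ h₁ h₂ => simp only [map_add, h₁, h₂]
    | tmul h k =>
      rw [tOne_tmul, kTensor_tmul, kTensor_tmul, map_mul, TensorProduct.map_tmul]; rfl

theorem hNorm_tOne_le (c : C) (u : X ⊗[ℂ] C) : hNorm A (tOne X C c u) ≤ ‖c‖ * hNorm A u := by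
  refine hNorm_le (mul_nonneg (norm_nonneg _) (hNorm_nonneg _)) ?_
  intro H K _ _ _ _ _ _ π σ v
  rw [kTensor_tOne, mul_assoc]
  refine (norm_id_map_le _ _).trans ?_
  exact mul_le_mul (NonUnitalStarAlgHom.norm_apply_le σ c) (norm_kTensor_le π σ u v)
    (norm_nonneg _) (norm_nonneg _)

section LeftAct

variable {B : Type u} [NonUnitalCStarAlgebra B] (L : LeftAction B A X)

variable (C) in
/-- The left action of `B ⊙ C` on `X ⊙ C`. -/
def tLeft : B ⊗[ℂ] C →ₗ[ℂ] X ⊗[ℂ] C →ₗ[ℂ] X ⊗[ℂ] C :=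
  TensorProduct.map₂ L.act (LinearMap.mul ℂ C)

theorem tLeft_tmul (b : B) (c d : C) (x : X) :
    tLeft C L (b ⊗ₜ c) (x ⊗ₜ d) = L.act b x ⊗ₜ (c * d) := rfl

theorem kTensor_tLeft {H K : Type u} [NormedAddCommGroup H] [InnerProductSpace ℂ H]
    [CompleteSpace H] [NormedAddCommGroup K] [InnerProductSpace ℂ K] [CompleteSpace K]
    (π : A →⋆ₙₐ[ℂ] (H →L[ℂ] H)) (σ : C →⋆ₙₐ[ℂ] (K →L[ℂ] K)) (t : B ⊗[ℂ] C) (u : X ⊗[ℂ] C)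
    (v : H ⊗[ℂ] K) : kTensor π σ (tLeft C L t u) v =
      repTensor (indRep π L) σ t (kTensor π σ u v) := by
  induction u with
  | zero => simp
  | add u₁ u₂ h₁ h₂ => simp only [map_add, LinearMap.add_apply, h₁, h₂]
  | tmul x d =>
    induction t with
    | zero => simp
    | add t₁ t₂ h₁ h₂ => simp only [map_add, LinearMap.add_apply, h₁, h₂]
    | tmul b c =>
      induction v with
      | zero => simp
      | add v₁ v₂ h₁ h₂ => simp only [map_add, h₁, h₂]
      | tmul h k =>
        rw [tLeft_tmul, kTensor_tmul, kTensor_tmul, repTensor_tmul_tmul, indRep_kmap, map_mul,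
          mul_apply_eq_comp]

theorem hNorm_tLeft_le (t : B ⊗[ℂ] C) (u : X ⊗[ℂ] C) :
    hNorm A (tLeft C L t u) ≤ minNorm t * hNorm A u := by
  refine hNorm_le (mul_nonneg (minNorm_nonneg _) (hNorm_nonneg _)) ?_
  intro H K _ _ _ _ _ _ π σ v
  rw [kTensor_tLeft, mul_assoc]
  exact (repTensor_le_minNorm _ σ t _).trans
    (mul_le_mul_of_nonneg_left (norm_kTensor_le π σ u v) (minNorm_nonneg _))

end LeftAct

/-- The algebraic tensor product `X ⊙ C`, as a type carrying the norm `‖⟨u, u⟩‖^{1/2}`. -/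
@[nolint unusedArguments]
def HilbPre (A X C : Type u) [NonUnitalCStarAlgebra A] [NonUnitalCStarAlgebra C]
    [NormedAddCommGroup X] [NormedSpace ℂ X] [CompleteSpace X] [HilbertModule A X] : Type u := X ⊗[ℂ] C

instance : AddCommGroup (HilbPre A X C) := inferInstanceAs (AddCommGroup (X ⊗[ℂ] C))
instance : Module ℂ (HilbPre A X C) := inferInstanceAs (Module ℂ (X ⊗[ℂ] C))

instance : SeminormedAddCommGroup (HilbPre A X C) :=
  AddGroupSeminorm.toSeminormedAddCommGroup (E := HilbPre A X C)
    { toFun := fun u => hNorm A (X := X) (C := C) u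
      map_zero' := le_antisymm (by
        have h := hNorm_smul_le (A := A) (X := X) (C := C) 0 0
        simp only [zero_smul, norm_zero, zero_mul] at h
        exact h) (hNorm_nonneg _)
      add_le' := hNorm_add_le (A := A) (X := X) (C := C)
      neg' := fun t => by
        have h : ∀ s : X ⊗[ℂ] C, hNorm A (-s) ≤ hNorm A s := fun s => by
          have := hNorm_smul_le (A := A) (-1) s
          rwa [neg_one_smul, norm_neg, norm_one, one_mul] at this
        exact le_antisymm (h t)
          ((congrArg (hNorm A) (neg_neg (G := X ⊗[ℂ] C) t)).symm.le.trans (h (-t))) }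

instance : NormedSpace ℂ (HilbPre A X C) where
  norm_smul_le := hNorm_smul_le (A := A) (X := X) (C := C)

/-- The external tensor product `X ⊗ C`, a Hilbert module over `A ⊗ C`. -/
def HilbTensor (A X C : Type u) [NonUnitalCStarAlgebra A] [NonUnitalCStarAlgebra C]
    [NormedAddCommGroup X] [NormedSpace ℂ X] [CompleteSpace X] [HilbertModule A X] : Type u := Completion (HilbPre A X C)

namespace HilbTensor

instance : NormedAddCommGroup (HilbTensor A X C) :=
  inferInstanceAs (NormedAddCommGroup (Completion (HilbPre A X C)))
instance : NormedSpace ℂ (HilbTensor A X C) :=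
  inferInstanceAs (NormedSpace ℂ (Completion (HilbPre A X C)))
instance : CompleteSpace (HilbTensor A X C) :=
  inferInstanceAs (CompleteSpace (Completion (HilbPre A X C)))

variable (A) in
/-- The canonical map of the algebraic tensor product into `X ⊗ C`. -/
def of : X ⊗[ℂ] C →ₗ[ℂ] HilbTensor A X C :=
  (Completion.toComplL : HilbPre A X C →L[ℂ] Completion (HilbPre A X C)).toLinearMap

variable (A) in
/-- The elementary tensor `x ⊗ c`. -/
def tmul (x : X) (c : C) : HilbTensor A X C := of A (x ⊗ₜ[ℂ] c)

theorem norm_of (t : X ⊗[ℂ] C) : ‖of A t‖ = hNorm A t :=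
  Completion.norm_coe (E := HilbPre A X C) t

theorem induction {p : HilbTensor A X C → Prop} (x : HilbTensor A X C) (hp : IsClosed {x | p x})
    (ih : ∀ t : X ⊗[ℂ] C, p (of A t)) : p x :=
  Completion.induction_on (α := HilbPre A X C) x hp ih

/-- The right action of `A ⊗ C` on `X ⊗ C`. -/
def actL : HilbTensor A X C →L[ℂ] MinTensor A C →L[ℂ] HilbTensor A X C :=
  bilinExt (E := HilbPre A X C) (F := MinPre A C) (G := HilbPre A X C) (tAct A X C)
    (hNorm_tAct_le (A := A) (X := X) (C := C))

/-- The `A ⊗ C`-valued inner product on `X ⊗ C`. -/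
def innerL : HilbTensor A X C →SL[starRingEnd ℂ] HilbTensor A X C →L[ℂ] MinTensor A C :=
  bilinExt (E := HilbPre A X C) (F := HilbPre A X C) (G := MinPre A C) (tInner A X C)
    (minNorm_tInner_le (A := A) (X := X) (C := C))

/-- The operator `1 ⊗ c` on `X ⊗ C`. -/
def oneAct (c : C) : HilbTensor A X C →L[ℂ] HilbTensor A X C :=
  extAux (E := C) (F := HilbPre A X C) (G := HilbPre A X C) (tOne X C)
    (hNorm_tOne_le (A := A) (X := X) (C := C)) c

theorem actL_of (u : X ⊗[ℂ] C) (t : A ⊗[ℂ] C) :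
    actL (of A u) (MinTensor.of t) = of A (tAct A X C u t) :=
  bilinExt_coe (E := HilbPre A X C) (F := MinPre A C) (G := HilbPre A X C) (tAct A X C)
    (hNorm_tAct_le (A := A) (X := X) (C := C)) u t

theorem innerL_of (u w : X ⊗[ℂ] C) :
    innerL (of A u) (of A w) = MinTensor.of (tInner A X C u w) :=
  bilinExt_coe (E := HilbPre A X C) (F := HilbPre A X C) (G := MinPre A C) (tInner A X C)
    (minNorm_tInner_le (A := A) (X := X) (C := C)) u w

theorem oneAct_of (c : C) (u : X ⊗[ℂ] C) :
    oneAct c (of A u) = of A (tOne X C c u) :=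
  extAux_coe (E := C) (F := HilbPre A X C) (G := HilbPre A X C) (tOne X C)
    (hNorm_tOne_le (A := A) (X := X) (C := C)) c u

theorem tAct_mul (u : X ⊗[ℂ] C) (s t : A ⊗[ℂ] C) :
    tAct A X C u (s * t) = tAct A X C (tAct A X C u s) t := by
  induction u with
  | zero => simp
  | add u₁ u₂ h₁ h₂ => simp only [map_add, LinearMap.add_apply, h₁, h₂]
  | tmul x c =>
    induction s with
    | zero => simp
    | add s₁ s₂ h₁ h₂ => simp only [add_mul, map_add, LinearMap.add_apply, h₁, h₂]
    | tmul a d =>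
      induction t with
      | zero => simp
      | add t₁ t₂ h₁ h₂ => simp only [mul_add, map_add, h₁, h₂]
      | tmul a' d' =>
        rw [Algebra.TensorProduct.tmul_mul_tmul, tAct_tmul, tAct_tmul, tAct_tmul,
          HilbertModule.act_mul, mul_assoc]

theorem tInner_act (u w : X ⊗[ℂ] C) (t : A ⊗[ℂ] C) :
    tInner A X C u (tAct A X C w t) = tInner A X C u w * t := by
  induction u with
  | zero => simp
  | add u₁ u₂ h₁ h₂ => simp only [map_add, LinearMap.add_apply, h₁, h₂, add_mul]
  | tmul x c =>
    induction w with
    | zero => simp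
    | add s₁ s₂ h₁ h₂ => simp only [add_mul, map_add, LinearMap.add_apply, h₁, h₂]
    | tmul a d =>
      induction t with
      | zero => simp
      | add t₁ t₂ h₁ h₂ => simp only [mul_add, map_add, h₁, h₂]
      | tmul a' d' =>
        rw [tAct_tmul, tInner_tmul, tInner_tmul, Algebra.TensorProduct.tmul_mul_tmul,
          HilbertModule.inner_act, mul_assoc]

theorem tInner_star (u w : X ⊗[ℂ] C) : star (tInner A X C u w) = tInner A X C w u := by
  induction u with
  | zero => simp
  | add u₁ u₂ h₁ h₂ => simp only [map_add, LinearMap.add_apply, h₁, h₂, star_add]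
  | tmul x c =>
    induction w with
    | zero => simp
    | add s₁ s₂ h₁ h₂ => simp only [star_add, map_add, LinearMap.add_apply, h₁, h₂]
    | tmul a d =>
      rw [tInner_tmul, tInner_tmul, TensorProduct.star_tmul, HilbertModule.star_inner, star_mul,
        star_star]

theorem tInner_pos (u : X ⊗[ℂ] C) : ∃ (n : ℕ) (w : Fin n → A ⊗[ℂ] C),
    tInner A X C u u = ∑ k, star (w k) * w k := by
  obtain ⟨n, x, c, rfl⟩ : ∃ (n : ℕ) (x : Fin n → X) (c : Fin n → C), u = ∑ i, x i ⊗ₜ[ℂ] c i := by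
    obtain ⟨s, rfl⟩ := TensorProduct.exists_finset u
    refine ⟨s.card, fun i => (s.equivFin.symm i).1.1, fun i => (s.equivFin.symm i).1.2, ?_⟩
    rw [← Finset.sum_coe_sort s (fun p : X × C => p.1 ⊗ₜ[ℂ] p.2)]
    exact (Equiv.sum_comp s.equivFin.symm (fun p : s => p.1.1 ⊗ₜ[ℂ] p.1.2)).symm
  obtain ⟨N, hN⟩ := exists_gram (A := A) x
  refine ⟨n, fun k => ∑ i, N k i ⊗ₜ[ℂ] c i, ?_⟩
  simp only [map_sum, LinearMap.sum_apply, tInner_tmul, hN, star_sum, Finset.sum_mul_sum,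
    TensorProduct.star_tmul, Algebra.TensorProduct.tmul_mul_tmul, TensorProduct.sum_tmul]
  conv_lhs => enter [2, y]; rw [Finset.sum_comm]
  rw [Finset.sum_comm]
  refine Finset.sum_congr rfl fun k _ => ?_
  rw [Finset.sum_comm]

instance : HilbertModule (MinTensor A C) (HilbTensor A X C) where
  act := LinearMap.mk₂'ₛₗ (RingHom.id ℂ) (RingHom.id ℂ) (fun u t => actL u t)
    (fun u v t => by simp) (fun c u t => by simp) (fun u t s => by simp) (fun c u t => by simp)
  inner := LinearMap.mk₂'ₛₗ (starRingEnd ℂ) (RingHom.id ℂ) (fun u w => innerL u w)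
    (fun u v t => by simp) (fun c u t => by simp) (fun u t s => by simp) (fun c u t => by simp)
  act_mul u s t := by
    change actL u (s * t) = actL (actL u s) t
    refine induction (p := fun u => actL u (s * t) = actL (actL u s) t) u
      (isClosed_eq (by fun_prop) (by fun_prop)) fun u => ?_
    refine MinTensor.induction₂ (p := fun s t => actL (of A u) (s * t) = actL (actL (of A u) s) t)
      s t (isClosed_eq (by fun_prop) (by fun_prop)) fun s t => ?_
    rw [← MinTensor.of_mul, actL_of, actL_of, actL_of, tAct_mul]
  inner_act u w t := by
    change innerL u (actL w t) = innerL u w * t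
    refine induction (p := fun u => innerL u (actL w t) = innerL u w * t) u
      (isClosed_eq (by fun_prop) (by fun_prop)) fun u => ?_
    refine induction (p := fun w => innerL (of A u) (actL w t) = innerL (of A u) w * t) w
      (isClosed_eq (by fun_prop) (by fun_prop)) fun w => ?_
    refine MinTensor.induction (p := fun t => innerL (of A u) (actL (of A w) t) =
      innerL (of A u) (of A w) * t) t (isClosed_eq (by fun_prop) (by fun_prop)) fun t => ?_
    rw [actL_of, innerL_of, innerL_of, ← MinTensor.of_mul, tInner_act]
  star_inner u w := by
    change star (innerL u w) = innerL w u
    refine induction (p := fun u => star (innerL u w) = innerL w u) u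
      (isClosed_eq (by fun_prop) (by fun_prop)) fun u => ?_
    refine induction (p := fun w => star (innerL (of A u) w) = innerL w (of A u)) w
      (isClosed_eq (by fun_prop) (by fun_prop)) fun w => ?_
    rw [innerL_of, innerL_of, ← MinTensor.of_star, tInner_star]
  inner_self_pos u := by
    change ∃ a, innerL u u = star a * a
    let _ := CStarAlgebra.spectralOrder (MinTensor A C)
    have _ := CStarAlgebra.spectralOrderedRing (MinTensor A C)
    refine CStarAlgebra.nonneg_iff_eq_star_mul_self.1 ?_
    refine induction (p := fun u => 0 ≤ innerL u u) u
      (isClosed_le (by fun_prop) (by fun_prop)) fun u => ?_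
    obtain ⟨n, w, hw⟩ := tInner_pos (A := A) u
    rw [innerL_of, hw, map_sum]
    refine Finset.sum_nonneg fun k _ => ?_
    rw [MinTensor.of_mul, MinTensor.of_star]
    exact star_mul_self_nonneg _
  norm_sq u := by
    change ‖u‖ ^ 2 = ‖innerL u u‖
    refine induction (p := fun u => ‖u‖ ^ 2 = ‖innerL u u‖) u
      (isClosed_eq (by fun_prop) (by fun_prop)) fun u => ?_
    rw [innerL_of, norm_of, MinTensor.norm_of, hNorm_sq]

theorem inner_def (u w : HilbTensor A X C) :
    HilbertModule.inner (A := MinTensor A C) u w = innerL u w := rfl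

theorem act_def (u : HilbTensor A X C) (t : MinTensor A C) :
    HilbertModule.act u t = actL u t := rfl

section LeftAct

variable {B : Type u} [NonUnitalCStarAlgebra B] (L : LeftAction B A X)

variable (C) in
/-- The left action of `B ⊗ C` on `X ⊗ C`, continuous in both variables. -/
def leftL : MinTensor B C →L[ℂ] HilbTensor A X C →L[ℂ] HilbTensor A X C :=
  bilinExt (E := MinPre B C) (F := HilbPre A X C) (G := HilbPre A X C) (tLeft C L)
    (hNorm_tLeft_le (A := A) (X := X) (C := C) L)

theorem leftL_of (t : B ⊗[ℂ] C) (u : X ⊗[ℂ] C) :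
    leftL C L (MinTensor.of t) (of A u) = of A (tLeft C L t u) :=
  bilinExt_coe (E := MinPre B C) (F := HilbPre A X C) (G := HilbPre A X C) (tLeft C L)
    (hNorm_tLeft_le (A := A) (X := X) (C := C) L) t u

theorem tLeft_mul (s t : B ⊗[ℂ] C) (u : X ⊗[ℂ] C) :
    tLeft C L (s * t) u = tLeft C L s (tLeft C L t u) := by
  induction u with
  | zero => simp
  | add u₁ u₂ h₁ h₂ => simp only [map_add, h₁, h₂]
  | tmul x c =>
    induction s with
    | zero => simp
    | add s₁ s₂ h₁ h₂ => simp only [add_mul, map_add, LinearMap.add_apply, h₁, h₂]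
    | tmul a d =>
      induction t with
      | zero => simp
      | add t₁ t₂ h₁ h₂ => simp only [mul_add, map_add, LinearMap.add_apply, h₁, h₂]
      | tmul a' d' =>
        rw [Algebra.TensorProduct.tmul_mul_tmul, tLeft_tmul, tLeft_tmul, tLeft_tmul, L.mul_act,
          mul_assoc]

theorem tInner_tLeft (t : B ⊗[ℂ] C) (u w : X ⊗[ℂ] C) :
    tInner A X C (tLeft C L t u) w = tInner A X C u (tLeft C L (star t) w) := by
  induction u with
  | zero => simp
  | add u₁ u₂ h₁ h₂ => simp only [map_add, LinearMap.add_apply, h₁, h₂]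
  | tmul x c =>
    induction w with
    | zero => simp
    | add s₁ s₂ h₁ h₂ => simp only [map_add, h₁, h₂]
    | tmul y d =>
      induction t with
      | zero => simp
      | add t₁ t₂ h₁ h₂ => simp only [star_add, map_add, LinearMap.add_apply, h₁, h₂]
      | tmul b d' =>
        rw [TensorProduct.star_tmul, tLeft_tmul, tLeft_tmul, tInner_tmul, tInner_tmul,
          L.inner_act_left, star_mul, mul_assoc]

variable (C) in
/-- The left action of `B ⊗ C` on `X ⊗ C` extending a left action of `B` on `X`. -/
def leftAction : LeftAction (MinTensor B C) (MinTensor A C) (HilbTensor A X C) where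
  act := LinearMap.mk₂'ₛₗ (RingHom.id ℂ) (RingHom.id ℂ) (fun t u => leftL C L t u)
    (fun u v t => by simp) (fun c u t => by simp) (fun u t s => by simp) (fun c u t => by simp)
  mul_act s t u := by
    change leftL C L (s * t) u = leftL C L s (leftL C L t u)
    refine induction (p := fun u => leftL C L (s * t) u = leftL C L s (leftL C L t u)) u
      (isClosed_eq (by fun_prop) (by fun_prop)) fun u => ?_
    refine MinTensor.induction₂ (p := fun s t => leftL C L (s * t) (of A u) =
      leftL C L s (leftL C L t (of A u)))
      s t (isClosed_eq (by fun_prop) (by fun_prop)) fun s t => ?_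
    rw [← MinTensor.of_mul, leftL_of, leftL_of, leftL_of, tLeft_mul]
  inner_act_left t u w := by
    change innerL (leftL C L t u) w = innerL u (leftL C L (star t) w)
    refine induction (p := fun u => innerL (leftL C L t u) w = innerL u (leftL C L (star t) w)) u
      (isClosed_eq (by fun_prop) (by fun_prop)) fun u => ?_
    refine induction (p := fun w => innerL (leftL C L t (of A u)) w =
      innerL (of A u) (leftL C L (star t) w)) w
      (isClosed_eq (by fun_prop) (by fun_prop)) fun w => ?_
    refine MinTensor.induction (p := fun t => innerL (leftL C L t (of A u)) (of A w) =
      innerL (of A u) (leftL C L (star t) (of A w))) t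
      (isClosed_eq (by fun_prop) (by fun_prop)) fun t => ?_
    rw [← MinTensor.of_star, leftL_of, leftL_of, innerL_of, innerL_of, tInner_tLeft]

end LeftAct

variable (A X C) in
/-- The left action of `C` on `X ⊗ C` through the operators `1 ⊗ c`. -/
def oneAction : LeftAction C (MinTensor A C) (HilbTensor A X C) where
  act := LinearMap.mk₂'ₛₗ (RingHom.id ℂ) (RingHom.id ℂ) (fun c u => oneAct c u)
    (fun c d u => extAux_add (E := C) (F := HilbPre A X C) (G := HilbPre A X C) _ _ c d u)
    (fun r c u => extAux_smul (E := C) (F := HilbPre A X C) (G := HilbPre A X C) _ _ r c u)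
    (fun u t s => by simp) (fun c u t => by simp)
  mul_act c d u := by
    change oneAct (c * d) u = oneAct c (oneAct d u)
    refine induction (p := fun u => oneAct (c * d) u = oneAct c (oneAct d u)) u
      (isClosed_eq (by fun_prop) (by fun_prop)) fun u => ?_
    rw [oneAct_of, oneAct_of, oneAct_of]
    congr 1
    induction u with
    | zero => simp
    | add u₁ u₂ h₁ h₂ => simp only [map_add, h₁, h₂]
    | tmul x e => rw [tOne_tmul, tOne_tmul, tOne_tmul, mul_assoc]
  inner_act_left c u w := by
    change innerL (oneAct c u) w = innerL u (oneAct (star c) w)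
    refine induction (p := fun u => innerL (oneAct c u) w = innerL u (oneAct (star c) w)) u
      (isClosed_eq (by fun_prop) (by fun_prop)) fun u => ?_
    refine induction (p := fun w => innerL (oneAct c (of A u)) w =
      innerL (of A u) (oneAct (star c) w)) w
      (isClosed_eq (by fun_prop) (by fun_prop)) fun w => ?_
    rw [oneAct_of, oneAct_of, innerL_of, innerL_of]
    congr 1
    induction u with
    | zero => simp
    | add u₁ u₂ h₁ h₂ => simp only [map_add, LinearMap.add_apply, h₁, h₂]
    | tmul x e =>
      induction w with
      | zero => simp
      | add s₁ s₂ h₁ h₂ => simp only [map_add, h₁, h₂]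
      | tmul y d =>
        rw [tOne_tmul, tOne_tmul, tInner_tmul, tInner_tmul, star_mul, mul_assoc]

end HilbTensor

end ExternalTensorProduct

end HilbertModules

section Multipliers

/-- A C*-algebra as a Hilbert module over itself, `⟨x, y⟩ = x* y`. -/
instance selfModule (E : Type*) [NonUnitalCStarAlgebra E] : HilbertModule E E where
  act := LinearMap.mul ℂ E
  inner := starMul
  act_mul x a b := (mul_assoc x a b).symm
  inner_act x y a := (mul_assoc (star x) y a).symm
  star_inner x y := by
    change star (star x * y) = star y * x
    rw [star_mul, star_star]
  inner_self_pos x := ⟨x, rfl⟩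
  norm_sq x := by
    change ‖x‖ ^ 2 = ‖star x * x‖
    rw [CStarRing.norm_star_mul_self, sq]

variable {D E : Type u} [NonUnitalCStarAlgebra D] [NonUnitalCStarAlgebra E]

theorem self_inner_def (x y : E) : HilbertModule.inner (A := E) x y = star x * y := rfl

theorem multiplier_ext {m n : 𝓜(ℂ, E)} (h : ∀ x, m.fst x = n.fst x) : m = n := by
  have h1 : (m - n).fst = 0 := by
    ext x
    change m.fst x - n.fst x = 0
    rw [h, sub_self]
  have h2 := DoubleCentralizer.norm_fst (m - n)
  rw [h1, norm_zero] at h2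
  exact sub_eq_zero.1 (norm_eq_zero.1 h2.symm)

/-- The homomorphism into the multiplier algebra given by a contractive left action by adjointable
operators: `d ↦ (e ↦ d · e)`. -/
def multOf (L : LeftAction D E E) (hL : ∀ d e, ‖L.act d e‖ ≤ ‖d‖ * ‖e‖) : D →⋆ₙₐ[ℂ] 𝓜(ℂ, E) where
  toFun d :=
    { fst := (L.act d).mkContinuous ‖d‖ (hL d)
      snd := LinearMap.mkContinuous
        { toFun := fun y => star (L.act (star d) (star y))
          map_add' := fun x y => by simp
          map_smul' := fun c x => by simp } ‖d‖ (fun y => by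
            change ‖star (L.act (star d) (star y))‖ ≤ _
            rw [norm_star]
            simpa using hL (star d) (star y))
      central := fun x y => by
        change star (L.act (star d) (star x)) * y = x * L.act d y
        rw [← self_inner_def, L.inner_act_left, self_inner_def, star_star, star_star] }
  map_smul' c d := multiplier_ext fun x => LinearMap.map_smul₂ L.act c d x
  map_zero' := multiplier_ext fun x => LinearMap.map_zero₂ L.act x
  map_add' c d := multiplier_ext fun x => LinearMap.map_add₂ L.act c d x
  map_mul' c d := multiplier_ext fun x => L.mul_act c d x
  map_star' d := multiplier_ext fun x => by
    rw [DoubleCentralizer.star_fst]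
    change L.act (star d) x = star (star (L.act (star d) (star (star x))))
    rw [star_star, star_star]

theorem multOf_fst (L : LeftAction D E E) (hL : ∀ d e, ‖L.act d e‖ ≤ ‖d‖ * ‖e‖) (d : D) (e : E) :
    (multOf L hL d).fst e = L.act d e := rfl

/-- The left action `d · e = φ(d) e`. -/
def actOfHom (φ : D →⋆ₙₐ[ℂ] 𝓜(ℂ, E)) : LeftAction D E E where
  act := LinearMap.mk₂'ₛₗ (RingHom.id ℂ) (RingHom.id ℂ) (fun d e => (φ d).fst e)
    (fun c d e => by simp) (fun r d e => by simp) (fun d e f => by simp) (fun r d e => by simp)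
  mul_act c d e := by
    change (φ (c * d)).fst e = (φ c).fst ((φ d).fst e)
    rw [map_mul]; rfl
  inner_act_left d x y := by
    change star ((φ d).fst x) * y = star x * (φ (star d)).fst y
    rw [map_star, ← DoubleCentralizer.central, DoubleCentralizer.star_snd, star_star]

variable {C : Type u} [NonUnitalCStarAlgebra C]

theorem tInner_self (u w : E ⊗[ℂ] C) : tInner E E C u w = star u * w := by
  induction u with
  | zero => simp
  | add u₁ u₂ h₁ h₂ => simp only [map_add, LinearMap.add_apply, h₁, h₂, star_add, add_mul]
  | tmul x c =>
    induction w with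
    | zero => simp
    | add s₁ s₂ h₁ h₂ => simp only [map_add, h₁, h₂, mul_add]
    | tmul y d =>
      rw [TensorProduct.star_tmul, Algebra.TensorProduct.tmul_mul_tmul]; rfl

theorem hNorm_self (u : E ⊗[ℂ] C) : hNorm E u = minNorm u := by
  have h : minNorm (star u * u) = minNorm u * minNorm u :=
    le_antisymm ((minNorm_mul_le _ _).trans (by rw [minNorm_star])) (minNorm_sq_le u)
  rw [hNorm, tInner_self, h, Real.sqrt_mul_self (minNorm_nonneg u)]

theorem minNorm_tLeft_le (L : LeftAction D E E) (t : D ⊗[ℂ] C) (u : E ⊗[ℂ] C) :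
    minNorm (tLeft C L t u) ≤ minNorm t * minNorm u := by
  rw [← hNorm_self, ← hNorm_self u]; exact hNorm_tLeft_le L t u

theorem minNorm_tOne_le (c : C) (u : E ⊗[ℂ] C) : minNorm (tOne E C c u) ≤ ‖c‖ * minNorm u := by
  rw [← hNorm_self, ← hNorm_self u]; exact hNorm_tOne_le c u

/-- The action of `D ⊗ C` on `E ⊗ C` for a left action of `D` on `E`. -/
def leftSelf (L : LeftAction D E E) :
    MinTensor D C →L[ℂ] MinTensor E C →L[ℂ] MinTensor E C :=
  bilinExt (E := MinPre D C) (F := MinPre E C) (G := MinPre E C) (tLeft C L)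
    (minNorm_tLeft_le (C := C) L)

theorem leftSelf_of (L : LeftAction D E E) (t : D ⊗[ℂ] C) (u : E ⊗[ℂ] C) :
    leftSelf L (MinTensor.of t) (MinTensor.of u) = MinTensor.of (tLeft C L t u) :=
  bilinExt_coe (E := MinPre D C) (F := MinPre E C) (G := MinPre E C) (tLeft C L)
    (minNorm_tLeft_le (C := C) L) t u

variable (C) in
/-- `leftSelf` as a left action. -/
def leftSelfAction (L : LeftAction D E E) :
    LeftAction (MinTensor D C) (MinTensor E C) (MinTensor E C) where
  act := LinearMap.mk₂'ₛₗ (RingHom.id ℂ) (RingHom.id ℂ) (fun t u => leftSelf L t u)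
    (fun u v t => by simp) (fun c u t => by simp) (fun u t s => by simp) (fun c u t => by simp)
  mul_act s t u := by
    change leftSelf L (s * t) u = leftSelf L s (leftSelf L t u)
    refine MinTensor.induction (p := fun u => leftSelf L (s * t) u =
      leftSelf L s (leftSelf L t u)) u
      (isClosed_eq (by fun_prop) (by fun_prop)) fun u => ?_
    refine MinTensor.induction₂ (p := fun s t => leftSelf L (s * t) (MinTensor.of u) =
      leftSelf L s (leftSelf L t (MinTensor.of u))) s t
      (isClosed_eq (by fun_prop) (by fun_prop)) fun s t => ?_
    rw [← MinTensor.of_mul, leftSelf_of, leftSelf_of, leftSelf_of, HilbTensor.tLeft_mul]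
  inner_act_left t u w := by
    change star (leftSelf L t u) * w = star u * leftSelf L (star t) w
    refine MinTensor.induction₂ (p := fun u w => star (leftSelf L t u) * w =
      star u * leftSelf L (star t) w) u w
      (isClosed_eq (by fun_prop) (by fun_prop)) fun u w => ?_
    refine MinTensor.induction (p := fun t => star (leftSelf L t (MinTensor.of u)) *
      MinTensor.of w = star (MinTensor.of u) * leftSelf L (star t) (MinTensor.of w)) t
      (isClosed_eq (by fun_prop) (by fun_prop)) fun t => ?_
    rw [← MinTensor.of_star t, leftSelf_of, leftSelf_of, ← MinTensor.of_star, ← MinTensor.of_star,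
      ← MinTensor.of_mul, ← MinTensor.of_mul, ← tInner_self, ← tInner_self,
      HilbTensor.tInner_tLeft]

variable (C) in
/-- For a homomorphism `φ : D → M(E)`, the homomorphism `φ ⊗ id : D ⊗ C → M(E ⊗ C)` with
`(φ ⊗ id)(d ⊗ c) (e ⊗ c') = φ(d)e ⊗ cc'`. -/
def tensorId (φ : D →⋆ₙₐ[ℂ] 𝓜(ℂ, E)) : MinTensor D C →⋆ₙₐ[ℂ] 𝓜(ℂ, MinTensor E C) :=
  multOf (leftSelfAction C (actOfHom φ))
    (bilinExt_bound (E := MinPre D C) (F := MinPre E C) (G := MinPre E C) (tLeft C (actOfHom φ))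
      (minNorm_tLeft_le (C := C) (actOfHom φ)))

theorem tensorId_tmul (φ : D →⋆ₙₐ[ℂ] 𝓜(ℂ, E)) (d : D) (c : C) (e : E) (c' : C) :
    (tensorId C φ (MinTensor.tmul d c)).fst (MinTensor.tmul e c') =
      MinTensor.tmul ((φ d).fst e) (c * c') :=
  leftSelf_of (actOfHom φ) (d ⊗ₜ c) (e ⊗ₜ c')

/-- The operator `1 ⊗ c` on `E ⊗ C`. -/
def oneSelf (c : C) : MinTensor E C →L[ℂ] MinTensor E C :=
  extAux (E := C) (F := MinPre E C) (G := MinPre E C) (tOne E C)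
    (minNorm_tOne_le (E := E) (C := C)) c

theorem oneSelf_of (c : C) (u : E ⊗[ℂ] C) :
    oneSelf c (MinTensor.of u) = MinTensor.of (tOne E C c u) :=
  extAux_coe (E := C) (F := MinPre E C) (G := MinPre E C) (tOne E C)
    (minNorm_tOne_le (E := E) (C := C)) c u

variable (E C) in
/-- `oneSelf` as a left action. -/
def oneSelfAction : LeftAction C (MinTensor E C) (MinTensor E C) where
  act := LinearMap.mk₂'ₛₗ (RingHom.id ℂ) (RingHom.id ℂ) (fun c u => oneSelf c u)
    (fun c d u => extAux_add (E := C) (F := MinPre E C) (G := MinPre E C) _ _ c d u)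
    (fun r c u => extAux_smul (E := C) (F := MinPre E C) (G := MinPre E C) _ _ r c u)
    (fun u t s => by simp) (fun c u t => by simp)
  mul_act c d u := by
    change oneSelf (c * d) u = oneSelf c (oneSelf d u)
    refine MinTensor.induction (p := fun u => oneSelf (c * d) u = oneSelf c (oneSelf d u)) u
      (isClosed_eq (by fun_prop) (by fun_prop)) fun u => ?_
    rw [oneSelf_of, oneSelf_of, oneSelf_of]
    congr 1
    induction u with
    | zero => simp
    | add u₁ u₂ h₁ h₂ => simp only [map_add, h₁, h₂]
    | tmul x e => rw [tOne_tmul, tOne_tmul, tOne_tmul, mul_assoc]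
  inner_act_left c u w := by
    change star (oneSelf c u) * w = star u * oneSelf (star c) w
    refine MinTensor.induction₂ (p := fun u w => star (oneSelf c u) * w =
      star u * oneSelf (star c) w) u w
      (isClosed_eq (by fun_prop) (by fun_prop)) fun u w => ?_
    rw [oneSelf_of, oneSelf_of, ← MinTensor.of_star, ← MinTensor.of_star, ← MinTensor.of_mul,
      ← MinTensor.of_mul]
    congr 1
    induction u with
    | zero => simp
    | add u₁ u₂ h₁ h₂ => simp only [map_add, star_add, add_mul, h₁, h₂]
    | tmul x e =>
      induction w with
      | zero => simp
      | add s₁ s₂ h₁ h₂ => simp only [map_add, mul_add, h₁, h₂]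
      | tmul y d =>
        rw [tOne_tmul, tOne_tmul, TensorProduct.star_tmul, TensorProduct.star_tmul,
          Algebra.TensorProduct.tmul_mul_tmul, Algebra.TensorProduct.tmul_mul_tmul, star_mul,
          mul_assoc]

variable (E C) in
/-- The homomorphism `c ↦ 1 ⊗ c`, `C → M(E ⊗ C)`. -/
def oneTensor : C →⋆ₙₐ[ℂ] 𝓜(ℂ, MinTensor E C) :=
  multOf (oneSelfAction E C)
    (extAux_bound (E := C) (F := MinPre E C) (G := MinPre E C) (tOne E C)
      (minNorm_tOne_le (E := E) (C := C)))

theorem oneTensor_tmul (c : C) (e : E) (c' : C) :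
    (oneTensor E C c).fst (MinTensor.tmul e c') = MinTensor.tmul e (c * c') :=
  oneSelf_of c (e ⊗ₜ c')

end Multipliers

section Multipliers2

variable {D E C : Type u} [NonUnitalCStarAlgebra D] [NonUnitalCStarAlgebra E]
  [NonUnitalCStarAlgebra C]

variable (C) in
/-- The operators `φ(d) ⊗ 1` on `E ⊙ C`. -/
def tFirst (L : LeftAction D E E) : D →ₗ[ℂ] E ⊗[ℂ] C →ₗ[ℂ] E ⊗[ℂ] C :=
  LinearMap.rTensorHom C ∘ₗ L.act

theorem tFirst_tmul (L : LeftAction D E E) (d : D) (e : E) (c : C) :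
    tFirst C L d (e ⊗ₜ c) = L.act d e ⊗ₜ c := rfl

theorem kTensor_tFirst {H K : Type u} [NormedAddCommGroup H] [InnerProductSpace ℂ H]
    [CompleteSpace H] [NormedAddCommGroup K] [InnerProductSpace ℂ K] [CompleteSpace K]
    (π : E →⋆ₙₐ[ℂ] (H →L[ℂ] H)) (σ : C →⋆ₙₐ[ℂ] (K →L[ℂ] K)) (L : LeftAction D E E) (d : D)
    (u : E ⊗[ℂ] C) (v : H ⊗[ℂ] K) : kTensor π σ (tFirst C L d u) v =
      TensorProduct.map (indRep π L d : Ind E π →ₗ[ℂ] Ind E π) LinearMap.id (kTensor π σ u v) := by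
  induction u with
  | zero => simp
  | add u₁ u₂ h₁ h₂ => simp only [map_add, LinearMap.add_apply, h₁, h₂]
  | tmul x c =>
    induction v with
    | zero => simp
    | add v₁ v₂ h₁ h₂ => simp only [map_add, h₁, h₂]
    | tmul h k =>
      rw [tFirst_tmul, kTensor_tmul, kTensor_tmul, TensorProduct.map_tmul,
        ContinuousLinearMap.coe_coe, indRep_kmap]
      rfl

theorem minNorm_tFirst_le (L : LeftAction D E E) (d : D) (u : E ⊗[ℂ] C) :
    minNorm (tFirst C L d u) ≤ ‖d‖ * minNorm u := by
  rw [← hNorm_self, ← hNorm_self u]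
  refine hNorm_le (mul_nonneg (norm_nonneg _) (hNorm_nonneg _)) ?_
  intro H K _ _ _ _ _ _ π σ v
  rw [kTensor_tFirst, mul_assoc]
  refine (norm_map_id_le _ _).trans ?_
  exact mul_le_mul (NonUnitalStarAlgHom.norm_apply_le _ d) (norm_kTensor_le π σ u v)
    (norm_nonneg _) (norm_nonneg _)

/-- The operator `φ(d) ⊗ 1` on `E ⊗ C`. -/
def firstSelf (L : LeftAction D E E) (d : D) : MinTensor E C →L[ℂ] MinTensor E C :=
  extAux (E := D) (F := MinPre E C) (G := MinPre E C) (tFirst C L)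
    (minNorm_tFirst_le (C := C) L) d

theorem firstSelf_of (L : LeftAction D E E) (d : D) (u : E ⊗[ℂ] C) :
    firstSelf L d (MinTensor.of u) = MinTensor.of (tFirst C L d u) :=
  extAux_coe (E := D) (F := MinPre E C) (G := MinPre E C) (tFirst C L)
    (minNorm_tFirst_le (C := C) L) d u

variable (C) in
/-- `firstSelf` as a left action. -/
def firstSelfAction (L : LeftAction D E E) : LeftAction D (MinTensor E C) (MinTensor E C) where
  act := LinearMap.mk₂'ₛₗ (RingHom.id ℂ) (RingHom.id ℂ) (fun c u => firstSelf L c u)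
    (fun c d u => extAux_add (E := D) (F := MinPre E C) (G := MinPre E C) _ _ c d u)
    (fun r c u => extAux_smul (E := D) (F := MinPre E C) (G := MinPre E C) _ _ r c u)
    (fun u t s => by simp) (fun c u t => by simp)
  mul_act c d u := by
    change firstSelf L (c * d) u = firstSelf L c (firstSelf L d u)
    refine MinTensor.induction
      (p := fun u => firstSelf L (c * d) u = firstSelf L c (firstSelf L d u)) u
      (isClosed_eq (by fun_prop) (by fun_prop)) fun u => ?_
    rw [firstSelf_of, firstSelf_of, firstSelf_of]
    congr 1
    induction u with
    | zero => simp
    | add u₁ u₂ h₁ h₂ => simp only [map_add, h₁, h₂]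
    | tmul x e => rw [tFirst_tmul, tFirst_tmul, tFirst_tmul, L.mul_act]
  inner_act_left c u w := by
    change star (firstSelf L c u) * w = star u * firstSelf L (star c) w
    refine MinTensor.induction₂ (p := fun u w => star (firstSelf L c u) * w =
      star u * firstSelf L (star c) w) u w
      (isClosed_eq (by fun_prop) (by fun_prop)) fun u w => ?_
    rw [firstSelf_of, firstSelf_of, ← MinTensor.of_star, ← MinTensor.of_star, ← MinTensor.of_mul,
      ← MinTensor.of_mul]
    congr 1
    induction u with
    | zero => simp
    | add u₁ u₂ h₁ h₂ => simp only [map_add, star_add, add_mul, h₁, h₂]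
    | tmul x e =>
      induction w with
      | zero => simp
      | add s₁ s₂ h₁ h₂ => simp only [map_add, mul_add, h₁, h₂]
      | tmul y d =>
        rw [tFirst_tmul, tFirst_tmul, TensorProduct.star_tmul, TensorProduct.star_tmul,
          Algebra.TensorProduct.tmul_mul_tmul, Algebra.TensorProduct.tmul_mul_tmul,
          ← self_inner_def, L.inner_act_left, self_inner_def]

variable (C) in
/-- For a homomorphism `φ : D → M(E)`, the homomorphism `d ↦ φ(d) ⊗ 1`, `D → M(E ⊗ C)`. -/
def tensorOne (φ : D →⋆ₙₐ[ℂ] 𝓜(ℂ, E)) : D →⋆ₙₐ[ℂ] 𝓜(ℂ, MinTensor E C) :=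
  multOf (firstSelfAction C (actOfHom φ))
    (extAux_bound (E := D) (F := MinPre E C) (G := MinPre E C) (tFirst C (actOfHom φ))
      (minNorm_tFirst_le (C := C) (actOfHom φ)))

theorem tensorOne_tmul (φ : D →⋆ₙₐ[ℂ] 𝓜(ℂ, E)) (d : D) (e : E) (c : C) :
    (tensorOne C φ d).fst (MinTensor.tmul e c) = MinTensor.tmul ((φ d).fst e) c :=
  firstSelf_of (actOfHom φ) d (e ⊗ₜ c)

variable (E C) in
/-- The homomorphism `e ↦ (e ⊗ 1) ⊗ 1`, `E → M((E ⊗ C) ⊗ C)`. -/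
def legOne : E →⋆ₙₐ[ℂ] 𝓜(ℂ, MinTensor (MinTensor E C) C) :=
  tensorOne C (tensorOne C (DoubleCentralizer.coeHom (𝕜 := ℂ) (A := E)))

variable (E C) in
/-- The homomorphism `c ⊗ d ↦ (1 ⊗ c) ⊗ d`, `C ⊗ C → M((E ⊗ C) ⊗ C)`. -/
def legTwoThree : MinTensor C C →⋆ₙₐ[ℂ] 𝓜(ℂ, MinTensor (MinTensor E C) C) :=
  tensorId C (oneTensor E C)

end Multipliers2

section GroupAlgebra

variable (G : Type u) [TopologicalSpace G] [Group G] [IsTopologicalGroup G] [LocallyCompactSpace G]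

/-- The Hilbert space `ℓ²(G × ℕ)`. Every cyclic unitary representation of `G` is unitarily
equivalent to a subrepresentation of one on this space. -/
abbrev UnivHilbert : Type u := lp (fun _ : G × ℕ => ℂ) 2

/-- The strongly continuous unitary representations of `G` on `ℓ²(G × ℕ)`. -/
def UnitaryRep : Type u :=
  {U : G →* unitary (UnivHilbert G →L[ℂ] UnivHilbert G) //
    ∀ ξ : UnivHilbert G, Continuous fun s => (U s : UnivHilbert G →L[ℂ] UnivHilbert G) ξ}

/-- The product of the operator algebras of all these representations. -/
def RepProduct : Type u := lp (fun _ : UnitaryRep G => UnivHilbert G →L[ℂ] UnivHilbert G) ∞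

instance : NonUnitalCStarAlgebra (RepProduct G) :=
  inferInstanceAs
    (NonUnitalCStarAlgebra (lp (fun _ : UnitaryRep G => UnivHilbert G →L[ℂ] UnivHilbert G) ∞))

variable {G}

/-- The operator `U(s)`. -/
def UnitaryRep.op (U : UnitaryRep G) (s : G) : UnivHilbert G →L[ℂ] UnivHilbert G := U.1 s

/-- The component of `T` at the representation `U`. -/
def RepProduct.at (T : RepProduct G) (U : UnitaryRep G) : UnivHilbert G →L[ℂ] UnivHilbert G :=
  (show lp (fun _ : UnitaryRep G => UnivHilbert G →L[ℂ] UnivHilbert G) ∞ from T) U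

theorem UnitaryRep.norm_op_le (U : UnitaryRep G) (s : G) : ‖U.op s‖ ≤ 1 := by
  have h : star (U.op s) * U.op s = 1 := (Unitary.mem_iff.1 (U.1 s).2).1
  have h1 : ‖U.op s‖ * ‖U.op s‖ ≤ 1 := by
    rw [← CStarRing.norm_star_mul_self, h]
    exact ContinuousLinearMap.norm_id_le
  nlinarith [norm_nonneg (U.op s)]

/-- The image of the group element `s` under the direct sum of all representations. -/
def groupElem (s : G) : RepProduct G :=
  show lp (fun _ : UnitaryRep G => UnivHilbert G →L[ℂ] UnivHilbert G) ∞ from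
  ⟨fun U => U.op s, memℓp_infty ⟨1, by
    rintro r ⟨U, rfl⟩
    exact U.norm_op_le s⟩⟩

/-- `T` is the integrated form `∫ f(s) U(s) ds` of `f` (with respect to Haar measure) in every
representation `U`. -/
def IsIntegratedForm (f : G → ℂ) (T : RepProduct G) : Prop :=
  letI : MeasurableSpace G := borel G
  haveI : BorelSpace G := ⟨rfl⟩
  ∀ (U : UnitaryRep G) (ξ : UnivHilbert G),
    T.at U ξ = ∫ s, f s • U.op s ξ ∂(MeasureTheory.Measure.haar : MeasureTheory.Measure G)

variable (G)

/-- The full group C*-algebra inside `RepProduct G`: the closure of the algebra of the integrated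
forms of the functions in `C_c(G)`. The norm of `f` is the supremum of the norms of its integrated
forms in all strongly continuous unitary representations. -/
def groupSubalgebra : NonUnitalStarSubalgebra ℂ (RepProduct G) :=
  (NonUnitalStarAlgebra.adjoin ℂ {T : RepProduct G | ∃ f : G → ℂ, Continuous f ∧
    HasCompactSupport f ∧ IsIntegratedForm f T}).topologicalClosure

/-- The full group C*-algebra `C*(G)`. -/
def GroupCStar : Type u := groupSubalgebra G

instance : IsClosed (groupSubalgebra G : Set (RepProduct G)) :=
  NonUnitalStarSubalgebra.isClosed_topologicalClosure _

instance : NonUnitalCStarAlgebra (GroupCStar G) :=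
  inferInstanceAs (NonUnitalCStarAlgebra (groupSubalgebra G))

variable {G}

/-- The inclusion of `C*(G)` into the product of operator algebras. -/
def GroupCStar.val (c : GroupCStar G) : RepProduct G := Subtype.val (show groupSubalgebra G from c)

end GroupAlgebra

section Ideals

/-- The closed linear span of a set. -/
def closedSpan {V : Type*} [NormedAddCommGroup V] [NormedSpace ℂ V] (S : Set V) :
    Submodule ℂ V := (Submodule.span ℂ S).topologicalClosure

/-- Closed two-sided ideals of a C*-algebra. -/
structure IsClosedIdeal {A : Type*} [NonUnitalCStarAlgebra A] (I : Submodule ℂ A) : Prop where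
  isClosed : IsClosed (I : Set A)
  mul_mem_left : ∀ (b : A), ∀ a ∈ I, b * a ∈ I
  mul_mem_right : ∀ (b : A), ∀ a ∈ I, a * b ∈ I

variable {A : Type u} [NonUnitalCStarAlgebra A]

/-- For an ideal `I` of `A`, the ideal `I ⊗ C` of `A ⊗ C`: the closed linear span of the elementary
tensors `a ⊗ c` with `a ∈ I`. -/
def idealTensor (C : Type u) [NonUnitalCStarAlgebra C] (I : Submodule ℂ A) :
    Submodule ℂ (MinTensor A C) :=
  closedSpan {z | ∃ a ∈ I, ∃ c : C, z = MinTensor.tmul a c}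

end Ideals

section Imprimitivity

/-- A `B`–`A` imprimitivity bimodule: a right Hilbert `A`-module and left Hilbert `B`-module whose
two actions are adjointable for the other inner product, whose two inner products are full, and for
which `_B⟨x, y⟩ · z = x · ⟨y, z⟩_A`. -/
structure ImprimitivityBimodule (B A X : Type*) [NonUnitalCStarAlgebra B]
    [NonUnitalCStarAlgebra A] [NormedAddCommGroup X] [NormedSpace ℂ X] [CompleteSpace X]
    [HilbertModule A X] extends LeftAction B A X where
  /-- the left inner product `_B⟨x, y⟩` -/
  leftInner : X →ₗ[ℂ] X →ₗ⋆[ℂ] B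
  leftInner_act : ∀ b x y, leftInner (act b x) y = b * leftInner x y
  star_leftInner : ∀ x y, star (leftInner x y) = leftInner y x
  leftInner_self_pos : ∀ x, ∃ b, leftInner x x = star b * b
  leftInner_act_right : ∀ x y (a : A),
    leftInner (HilbertModule.act x a) y = leftInner x (HilbertModule.act y (star a))
  leftInner_act_eq : ∀ x y z, act (leftInner x y) z =
    HilbertModule.act (A := A) x (HilbertModule.inner y z)
  full_left : closedSpan {b : B | ∃ x y, b = leftInner x y} = ⊤
  full_right : closedSpan {a : A | ∃ x y : X, a = HilbertModule.inner x y} = ⊤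

/-- The Rieffel correspondence: the ideal of `B` associated to an ideal `I` of `A` is the closed
linear span of `_B⟨X · I, X⟩`. -/
def ImprimitivityBimodule.rieffel {B A X : Type*} [NonUnitalCStarAlgebra B]
    [NonUnitalCStarAlgebra A] [NormedAddCommGroup X] [NormedSpace ℂ X] [CompleteSpace X]
    [HilbertModule A X] (M : ImprimitivityBimodule B A X) (I : Submodule ℂ A) : Submodule ℂ B :=
  closedSpan {b | ∃ x y : X, ∃ a ∈ I, b = M.leftInner (HilbertModule.act x a) y}

end Imprimitivity

section Actions

variable {G : Type*} [TopologicalSpace G] [Group G]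

/-- A (strongly continuous) action of `G` on a C*-algebra by *-automorphisms. -/
def IsAction {A : Type*} [NonUnitalCStarAlgebra A] (α : G →* (A ≃⋆ₐ[ℂ] A)) : Prop :=
  ∀ a, Continuous fun s => α s a

/-- `I` is `α`-invariant: `α_s(I) ⊆ I` for every `s`. -/
def IsActionInvariant {A : Type*} [NonUnitalCStarAlgebra A] (α : G →* (A ≃⋆ₐ[ℂ] A))
    (I : Submodule ℂ A) : Prop :=
  ∀ s, ∀ a ∈ I, α s a ∈ I

/-- `γ` is a `β`–`α` compatible action of `G` on the bimodule `X`. -/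
structure IsCompatibleAction {B A X : Type*} [NonUnitalCStarAlgebra B]
    [NonUnitalCStarAlgebra A] [NormedAddCommGroup X] [NormedSpace ℂ X] [CompleteSpace X]
    [HilbertModule A X] (L : LeftAction B A X) (β : G →* (B ≃⋆ₐ[ℂ] B)) (α : G →* (A ≃⋆ₐ[ℂ] A))
    (γ : G →* (X ≃ₗ[ℂ] X)) : Prop where
  continuous : ∀ x, Continuous fun s => γ s x
  map_left : ∀ s b x, γ s (L.act b x) = L.act (β s b) (γ s x)
  map_right : ∀ s x (a : A), γ s (HilbertModule.act x a) = HilbertModule.act (γ s x) (α s a)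
  map_inner : ∀ s x y,
    HilbertModule.inner (A := A) (γ s x) (γ s y) = α s (HilbertModule.inner x y)

end Actions

section Coactions

variable {G : Type u} [TopologicalSpace G] [Group G] [IsTopologicalGroup G]
  [LocallyCompactSpace G]

/-- `Δ` is the comultiplication of `C*(G)`, i.e. the integrated form of the unitary homomorphism
`s ↦ s ⊗ s` of `G` into `M(C*(G) ⊗ C*(G))`. It is the unique nondegenerate homomorphism whose
extension to multipliers takes `s` to `s ⊗ s`, i.e. such that `Δ(s c) = (s ⊗ s) Δ(c)`; the last
equation is tested by multiplying with elementary tensors `x ⊗ y` from the left. -/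
structure IsComultiplication
    (Δ : GroupCStar G →⋆ₙₐ[ℂ] 𝓜(ℂ, MinTensor (GroupCStar G) (GroupCStar G))) : Prop where
  nondegenerate : closedSpan {z | ∃ c w, z = (Δ c).fst w} = ⊤
  map_groupElem : ∀ (s : G) (c c' x x' y y' : GroupCStar G),
    c'.val = groupElem s * c.val → x'.val = x.val * groupElem s → y'.val = y.val * groupElem s →
      (Δ c').snd (MinTensor.tmul x y) = (Δ c).snd (MinTensor.tmul x' y')

variable {A B X : Type u} [NonUnitalCStarAlgebra A] [NonUnitalCStarAlgebra B]
  [NormedAddCommGroup X] [NormedSpace ℂ X] [CompleteSpace X] [HilbertModule A X]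

/-- `Ψ` is the homomorphism `id ⊗ Δ : A ⊗ C → M(A ⊗ C ⊗ C)`. It is characterized by
`Ψ(a ⊗ c) (1 ⊗ w) = (a ⊗ 1 ⊗ 1) (1 ⊗ Δ(c) w)` for `w ∈ C ⊗ C`. -/
def IsIdTensor {C : Type u} [NonUnitalCStarAlgebra C] (Δ : C →⋆ₙₐ[ℂ] 𝓜(ℂ, MinTensor C C))
    (Ψ : MinTensor A C →⋆ₙₐ[ℂ] 𝓜(ℂ, MinTensor (MinTensor A C) C)) : Prop :=
  ∀ a c w, Ψ (MinTensor.tmul a c) * legTwoThree A C w =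
    legOne A C a * legTwoThree A C ((Δ c).fst w)

/-- `n` is the value at the multiplier `m` of the extension of the (nondegenerate) homomorphism
`φ : D → M(E)` to `M(D)`: `φ(m d) = n φ(d)` for all `d ∈ D`. -/
def IsExtensionAt {D E : Type*} [NonUnitalCStarAlgebra D] [NonUnitalCStarAlgebra E]
    (φ : D →⋆ₙₐ[ℂ] 𝓜(ℂ, E)) (m : 𝓜(ℂ, D)) (n : 𝓜(ℂ, E)) : Prop :=
  ∀ d, φ (m.fst d) = n * φ d

/-- The restriction of `δ : A → M(A ⊗ C*(G))` to the ideal `I` is a coaction of `G` on `I`: it is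
injective and nondegenerate as a map into the multipliers of `I ⊗ C*(G)`, the closed linear span of
`δ(I)(1 ⊗ C*(G))` is `I ⊗ C*(G)` (inside `M(A ⊗ C*(G))`), and `(δ ⊗ id) ∘ δ = (id ⊗ δ_G) ∘ δ` holds
on `I`. -/
structure IsCoactionOn (δ : A →⋆ₙₐ[ℂ] 𝓜(ℂ, MinTensor A (GroupCStar G))) (I : Submodule ℂ A) :
    Prop where
  injective : ∀ a ∈ I, (∀ z ∈ idealTensor (GroupCStar G) I, (δ a).fst z = 0) → a = 0
  nondegenerate :
    closedSpan {z | ∃ a ∈ I, ∃ w ∈ idealTensor (GroupCStar G) I, z = (δ a).fst w} =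
      idealTensor (GroupCStar G) I
  span_eq : (closedSpan {m | ∃ a ∈ I, ∃ c, m = δ a * oneTensor A (GroupCStar G) c} :
      Set 𝓜(ℂ, MinTensor A (GroupCStar G))) =
    (fun z : MinTensor A (GroupCStar G) => (z : 𝓜(ℂ, MinTensor A (GroupCStar G)))) ''
      (idealTensor (GroupCStar G) I : Set (MinTensor A (GroupCStar G)))
  coaction_identity : ∃ Δ Ψ, IsComultiplication Δ ∧ IsIdTensor Δ Ψ ∧
    ∀ a ∈ I, ∃ n, IsExtensionAt (tensorId (GroupCStar G) δ) (δ a) n ∧ IsExtensionAt Ψ (δ a) n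

/-- A coaction of `G` on `A`. -/
def IsCoaction (δ : A →⋆ₙₐ[ℂ] 𝓜(ℂ, MinTensor A (GroupCStar G))) : Prop := IsCoactionOn δ ⊤

/-- The ideal `I` is `δ`-invariant: `δ` restricts to a coaction on `I`. -/
def IsCoactionInvariant (δ : A →⋆ₙₐ[ℂ] 𝓜(ℂ, MinTensor A (GroupCStar G))) (I : Submodule ℂ A) :
    Prop := IsCoactionOn δ I

variable (A X) in
/-- The multipliers of `X ⊗ C` are the adjointable operators from `A ⊗ C` to `X ⊗ C`; this is the
space of all bounded operators between these spaces. -/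
abbrev ModuleOp (C : Type u) [NonUnitalCStarAlgebra C] : Type u :=
  MinTensor A C →L[ℂ] HilbTensor A X C

variable (A X) in
/-- Elements of `X ⊗ C` as operators `t ↦ z · t` from `A ⊗ C` to `X ⊗ C`. -/
def toModuleOp (C : Type u) [NonUnitalCStarAlgebra C] :
    HilbTensor A X C →L[ℂ] ModuleOp A X C :=
  HilbTensor.actL

/-- `ζ` is an `ε`–`δ` compatible coaction of `G` on the bimodule `X`. -/
structure IsCompatibleCoaction (L : LeftAction B A X)
    (ε : B →⋆ₙₐ[ℂ] 𝓜(ℂ, MinTensor B (GroupCStar G)))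
    (δ : A →⋆ₙₐ[ℂ] 𝓜(ℂ, MinTensor A (GroupCStar G)))
    (ζ : X →ₗ[ℂ] ModuleOp A X (GroupCStar G)) : Prop where
  /-- `ζ(x) ∈ M(X ⊗ C*(G))` -/
  adjointable : ∀ x, ∃ η : HilbTensor A X (GroupCStar G) → MinTensor A (GroupCStar G),
    ∀ t z, HilbertModule.inner (A := MinTensor A (GroupCStar G)) (ζ x t) z = star t * η z
  /-- `ζ(x · a) = ζ(x) δ(a)` -/
  map_right : ∀ x (a : A) t, ζ (HilbertModule.act x a) t = ζ x ((δ a).fst t)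
  /-- `ζ(b · x) = ε(b) ζ(x)`, tested by multiplying with `s ∈ B ⊗ C*(G)` from the left -/
  map_left : ∀ b x s t, (HilbTensor.leftAction (GroupCStar G) L).act s (ζ (L.act b x) t) =
    (HilbTensor.leftAction (GroupCStar G) L).act ((ε b).snd s) (ζ x t)
  /-- `ζ(x)* ζ(y) = δ(⟨x, y⟩_A)` -/
  map_inner : ∀ x y s t,
    HilbertModule.inner (A := MinTensor A (GroupCStar G)) (ζ x s) (ζ y t) =
      star s * (δ (HilbertModule.inner x y)).fst t
  /-- `ζ` is nondegenerate as a homomorphism: `ζ(X) (A ⊗ C*(G))` spans a dense subspace -/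
  dense_range : closedSpan {z | ∃ x t, z = ζ x t} = ⊤
  /-- `(1 ⊗ C*(G)) ζ(X) ⊆ X ⊗ C*(G)` -/
  one_tensor_mem : ∀ c x, ∃ z, HilbTensor.oneAct c ∘L ζ x = toModuleOp A X (GroupCStar G) z
  /-- `(ζ ⊗ id) ∘ ζ = (id ⊗ δ_G) ∘ ζ`; here `Φ` is `ζ ⊗ id` and `Ψ'` is `id ⊗ δ_G` on
  `X ⊗ C*(G)`, and `n` is the common value of their extensions to multipliers at `ζ(x)` -/
  coaction_identity : ∃ Δ Ψ, IsComultiplication Δ ∧ IsIdTensor Δ Ψ ∧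
    ∃ Φ Ψ' : HilbTensor A X (GroupCStar G) →L[ℂ] ModuleOp (MinTensor A (GroupCStar G))
        (HilbTensor A X (GroupCStar G)) (GroupCStar G),
      (∀ x c t d, Φ (HilbTensor.tmul A x c) (MinTensor.tmul t d) =
        HilbTensor.tmul (MinTensor A (GroupCStar G)) (ζ x t) (c * d)) ∧
      (∀ x c w a c₀ d₀, Ψ' (HilbTensor.tmul A x c)
          ((legTwoThree A (GroupCStar G) w).fst (MinTensor.tmul (MinTensor.tmul a c₀) d₀)) =
        (HilbTensor.leftAction (GroupCStar G) (HilbTensor.oneAction A X (GroupCStar G))).act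
          ((Δ c).fst w) (HilbTensor.tmul (MinTensor A (GroupCStar G))
            (HilbTensor.tmul A (HilbertModule.act x a) c₀) d₀)) ∧
      ∀ x, ∃ n : ModuleOp (MinTensor A (GroupCStar G)) (HilbTensor A X (GroupCStar G))
          (GroupCStar G), ∀ t z,
        n ((tensorId (GroupCStar G) δ t).fst z) = Φ (ζ x t) z ∧ n ((Ψ t).fst z) = Ψ' (ζ x t) z

/-- The coaction `ζ` on `X` is nondegenerate: the closed linear span of `(1 ⊗ C*(G)) ζ(X)` is
`X ⊗ C*(G)`. -/
def IsNondegenerateCoaction (ζ : X →ₗ[ℂ] ModuleOp A X (GroupCStar G)) : Prop :=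
  (closedSpan {T | ∃ (c : GroupCStar G) (x : X), T = HilbTensor.oneAct c ∘L ζ x} :
    Set (ModuleOp A X (GroupCStar G))) = Set.range (toModuleOp A X (GroupCStar G))

end Coactions

end CStarCoaction

end

/-!
Everything rests on comparing closed linear spans. Write `C` for `C*(G)`, `J` for the ideal of `B`
associated to `I`, and `Z = X ⊗ C`, and note that `X · I` and `J · X` span the same closed subspace
of `X` (`rieffel_act_mem`, `act_mem_closedSpan_rieffel`), while `I` is in turn spanned by the
`⟨x, b · y⟩_A` with `b ∈ J` (`mem_closedSpan_inner_rieffel`).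

For actions this suffices, because `β_s` takes `_B⟨x, y⟩` to `_B⟨γ_s x, γ_s y⟩`: both act in the same
way on `X`, and `B` acts faithfully.

For coactions, the invariance of `I` reduces to the equality of `closure (δ(I)(A ⊗ C))` with `I ⊗ C`
(`isCoactionInvariant_iff`); injectivity, nondegeneracy and the coaction identity come for free.
The space `Z` carries a `B ⊗ C`-valued inner product `tensorLeftInner`. Its boundedness for the
norm that `Z` has as a Hilbert `A ⊗ C`-module is the one analytic point. It is obtained by viewing
the conjugate of `X` as a Hilbert `B`-module with a left action of `A`, and by showing that
`x ⊗ c ↦ x̃ ⊗ c*` is contractive (`hNorm_tConj_le`).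

If `I` is invariant, then `ε(b) ⟨ζ(x) t, w⟩ = ⟨ζ(b · x) t, w⟩` computes `ε(J)(B ⊗ C)`: as `b · x`
may be traded for elements `y · a` with `a ∈ I` and `ζ(y · a) t = ζ(y) δ(a) t`, its closed span is
the span of the inner products of `(X · I) ⊗ C` with `Z`, which is `J ⊗ C`. If `J` is invariant,
then `ζ(J · X)(A ⊗ C)` spans `(X · I) ⊗ C`, and
`⟨(1 ⊗ c) ζ(x), ζ(b · y) t⟩ = ζ(x)* (1 ⊗ c*) ζ(b · y) t` leads back to the elements
`ζ(x)* ζ(b · y) t = δ(⟨x, b · y⟩_A) t`; here the nondegeneracy of `ζ` is used.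
-/

noncomputable section

namespace CStarCoaction

/-! ### Closed linear spans -/

section ClosedSpan

variable {V W : Type*} [NormedAddCommGroup V] [NormedSpace ℂ V] [NormedAddCommGroup W]
  [NormedSpace ℂ W]

theorem subset_closedSpan {S : Set V} {v : V} (hv : v ∈ S) : v ∈ closedSpan S :=
  Submodule.le_topologicalClosure _ (Submodule.subset_span hv)

theorem isClosed_closedSpan (S : Set V) : IsClosed (closedSpan S : Set V) :=
  Submodule.isClosed_topologicalClosure _

theorem closedSpan_le {S : Set V} {N : Submodule ℂ V} (hN : IsClosed (N : Set V))
    (h : ∀ v ∈ S, v ∈ N) : closedSpan S ≤ N :=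
  Submodule.topologicalClosure_minimal _ (Submodule.span_le.2 h) hN

/-- A continuous (semi)linear map taking a set into a closed subspace takes its closed linear span
into that subspace. -/
theorem map_mem_of_mem_closedSpan {σ : ℂ →+* ℂ} (f : V →SL[σ] W) {S : Set V} {N : Submodule ℂ W}
    (hN : IsClosed (N : Set W)) (h : ∀ v ∈ S, f v ∈ N) {v : V} (hv : v ∈ closedSpan S) :
    f v ∈ N :=
  closedSpan_le (N := N.comap f.toLinearMap) (hN.preimage f.continuous) h hv

theorem eq_on_of_closedSpan {σ : ℂ →+* ℂ} (f g : V →SL[σ] W) {S : Set V}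
    (hS : closedSpan S = ⊤) (h : ∀ v ∈ S, f v = g v) (v : V) : f v = g v := by
  have := map_mem_of_mem_closedSpan (f - g) (S := S) (N := ⊥)
    (by simp) (fun v hv => by simp [h v hv]) (v := v) (by rw [hS]; trivial)
  simpa [sub_eq_zero] using this

end ClosedSpan

/-! ### Closed ideals of C*-algebras -/

section Ideals

variable {A : Type*} [NonUnitalCStarAlgebra A] {I : Submodule ℂ A}

theorem isClosedIdeal_top : IsClosedIdeal (⊤ : Submodule ℂ A) where
  isClosed := isClosed_univ
  mul_mem_left _ _ _ := trivial
  mul_mem_right _ _ _ := trivial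

/-- Elements of a closed ideal have approximate right units in the ideal: for `a ∈ I` one may take
`f(a* a)` with `f(t) = t² / (t² + ε²)`. -/
theorem IsClosedIdeal.exists_approx_unit (hI : IsClosedIdeal I) {a : A} (ha : a ∈ I) {ε : ℝ}
    (hε : 0 < ε) : ∃ e ∈ I, star e = e ∧ ‖a - a * e‖ ^ 2 ≤ ε := by
  let S : NonUnitalStarSubalgebra ℂ A :=
    { carrier := {x | x ∈ I ∧ star x ∈ I}
      add_mem' := fun hx hy => ⟨I.add_mem hx.1 hy.1, by rw [star_add]; exact I.add_mem hx.2 hy.2⟩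
      zero_mem' := ⟨I.zero_mem, by rw [star_zero]; exact I.zero_mem⟩
      mul_mem' := fun {x y} hx hy => ⟨hI.mul_mem_left x y hy.1,
        by rw [star_mul]; exact hI.mul_mem_left _ _ hx.2⟩
      smul_mem' := fun c x hx => ⟨I.smul_mem c hx.1,
        by rw [star_smul]; exact I.smul_mem _ hx.2⟩
      star_mem' := fun {x} hx => ⟨hx.2, by rw [star_star]; exact hx.1⟩ }
  have hS : IsClosed (S : Set A) :=
    hI.isClosed.inter (hI.isClosed.preimage continuous_star)
  set h := star a * a with hh
  have hsa : IsSelfAdjoint h := .star_mul_self a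
  have hmem : h ∈ S := ⟨hI.mul_mem_left _ _ ha, by
    rw [hsa.star_eq]; exact hI.mul_mem_left _ _ ha⟩
  have hpos : ∀ t : ℝ, 0 < t ^ 2 + ε ^ 2 := fun t => by positivity
  let f : ℝ → ℝ := fun t => t ^ 2 / (t ^ 2 + ε ^ 2)
  have hf : Continuous f :=
    Continuous.div₀ (by fun_prop) (by fun_prop) fun t => (hpos t).ne'
  have hf0 : f 0 = 0 := by simp [f]
  refine ⟨cfcₙ f h, (cfcₙ_mem (s := S) f hmem).1, cfcₙ_predicate (R := ℝ) f h, ?_⟩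
  have hsa' : star (cfcₙ f h) = cfcₙ f h := cfcₙ_predicate (R := ℝ) f h
  have key : star (a - a * cfcₙ f h) * (a - a * cfcₙ f h) =
      cfcₙ (fun t => t - t * f t - f t * t + f t * t * f t) h := by
    have hid : cfcₙ (fun t : ℝ => t) h = h := cfcₙ_id' ℝ h
    have c1 : ContinuousOn f (quasispectrum ℝ h) := hf.continuousOn
    rw [cfcₙ_add (a := h) (fun t => t - t * f t - f t * t) (fun t => f t * t * f t)
        (by fun_prop) (by simp [hf0]) (by fun_prop) (by simp [hf0]),
      cfcₙ_sub (a := h) (fun t => t - t * f t) (fun t => f t * t)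
        (by fun_prop) (by simp [hf0]) (by fun_prop) (by simp [hf0]),
      cfcₙ_sub (a := h) (fun t => t) (fun t => t * f t)
        (by fun_prop) (by simp) (by fun_prop) (by simp [hf0]),
      cfcₙ_mul (a := h) (fun t => f t * t) f (by fun_prop) (by simp) (by fun_prop) hf0,
      cfcₙ_mul (a := h) f (fun t => t) (by fun_prop) hf0 (by fun_prop) (by simp),
      cfcₙ_mul (a := h) (fun t => t) f (by fun_prop) (by simp) (by fun_prop) hf0, hid,
      star_sub, star_mul, hsa', hh]
    noncomm_ring
  rw [sq, ← CStarRing.norm_star_mul_self, key]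
  refine norm_cfcₙ_le fun t _ => ?_
  have e : t - t * f t - f t * t + f t * t * f t = t * ε ^ 4 / (t ^ 2 + ε ^ 2) ^ 2 := by
    have := (hpos t).ne'
    simp only [f]
    field_simp
    ring
  -- `|t| ε ≤ t² + ε²` and `ε² ≤ t² + ε²` bound this by `ε`
  rw [e, norm_div, norm_mul, Real.norm_eq_abs, Real.norm_of_nonneg (by positivity : 0 ≤ ε ^ 4),
    Real.norm_of_nonneg (by positivity : 0 ≤ (t ^ 2 + ε ^ 2) ^ 2), div_le_iff₀ (by positivity),
    ← sq_abs t]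
  have h0 := abs_nonneg t
  have h1 : |t| * ε ≤ |t| ^ 2 + ε ^ 2 := by nlinarith [sq_nonneg (|t| - ε)]
  have h2 : ε ^ 2 ≤ |t| ^ 2 + ε ^ 2 := by nlinarith
  calc |t| * ε ^ 4 = ε * ((|t| * ε) * ε ^ 2) := by ring
    _ ≤ ε * ((|t| ^ 2 + ε ^ 2) * (|t| ^ 2 + ε ^ 2)) := by gcongr
    _ = _ := by ring

theorem IsClosedIdeal.exists_norm_sub_mul_lt (hI : IsClosedIdeal I) {a : A} (ha : a ∈ I) {ε : ℝ}
    (hε : 0 < ε) : ∃ e ∈ I, star e = e ∧ ‖a - a * e‖ < ε := by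
  obtain ⟨e, he, hs, h⟩ := hI.exists_approx_unit ha (ε := (ε / 2) ^ 2) (by positivity)
  exact ⟨e, he, hs, (le_of_sq_le_sq h (by positivity)).trans_lt (by linarith)⟩

theorem IsClosedIdeal.star_mem (hI : IsClosedIdeal I) {a : A} (ha : a ∈ I) : star a ∈ I := by
  refine hI.isClosed.closure_subset (Metric.mem_closure_iff.2 fun ε hε => ?_)
  obtain ⟨e, he, hs, h⟩ := hI.exists_norm_sub_mul_lt ha hε
  refine ⟨e * star a, hI.mul_mem_right _ _ he, ?_⟩
  rw [dist_eq_norm, ← norm_star, star_sub, star_mul, star_star, hs]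
  exact h

/-- Every element `a` of a closed ideal is a limit of products `a e` with `e` in the ideal. -/
theorem IsClosedIdeal.mem_of_forall_mul_mem (hI : IsClosedIdeal I) {N : Submodule ℂ A}
    (hN : IsClosed (N : Set A)) {a : A} (ha : a ∈ I) (h : ∀ e ∈ I, a * e ∈ N) : a ∈ N := by
  refine hN.closure_subset (Metric.mem_closure_iff.2 fun ε hε => ?_)
  obtain ⟨e, he, hs, h'⟩ := hI.exists_norm_sub_mul_lt ha hε
  exact ⟨a * e, h e he, by rwa [dist_eq_norm]⟩

theorem mem_of_forall_mul_mem {N : Submodule ℂ A} (hN : IsClosed (N : Set A)) {a : A}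
    (h : ∀ e, a * e ∈ N) : a ∈ N :=
  isClosedIdeal_top.mem_of_forall_mul_mem hN trivial fun e _ => h e

theorem eq_of_forall_mul_left {a b : A} (h : ∀ s : A, s * a = s * b) : a = b := by
  have h1 := h (star (a - b))
  rw [← sub_eq_zero, ← mul_sub] at h1
  exact sub_eq_zero.1 ((CStarRing.star_mul_self_eq_zero_iff _).1 h1)

theorem mem_of_forall_mul_left_mem {N : Submodule ℂ A}
    (hN : IsClosed (N : Set A)) {a : A} (h : ∀ e, e * a ∈ N) : a ∈ N := by
  refine hN.closure_subset (Metric.mem_closure_iff.2 fun ε hε => ?_)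
  obtain ⟨e, -, hs, h'⟩ := isClosedIdeal_top.exists_norm_sub_mul_lt (a := star a) trivial hε
  refine ⟨e * a, h e, ?_⟩
  rwa [dist_eq_norm, ← norm_star, star_sub, star_mul, hs]

theorem eq_of_forall_mul_right {a b : A}
    (h : ∀ s : A, a * s = b * s) : a = b := by
  have h1 := h (star (a - b))
  rw [← sub_eq_zero, ← sub_mul] at h1
  exact sub_eq_zero.1 ((CStarRing.mul_star_self_eq_zero_iff _).1 h1)

/-- The closed span of a set stable under left and right multiplication is an ideal. -/
theorem isClosedIdeal_closedSpan {S : Set A} (hl : ∀ b, ∀ a ∈ S, b * a ∈ closedSpan S)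
    (hr : ∀ b, ∀ a ∈ S, a * b ∈ closedSpan S) : IsClosedIdeal (closedSpan S) where
  isClosed := isClosed_closedSpan S
  mul_mem_left b _ ha := map_mem_of_mem_closedSpan (ContinuousLinearMap.mul ℂ A b)
    (isClosed_closedSpan S) (hl b) ha
  mul_mem_right b _ ha := map_mem_of_mem_closedSpan ((ContinuousLinearMap.mul ℂ A).flip b)
    (isClosed_closedSpan S) (hr b) ha

end Ideals

/-! ### Hilbert modules: boundedness and approximate units -/

section HilbertModule

/-- A representation of a C*-algebra `E` by operators that are adjointable for a positive form is
contractive for that form. The algebra need not act boundedly a priori: `‖e‖² - e* e` is of the form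
`d* d` in the unitization, whence `‖e‖² f(x, x) - f(e x, e x) = f(d x, d x) ≥ 0`. -/
theorem norm_form_act_le {D E V : Type*} [NonUnitalCStarAlgebra D] [NonUnitalCStarAlgebra E]
    [AddCommGroup V] [Module ℂ V] (f : V →ₗ⋆[ℂ] V →ₗ[ℂ] D) (hf : ∀ x, ∃ d, f x x = star d * d)
    (T : E →ₗ[ℂ] V →ₗ[ℂ] V) (hmul : ∀ d e x, T (d * e) x = T d (T e x))
    (hadj : ∀ e x y, f (T e x) y = f x (T (star e) y)) (e : E) (x : V) :
    ‖f (T e x) (T e x)‖ ≤ ‖e‖ ^ 2 * ‖f x x‖ := by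
  let _ := CStarAlgebra.spectralOrder (Unitization ℂ E)
  have _ := CStarAlgebra.spectralOrderedRing (Unitization ℂ E)
  let _ := CStarAlgebra.spectralOrder D
  have _ := CStarAlgebra.spectralOrderedRing D
  have hpos : ∀ x, 0 ≤ f x x := fun x => by
    obtain ⟨d, hd⟩ := hf x
    rw [hd]; exact star_mul_self_nonneg d
  set β : Unitization ℂ E := (e : Unitization ℂ E) with hβ
  have h1 : (0 : Unitization ℂ E) ≤ algebraMap ℝ (Unitization ℂ E) ‖star β * β‖ - star β * β :=
    sub_nonneg.2 (IsSelfAdjoint.le_algebraMap_norm_self (.star_mul_self β))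
  obtain ⟨d, hd⟩ := CStarAlgebra.nonneg_iff_eq_star_mul_self.1 h1
  have hfst := congrArg (fun z => z.fst) hd
  have hsnd := congrArg (fun z => z.snd) hd
  rw [CStarRing.norm_star_mul_self, hβ, Unitization.norm_inr,
    IsScalarTower.algebraMap_apply ℝ ℂ (Unitization ℂ E)] at hfst hsnd
  simp [Unitization.algebraMap_eq_inl, sub_eq_add_neg] at hfst hsnd
  have h2 := hpos (d.fst • x + T d.snd x)
  have h3 : f (d.fst • x + T d.snd x) (d.fst • x + T d.snd x) =
      ((‖e‖ * ‖e‖ : ℝ) : ℂ) • f x x - f (T e x) (T e x) := by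
    have e1 : f x (T (star d.fst • d.snd + d.fst • star d.snd + star d.snd * d.snd) x) =
        - f (T e x) (T e x) := by
      rw [hadj, ← hmul, ← map_neg, ← LinearMap.neg_apply, ← map_neg, hsnd]
      rfl
    simp only [map_add, LinearMap.add_apply, map_smul, LinearMap.smul_apply, hadj,
      LinearMap.map_smulₛₗ₂, hmul] at e1 ⊢
    rw [sub_eq_add_neg, ← e1]
    push_cast
    rw [hfst]
    simp only [smul_add, smul_smul]
    simp only [starRingEnd_apply, mul_comm]
    abel
  rw [h3, sub_nonneg] at h2
  have h4 := CStarAlgebra.norm_le_norm_of_nonneg_of_le (hpos (T e x)) h2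
  rwa [norm_smul, Complex.norm_real, Real.norm_of_nonneg (by positivity), ← sq] at h4

variable {A X : Type*} [NonUnitalCStarAlgebra A] [NormedAddCommGroup X] [NormedSpace ℂ X]
  [CompleteSpace X] [HilbertModule A X]

theorem inner_act_left (x : X) (a : A) (y : X) :
    HilbertModule.inner (A := A) (HilbertModule.act x a) y =
      star a * HilbertModule.inner (A := A) x y := by
  rw [← HilbertModule.star_inner, HilbertModule.inner_act, star_mul, HilbertModule.star_inner]

variable (A) in
theorem eq_zero_of_inner_self {x : X} (h : HilbertModule.inner (A := A) x x = 0) : x = 0 := by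
  have := HilbertModule.norm_sq (A := A) x
  rw [h, norm_zero] at this
  exact norm_eq_zero.1 (pow_eq_zero_iff two_ne_zero |>.1 this)

variable (A) in
theorem norm_inner_le (x y : X) : ‖HilbertModule.inner (A := A) x y‖ ≤ ‖x‖ * ‖y‖ := by
  let _ := CStarAlgebra.spectralOrder A
  have _ := CStarAlgebra.spectralOrderedRing A
  rcases eq_or_ne x 0 with rfl | hx
  · simp
  have hx' : 0 < ‖x‖ := norm_pos_iff.2 hx
  set a := HilbertModule.inner (A := A) x y with ha
  set g := HilbertModule.inner (A := A) x x with hg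
  have hpos : ∀ z : X, 0 ≤ HilbertModule.inner (A := A) z z := fun z => by
    obtain ⟨d, hd⟩ := HilbertModule.inner_self_pos (A := A) z
    rw [hd]; exact star_mul_self_nonneg d
  have h1 := hpos (HilbertModule.act x a - ((‖x‖ ^ 2 : ℝ) : ℂ) • y)
  have hyx : HilbertModule.inner (A := A) y x = star a := (HilbertModule.star_inner x y).symm
  have h2 : star a * g * a ≤ ((‖x‖ ^ 2 : ℝ) : ℂ) • (star a * a) := by
    have := CStarAlgebra.star_left_conjugate_le_norm_smul (a := a) (b := g)
      (by exact (hpos x).isSelfAdjoint)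
    rwa [← HilbertModule.norm_sq (A := A) x, ← Complex.coe_smul] at this
  have h3 : HilbertModule.inner (A := A) (HilbertModule.act x a - ((‖x‖ ^ 2 : ℝ) : ℂ) • y)
      (HilbertModule.act x a - ((‖x‖ ^ 2 : ℝ) : ℂ) • y) = star a * g * a
      - ((‖x‖ ^ 2 : ℝ) : ℂ) • (star a * a) - ((‖x‖ ^ 2 : ℝ) : ℂ) • (star a * a)
      + ((‖x‖ ^ 2 : ℝ) : ℂ) • ((‖x‖ ^ 2 : ℝ) : ℂ) • HilbertModule.inner (A := A) y y := by
    simp only [map_sub, LinearMap.sub_apply, map_smul,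
      LinearMap.map_smulₛₗ₂, HilbertModule.inner_act, inner_act_left, hyx, ← ha, ← hg,
      Complex.conj_ofReal, smul_sub, mul_assoc]
    abel
  rw [h3] at h1
  have h4 : ((‖x‖ ^ 2 : ℝ) : ℂ) • (star a * a) ≤
      ((‖x‖ ^ 2 : ℝ) : ℂ) • ((‖x‖ ^ 2 : ℝ) : ℂ) • HilbertModule.inner (A := A) y y := by
    rw [← sub_nonneg]
    refine h1.trans ?_
    rw [← sub_nonneg]
    have := sub_nonneg.2 h2
    convert this using 1
    abel
  have h5 := CStarAlgebra.norm_le_norm_of_nonneg_of_le (by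
    rw [Complex.coe_smul]; exact smul_nonneg (by positivity) (star_mul_self_nonneg a)) h4
  rw [norm_smul, norm_smul, norm_smul, CStarRing.norm_star_mul_self, Complex.norm_real,
    Real.norm_of_nonneg (by positivity), ← HilbertModule.norm_sq (A := A) y] at h5
  have h6 := le_of_mul_le_mul_left h5 (by positivity)
  refine le_of_sq_le_sq ?_ (by positivity)
  rw [mul_pow, sq ‖a‖]
  exact h6

theorem norm_act_le (x : X) (a : A) : ‖HilbertModule.act x a‖ ≤ ‖x‖ * ‖a‖ := by
  refine le_of_sq_le_sq ?_ (by positivity)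
  rw [HilbertModule.norm_sq (A := A), inner_act_left, HilbertModule.inner_act, mul_pow,
    HilbertModule.norm_sq (A := A) x]
  calc _ ≤ ‖star a‖ * (‖HilbertModule.inner (A := A) x x‖ * ‖a‖) :=
        (norm_mul_le _ _).trans (mul_le_mul_of_nonneg_left (norm_mul_le _ _) (norm_nonneg _))
    _ = _ := by rw [norm_star]; ring

theorem LeftAction.norm_act_le {B : Type*} [NonUnitalCStarAlgebra B] (L : LeftAction B A X) (b : B)
    (x : X) : ‖L.act b x‖ ≤ ‖b‖ * ‖x‖ := by
  refine le_of_sq_le_sq ?_ (by positivity)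
  rw [mul_pow, HilbertModule.norm_sq (A := A), HilbertModule.norm_sq (A := A) x]
  exact norm_form_act_le HilbertModule.inner HilbertModule.inner_self_pos L.act L.mul_act
    L.inner_act_left b x

variable (A X) in
/-- The right action of a Hilbert module as a continuous bilinear map. -/
def actCLM : X →L[ℂ] A →L[ℂ] X :=
  HilbertModule.act.mkContinuous₂ 1 fun x a => by rw [one_mul]; exact norm_act_le x a

variable (A X) in
/-- The inner product of a Hilbert module as a continuous sesquilinear map. -/
def innerCLM : X →SL[starRingEnd ℂ] X →L[ℂ] A :=
  HilbertModule.inner.mkContinuous₂ 1 fun x y => by rw [one_mul]; exact norm_inner_le A x y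

/-- A left action as a continuous bilinear map. -/
def LeftAction.actCLM {B : Type*} [NonUnitalCStarAlgebra B] (L : LeftAction B A X) :
    B →L[ℂ] X →L[ℂ] X :=
  L.act.mkContinuous₂ 1 fun b x => by rw [one_mul]; exact L.norm_act_le b x

theorem actCLM_apply (x : X) (a : A) : actCLM A X x a = HilbertModule.act x a := rfl

theorem innerCLM_apply (x y : X) : innerCLM A X x y = HilbertModule.inner x y := rfl

theorem LeftAction.actCLM_apply {B : Type*} [NonUnitalCStarAlgebra B] (L : LeftAction B A X)
    (b : B) (x : X) : L.actCLM b x = L.act b x := rfl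

variable (A) in
/-- Every element `x` of a Hilbert module is a limit of elements `x · e`. -/
theorem mem_of_forall_act_mem {N : Submodule ℂ X} (hN : IsClosed (N : Set X)) {x : X}
    (h : ∀ a : A, HilbertModule.act x a ∈ N) : x ∈ N := by
  refine hN.closure_subset (Metric.mem_closure_iff.2 fun ε hε => ?_)
  set g := HilbertModule.inner (A := A) x x with hg
  have hgs : star g = g := HilbertModule.star_inner x x
  -- `⟨x - x e, x - x e⟩ = (g - g e) - e (g - g e)`, and the approximate unit is contractive
  let _ := CStarAlgebra.spectralOrder A
  have _ := CStarAlgebra.spectralOrderedRing A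
  have hu := CStarAlgebra.increasingApproximateUnit A
  have ht : Filter.Tendsto (fun e => g * e) (CStarAlgebra.approximateUnit A) (nhds g) :=
    hu.tendsto_mul_left g
  have hev := (Metric.tendsto_nhds.1 ht (ε ^ 2 / 2) (by positivity)).and
    (hu.eventually_nonneg.and hu.eventually_norm)
  obtain ⟨e, he, he0, he1⟩ := hev.exists
  refine ⟨HilbertModule.act x e, h e, ?_⟩
  rw [dist_eq_norm]
  have hes : star e = e := he0.isSelfAdjoint
  have key : HilbertModule.inner (A := A) (x - HilbertModule.act x e) (x - HilbertModule.act x e) =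
      (g - g * e) - e * (g - g * e) := by
    simp only [map_sub, LinearMap.sub_apply, inner_act_left, HilbertModule.inner_act, hes, ← hg,
      mul_sub, mul_assoc]
    abel
  have hd : ‖g - g * e‖ < ε ^ 2 / 2 := by rwa [dist_eq_norm, ← norm_neg, neg_sub] at he
  have h1 : ‖x - HilbertModule.act x e‖ ^ 2 < ε ^ 2 := by
    rw [HilbertModule.norm_sq (A := A), key]
    calc _ ≤ ‖g - g * e‖ + ‖e * (g - g * e)‖ := norm_sub_le _ _
      _ ≤ ‖g - g * e‖ + 1 * ‖g - g * e‖ := by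
        gcongr
        exact (norm_mul_le _ _).trans (by gcongr)
      _ < ε ^ 2 := by linarith
  exact lt_of_pow_lt_pow_left₀ 2 hε.le h1

end HilbertModule

/-! ### The conjugate of an imprimitivity bimodule -/

section Conjugate

variable {B A X : Type*} [NonUnitalCStarAlgebra B] [NonUnitalCStarAlgebra A]
  [NormedAddCommGroup X] [NormedSpace ℂ X] [CompleteSpace X] [HilbertModule A X]

/-- The conjugate bimodule: `X` with the conjugate scalar multiplication, on which `A` acts from the
left by `a · x̃ = (x · a*)~` and `B` from the right by `x̃ · b = (b* · x)~`. The bimodule `M` is an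
argument of the type since the `B`-valued inner product is part of `M`. -/
@[nolint unusedArguments]
def ConjModule (_M : ImprimitivityBimodule B A X) : Type _ := X

variable (M : ImprimitivityBimodule B A X)

instance : NormedAddCommGroup (ConjModule M) := inferInstanceAs (NormedAddCommGroup X)
instance : CompleteSpace (ConjModule M) := inferInstanceAs (CompleteSpace X)
instance : Module ℂ (ConjModule M) := Module.compHom X (starRingEnd ℂ)
instance : NormedSpace ℂ (ConjModule M) where
  norm_smul_le c x := by
    change ‖(starRingEnd ℂ c) • (show X from x)‖ ≤ ‖c‖ * ‖(show X from x)‖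
    rw [norm_smul, RCLike.norm_conj]

/-- The conjugate-linear identification `x ↦ x̃`. -/
def toConj : X →ₗ⋆[ℂ] ConjModule M where
  toFun x := x
  map_add' _ _ := rfl
  map_smul' c x := by
    change c • x = (starRingEnd ℂ (starRingEnd ℂ c)) • x
    rw [Complex.conj_conj]

theorem exists_toConj (x : ConjModule M) : ∃ y, toConj M y = x := ⟨x, rfl⟩

/-- The `B`-valued inner product `⟨x̃, ỹ⟩_B = _B⟨x, y⟩`. -/
def conjInner : ConjModule M →ₗ⋆[ℂ] ConjModule M →ₗ[ℂ] B :=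
  LinearMap.mk₂'ₛₗ (starRingEnd ℂ) (RingHom.id ℂ) (fun x y => M.leftInner x y)
    (fun x y z => LinearMap.map_add₂ M.leftInner _ _ _)
    (fun c x y => LinearMap.map_smul₂ M.leftInner _ _ _)
    (fun x y z => map_add (M.leftInner x) _ _)
    (fun c x y => by
      refine (map_smulₛₗ (M.leftInner x) (starRingEnd ℂ c) (show X from y)).trans ?_
      rw [Complex.conj_conj]; rfl)

theorem conjInner_toConj (x y : X) : conjInner M (toConj M x) (toConj M y) = M.leftInner x y := rfl

/-- The left action `a · x̃ = (x · a*)~`. -/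
def conjLeft : A →ₗ[ℂ] ConjModule M →ₗ[ℂ] ConjModule M :=
  LinearMap.mk₂'ₛₗ (RingHom.id ℂ) (RingHom.id ℂ)
    (fun a x => toConj M (HilbertModule.act (A := A) (X := X) x (star a)))
    (fun a b x => by rw [star_add]; exact map_add (HilbertModule.act (A := A) (X := X) x) _ _)
    (fun c a x => by
      rw [star_smul]
      exact map_smul (HilbertModule.act (A := A) (X := X) x) (star c) (star a))
    (fun a x y => LinearMap.map_add₂ (HilbertModule.act (A := A) (X := X)) _ _ _)
    (fun c a x => LinearMap.map_smul₂ (HilbertModule.act (A := A) (X := X)) _ _ _)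

theorem conjLeft_toConj (a : A) (x : X) :
    conjLeft M a (toConj M x) = toConj M (HilbertModule.act x (star a)) := rfl

/-- The right action `x̃ · b = (b* · x)~`. -/
def conjRight : ConjModule M →ₗ[ℂ] B →ₗ[ℂ] ConjModule M :=
  LinearMap.mk₂'ₛₗ (RingHom.id ℂ) (RingHom.id ℂ)
    (fun x b => toConj M (M.act (star b) x))
    (fun x y b => map_add (M.act (star b)) _ _)
    (fun c x b => map_smul (M.act (star b)) _ _)
    (fun x b c => by rw [star_add]; exact LinearMap.map_add₂ M.act _ _ _)
    (fun c x b => by rw [star_smul]; exact LinearMap.map_smul₂ M.act (star c) (star b) _)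

theorem conjRight_toConj (x : X) (b : B) :
    conjRight M (toConj M x) b = toConj M (M.act (star b) x) := rfl

theorem leftInner_act_left (x y : X) (b : B) :
    M.leftInner x (M.act b y) = M.leftInner x y * star b := by
  rw [← M.star_leftInner, M.leftInner_act, star_mul, M.star_leftInner]

/-- For self-adjoint `d` one has `‖d³‖ = ‖d‖³`; this turns a bound on `d³` into one on `d`. -/
theorem norm_cube_le {D : Type*} [NonUnitalCStarAlgebra D] {d : D} (hd : star d = d) {m : ℝ}
    (h : ‖d * d * d‖ ≤ m ^ 2 * ‖d‖) : ‖d‖ ≤ |m| := by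
  rcases eq_or_ne d 0 with rfl | h0
  · simp
  have hp : 0 < ‖d‖ := norm_pos_iff.2 h0
  have h1 : ‖d * d‖ = ‖d‖ * ‖d‖ := by
    conv_lhs => rw [← hd, hd, ← hd, hd]
    nth_rw 1 [← hd]
    exact CStarRing.norm_star_mul_self
  have h2 : star (d * d) = d * d := by rw [star_mul, hd]
  have h3 : ‖d * d * (d * d)‖ = ‖d * d‖ * ‖d * d‖ := by
    nth_rw 1 [← h2]
    exact CStarRing.norm_star_mul_self
  have h4 : ‖d * d * (d * d)‖ ≤ ‖d * d * d‖ * ‖d‖ := by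
    rw [← mul_assoc]; exact norm_mul_le _ _
  rw [h3, h1] at h4
  have h5 : ‖d‖ * ‖d‖ * (‖d‖ * ‖d‖) ≤ m ^ 2 * ‖d‖ * ‖d‖ := h4.trans (by gcongr)
  have h6 : ‖d‖ ^ 2 ≤ m ^ 2 := by
    have : 0 < ‖d‖ * ‖d‖ := by positivity
    nlinarith
  exact (abs_norm d) ▸ sq_le_sq.1 h6

/-- The two inner products of an imprimitivity bimodule induce the same norm. With
`a = ⟨x, x⟩_A` and `b = _B⟨x, x⟩` one has `b · x = x · a`, so that `a³ = ⟨b x, b x⟩_A` and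
`b³ = _B⟨x a, x a⟩`. -/
theorem norm_leftInner_self (x : X) : ‖x‖ ^ 2 = ‖M.leftInner x x‖ := by
  set a := HilbertModule.inner (A := A) x x with ha
  set b := M.leftInner x x with hb
  have has : star a = a := HilbertModule.star_inner x x
  have hbs : star b = b := M.star_leftInner x x
  have hbx : M.act b x = HilbertModule.act x a := M.leftInner_act_eq x x x
  have h1 : ‖a * a * a‖ ≤ ‖b‖ ^ 2 * ‖a‖ := by
    have h := norm_form_act_le HilbertModule.inner (HilbertModule.inner_self_pos (A := A))
      M.act M.mul_act M.inner_act_left b x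
    rwa [hbx, inner_act_left, HilbertModule.inner_act, ← ha, has, ← mul_assoc] at h
  have h2 : ‖b * b * b‖ ≤ ‖a‖ ^ 2 * ‖b‖ := by
    have h := norm_form_act_le (conjInner M) M.leftInner_self_pos (conjLeft M)
      (fun d e x => by
        obtain ⟨x, rfl⟩ := exists_toConj M x
        rw [conjLeft_toConj, conjLeft_toConj, conjLeft_toConj, star_mul, HilbertModule.act_mul])
      (fun e x y => by
        obtain ⟨x, rfl⟩ := exists_toConj M x
        obtain ⟨y, rfl⟩ := exists_toConj M y
        rw [conjLeft_toConj, conjLeft_toConj, conjInner_toConj, conjInner_toConj,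
          M.leftInner_act_right]) a (toConj M x)
    rwa [conjLeft_toConj, conjInner_toConj, conjInner_toConj, has, ← hbx, M.leftInner_act,
      leftInner_act_left, ← hb, hbs, ← mul_assoc] at h
  have h3 := norm_cube_le has h1
  have h4 := norm_cube_le hbs h2
  rw [abs_norm] at h3 h4
  rw [HilbertModule.norm_sq (A := A)]
  exact le_antisymm h3 h4

instance : HilbertModule B (ConjModule M) where
  act := conjRight M
  inner := conjInner M
  act_mul x a b := by
    obtain ⟨x, rfl⟩ := exists_toConj M x
    rw [conjRight_toConj, conjRight_toConj, conjRight_toConj, star_mul, M.mul_act]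
  inner_act x y b := by
    obtain ⟨x, rfl⟩ := exists_toConj M x
    obtain ⟨y, rfl⟩ := exists_toConj M y
    rw [conjRight_toConj, conjInner_toConj, conjInner_toConj, leftInner_act_left, star_star]
  star_inner x y := M.star_leftInner x y
  inner_self_pos x := M.leftInner_self_pos x
  norm_sq x := norm_leftInner_self M x

theorem conj_inner_def (x y : X) :
    HilbertModule.inner (A := B) (toConj M x) (toConj M y) = M.leftInner x y := rfl

theorem conj_act_def (x : X) (b : B) :
    HilbertModule.act (toConj M x) b = toConj M (M.act (star b) x) := rfl

/-- The left action of `A` on the conjugate bimodule. -/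
def conjLeftAction : LeftAction A B (ConjModule M) where
  act := conjLeft M
  mul_act d e x := by
    obtain ⟨x, rfl⟩ := exists_toConj M x
    rw [conjLeft_toConj, conjLeft_toConj, conjLeft_toConj, star_mul, HilbertModule.act_mul]
  inner_act_left e x y := by
    obtain ⟨x, rfl⟩ := exists_toConj M x
    obtain ⟨y, rfl⟩ := exists_toConj M y
    rw [conjLeft_toConj, conjLeft_toConj, conj_inner_def, conj_inner_def, M.leftInner_act_right]

end Conjugate

/-! ### The left inner product of the external tensor product -/

section TensorLeftInner

variable {B A X C : Type u} [NonUnitalCStarAlgebra B] [NonUnitalCStarAlgebra A]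
  [NormedAddCommGroup X] [NormedSpace ℂ X] [CompleteSpace X] [HilbertModule A X]
  [NonUnitalCStarAlgebra C] (M : ImprimitivityBimodule B A X)

variable (C) in
/-- The map `x ⊗ c ↦ x̃ ⊗ c*` from `X ⊙ C` to `X̃ ⊙ C`. -/
def tConj : X ⊗[ℂ] C →ₗ⋆[ℂ] ConjModule M ⊗[ℂ] C :=
  TensorProduct.map (toConj M) (starLinearEquiv ℂ : C ≃ₗ⋆[ℂ] C).toLinearMap

theorem tConj_tmul (x : X) (c : C) : tConj C M (x ⊗ₜ c) = toConj M x ⊗ₜ star c := rfl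

theorem tAct_tConj (u w r : X ⊗[ℂ] C) :
    tAct B (ConjModule M) C (tConj C M u) (tInner B (ConjModule M) C (tConj C M w) (tConj C M r)) =
      tLeft C (conjLeftAction M) (tInner A X C u w) (tConj C M r) := by
  induction u with
  | zero => simp
  | add u₁ u₂ h₁ h₂ => simp only [map_add, LinearMap.add_apply, h₁, h₂]
  | tmul x c =>
    induction w with
    | zero => simp
    | add w₁ w₂ h₁ h₂ => simp only [map_add, LinearMap.add_apply, h₁, h₂]
    | tmul y d =>
      induction r with
      | zero => simp
      | add r₁ r₂ h₁ h₂ => simp only [map_add, h₁, h₂]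
      | tmul z e =>
        rw [tConj_tmul, tConj_tmul, tConj_tmul, tInner_tmul, tAct_tmul, tInner_tmul, tLeft_tmul,
          conj_inner_def, conj_act_def, M.star_leftInner, M.leftInner_act_eq, star_star,
          ← HilbertModule.star_inner x y, ← mul_assoc]
        change _ = conjLeft M _ _ ⊗ₜ _
        rw [conjLeft_toConj, HilbertModule.star_inner]

/-- The map `x ⊗ c ↦ x̃ ⊗ c*` is contractive. Writing `v = ũ`, this comes from
`⟨v, v⟩² = ⟨v, v · ⟨v, v⟩_B⟩ = ⟨v, ⟨u, u⟩_A · v⟩`. -/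
theorem hNorm_tConj_le (u : X ⊗[ℂ] C) : hNorm B (tConj C M u) ≤ hNorm A u := by
  set v := tConj C M u with hv
  set N := hNorm B v with hN
  have hg : N ^ 2 = minNorm (tInner B (ConjModule M) C v v) := hNorm_sq v
  have h1 : N ^ 2 * N ^ 2 ≤ N * (hNorm A u ^ 2 * N) := by
    have e : star (tInner B (ConjModule M) C v v) * tInner B (ConjModule M) C v v =
        tInner B (ConjModule M) C v (tLeft C (conjLeftAction M) (tInner A X C u u) v) := by
      rw [HilbTensor.tInner_star, hv, ← tAct_tConj, HilbTensor.tInner_act]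
    rw [hg]
    refine (minNorm_sq_le _).trans ?_
    rw [e, hNorm_sq]
    refine (minNorm_tInner_le _ _).trans ?_
    exact mul_le_mul_of_nonneg_left (hNorm_tLeft_le _ _ _) (hNorm_nonneg _)
  rcases (hNorm_nonneg (A := B) v).eq_or_lt with h0 | h0
  · rw [hN, ← h0]; exact hNorm_nonneg u
  refine le_of_sq_le_sq ?_ (hNorm_nonneg u)
  have : 0 < N ^ 2 := by positivity
  nlinarith

variable (C) in
/-- The contraction `x ⊗ c ↦ x̃ ⊗ c*` on the uncompleted tensor products. -/
def conjPre : HilbPre A X C →SL[starRingEnd ℂ] HilbPre B (ConjModule M) C :=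
  LinearMap.mkContinuous (E := HilbPre A X C) (F := HilbPre B (ConjModule M) C) (tConj C M) 1
    (fun u => by rw [one_mul]; exact hNorm_tConj_le M u)

variable (C) in
/-- The map `x ⊗ c ↦ x̃ ⊗ c*` from `X ⊗ C` to `X̃ ⊗ C`. -/
def conjTensor : HilbTensor A X C →SL[starRingEnd ℂ] HilbTensor B (ConjModule M) C :=
  (conjPre C M).completion

theorem conjTensor_of (u : X ⊗[ℂ] C) :
    conjTensor C M (HilbTensor.of A u) = HilbTensor.of B (tConj C M u) :=
  ContinuousLinearMap.completion_apply_coe (conjPre C M) u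

variable (C) in
/-- The `B ⊗ C`-valued inner product of `X ⊗ C`,
`⟨x ⊗ c, y ⊗ d⟩ = _B⟨x, y⟩ ⊗ c d*`, obtained from the right inner product of `X̃ ⊗ C`. -/
def tensorLeftInner (z w : HilbTensor A X C) : MinTensor B C :=
  HilbTensor.innerL (conjTensor C M z) (conjTensor C M w)

variable (C) in
/-- `tensorLeftInner` as a continuous linear map of the first variable. -/
def tensorLeftInnerFst (w : HilbTensor A X C) : HilbTensor A X C →L[ℂ] MinTensor B C :=
  (HilbTensor.innerL.flip (conjTensor C M w)).comp (conjTensor C M)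

variable (C) in
/-- `tensorLeftInner` as a continuous conjugate-linear map of the second variable. -/
def tensorLeftInnerSnd (z : HilbTensor A X C) :
    HilbTensor A X C →SL[starRingEnd ℂ] MinTensor B C :=
  (HilbTensor.innerL (conjTensor C M z)).comp (conjTensor C M)

theorem tensorLeftInnerSnd_apply (z w : HilbTensor A X C) :
    tensorLeftInnerSnd C M z w = tensorLeftInner C M z w := rfl

theorem tensorLeftInner_tmul (x y : X) (c d : C) :
    tensorLeftInner C M (HilbTensor.tmul A x c) (HilbTensor.tmul A y d) =
      MinTensor.tmul (M.leftInner x y) (c * star d) := by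
  rw [tensorLeftInner, HilbTensor.tmul, HilbTensor.tmul, conjTensor_of, conjTensor_of,
    HilbTensor.innerL_of, tConj_tmul, tConj_tmul, tInner_tmul, star_star]
  rfl

end TensorLeftInner

/-! ### The Rieffel correspondence -/

section Rieffel

variable {B A X : Type*} [NonUnitalCStarAlgebra B] [NonUnitalCStarAlgebra A]
  [NormedAddCommGroup X] [NormedSpace ℂ X] [CompleteSpace X] [HilbertModule A X]

variable (A) in
theorem eq_of_forall_inner {x y : X}
    (h : ∀ z, HilbertModule.inner (A := A) x z = HilbertModule.inner (A := A) y z) : x = y := by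
  rw [← sub_eq_zero]
  refine eq_zero_of_inner_self A ?_
  rw [LinearMap.map_sub₂, h, sub_self]

theorem LeftAction.act_right (L : LeftAction B A X) (b : B) (x : X) (a : A) :
    L.act b (HilbertModule.act x a) = HilbertModule.act (L.act b x) a :=
  eq_of_forall_inner A fun z => by
    rw [L.inner_act_left, CStarCoaction.inner_act_left, CStarCoaction.inner_act_left,
      L.inner_act_left]

variable (M : ImprimitivityBimodule B A X)

theorem act_injective {b c : B} (h : ∀ x, M.act b x = M.act c x) : b = c := by
  refine eq_of_forall_mul_right fun s => ?_
  refine eq_on_of_closedSpan (ContinuousLinearMap.mul ℂ B b) (ContinuousLinearMap.mul ℂ B c)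
    M.full_left ?_ s
  rintro _ ⟨x, y, rfl⟩
  change b * _ = c * _
  rw [← M.leftInner_act, ← M.leftInner_act, h]

variable {I : Submodule ℂ A}

theorem leftInner_mem_rieffel (x y : X) {a : A} (ha : a ∈ I) :
    M.leftInner (HilbertModule.act x a) y ∈ M.rieffel I :=
  subset_closedSpan ⟨x, y, a, ha, rfl⟩

theorem isClosedIdeal_rieffel : IsClosedIdeal (M.rieffel I) := by
  refine isClosedIdeal_closedSpan ?_ ?_
  · rintro b _ ⟨x, y, a, ha, rfl⟩
    rw [← M.leftInner_act, M.act_right]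
    exact leftInner_mem_rieffel M _ _ ha
  · rintro b _ ⟨x, y, a, ha, rfl⟩
    rw [← star_star b, ← leftInner_act_left]
    exact leftInner_mem_rieffel M _ _ ha

variable (X I) in
/-- The closed submodule `X · I` of a Hilbert module. -/
def idealModule : Submodule ℂ X := closedSpan {x | ∃ y : X, ∃ a ∈ I, x = HilbertModule.act y a}

theorem act_mem_idealModule (x : X) {a : A} (ha : a ∈ I) :
    HilbertModule.act x a ∈ idealModule X I :=
  subset_closedSpan ⟨x, a, ha, rfl⟩

theorem rieffel_act_mem (hI : IsClosedIdeal I) {b : B} (hb : b ∈ M.rieffel I) (x : X) :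
    M.act b x ∈ idealModule X I := by
  refine map_mem_of_mem_closedSpan (M.actCLM.flip x) (isClosed_closedSpan _) ?_ hb
  rintro _ ⟨y, z, a, ha, rfl⟩
  change M.act _ x ∈ _
  rw [M.leftInner_act_eq, ← HilbertModule.act_mul]
  exact act_mem_idealModule y (hI.mul_mem_right _ _ ha)

/-- With `J` the ideal of `B` associated to `I`, one has `X · I ⊆ closure (J · X)`, because
`x · a⟨y, z⟩_A = _B⟨x · a, y⟩ · z`. -/
theorem act_mem_closedSpan_rieffel (x : X) {a : A} (ha : a ∈ I) :
    HilbertModule.act x a ∈ closedSpan {z | ∃ b ∈ M.rieffel I, ∃ y : X, z = M.act b y} := by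
  refine mem_of_forall_act_mem A (isClosed_closedSpan _) fun c => ?_
  refine map_mem_of_mem_closedSpan (S := {a : A | ∃ x y : X, a = HilbertModule.inner x y})
    (actCLM A X (HilbertModule.act x a)) (isClosed_closedSpan _) ?_
    (by rw [M.full_right]; trivial)
  rintro _ ⟨y, z, rfl⟩
  rw [actCLM_apply, ← M.leftInner_act_eq]
  exact subset_closedSpan ⟨_, leftInner_mem_rieffel M _ _ ha, z, rfl⟩

theorem inner_mem_of_mem_idealModule (hI : IsClosedIdeal I) (x : X) {y : X}
    (hy : y ∈ idealModule X I) : HilbertModule.inner x y ∈ I := by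
  refine map_mem_of_mem_closedSpan (innerCLM A X x) hI.isClosed ?_ hy
  rintro _ ⟨z, a, ha, rfl⟩
  rw [innerCLM_apply, HilbertModule.inner_act]
  exact hI.mul_mem_left _ _ ha

theorem mem_closedSpan_inner_act (M : ImprimitivityBimodule B A X) {a : A} (ha : a ∈ I) :
    a ∈ closedSpan {c | ∃ x y : X, ∃ a ∈ I,
      c = HilbertModule.inner (A := A) x (HilbertModule.act y a)} := by
  refine mem_of_forall_mul_left_mem (isClosed_closedSpan _) fun c => ?_
  refine map_mem_of_mem_closedSpan (S := {a : A | ∃ x y : X, a = HilbertModule.inner x y})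
    ((ContinuousLinearMap.mul ℂ A).flip a) (isClosed_closedSpan _) ?_
    (by rw [M.full_right]; trivial)
  rintro _ ⟨x, y, rfl⟩
  change _ * a ∈ _
  rw [← HilbertModule.inner_act]
  exact subset_closedSpan ⟨x, y, a, ha, rfl⟩

/-- The inverse of the Rieffel correspondence: `I` is spanned by the `⟨x, b · y⟩_A`, `b ∈ J`. -/
theorem mem_closedSpan_inner_rieffel {a : A} (ha : a ∈ I) :
    a ∈ closedSpan {c | ∃ x y : X, ∃ b ∈ M.rieffel I,
      c = HilbertModule.inner (A := A) x (M.act b y)} := by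
  refine closedSpan_le (isClosed_closedSpan _) ?_ (mem_closedSpan_inner_act M ha)
  rintro _ ⟨x, y, a, ha, rfl⟩
  refine map_mem_of_mem_closedSpan (innerCLM A X x) (isClosed_closedSpan _) ?_
    (act_mem_closedSpan_rieffel M y ha)
  rintro _ ⟨b, hb, y, rfl⟩
  exact subset_closedSpan ⟨x, y, b, hb, rfl⟩

end Rieffel

/-! ### Compatible actions -/

section Actions

variable {G : Type*} [TopologicalSpace G] [Group G] {B A X : Type*} [NonUnitalCStarAlgebra B]
  [NonUnitalCStarAlgebra A] [NormedAddCommGroup X] [NormedSpace ℂ X] [CompleteSpace X]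
  [HilbertModule A X]

/-- A *-isomorphism as a continuous linear map. -/
def starEquivCLM {D : Type*} [NonUnitalCStarAlgebra D] (φ : D ≃⋆ₐ[ℂ] D) : D →L[ℂ] D :=
  LinearMap.mkContinuous
    { toFun := φ, map_add' := map_add φ, map_smul' := map_smul φ } 1
    (fun d => by rw [one_mul]; exact NonUnitalStarAlgHom.norm_apply_le φ d)

theorem IsCompatibleAction.map_leftInner {M : ImprimitivityBimodule B A X} {β : G →* (B ≃⋆ₐ[ℂ] B)}
    {α : G →* (A ≃⋆ₐ[ℂ] A)} {γ : G →* (X ≃ₗ[ℂ] X)} (h : IsCompatibleAction M.toLeftAction β α γ)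
    (s : G) (x y : X) : β s (M.leftInner x y) = M.leftInner (γ s x) (γ s y) := by
  refine act_injective M fun z => ?_
  obtain ⟨z, rfl⟩ := (γ s).surjective z
  rw [← h.map_left, M.leftInner_act_eq, h.map_right, M.leftInner_act_eq, h.map_inner]

theorem IsCompatibleAction.invariant_iff {M : ImprimitivityBimodule B A X} {I : Submodule ℂ A}
    (hI : IsClosedIdeal I) {β : G →* (B ≃⋆ₐ[ℂ] B)} {α : G →* (A ≃⋆ₐ[ℂ] A)} {γ : G →* (X ≃ₗ[ℂ] X)}
    (h : IsCompatibleAction M.toLeftAction β α γ) :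
    IsActionInvariant α I ↔ IsActionInvariant β (M.rieffel I) := by
  constructor
  · intro hα s b hb
    refine map_mem_of_mem_closedSpan (starEquivCLM (β s)) (isClosed_closedSpan _) ?_ hb
    rintro _ ⟨x, y, a, ha, rfl⟩
    change β s _ ∈ _
    rw [h.map_leftInner, h.map_right]
    exact leftInner_mem_rieffel M _ _ (hα s a ha)
  · intro hβ s a ha
    refine map_mem_of_mem_closedSpan (starEquivCLM (α s)) hI.isClosed ?_
      (mem_closedSpan_inner_rieffel M ha)
    rintro _ ⟨x, y, b, hb, rfl⟩
    change α s _ ∈ _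
    rw [← h.map_inner, h.map_left]
    exact inner_mem_of_mem_idealModule hI _ (rieffel_act_mem M hI (hβ s b hb) _)

end Actions

/-! ### Nondegenerate left actions -/

section Nondegenerate

variable {B A X : Type*} [NonUnitalCStarAlgebra B] [NonUnitalCStarAlgebra A]
  [NormedAddCommGroup X] [NormedSpace ℂ X] [CompleteSpace X] [HilbertModule A X]

open Filter Topology in
/-- If `B · X` spans a dense subspace, some net of contractions in `B` acts as an approximate
identity on `X`. -/
theorem LeftAction.exists_tendsto (L : LeftAction B A X)
    (hL : closedSpan {z | ∃ b x, z = L.act b x} = ⊤) :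
    ∃ l : Filter B, l.NeBot ∧ (∀ᶠ e in l, ‖e‖ ≤ 1) ∧
      ∀ x, Tendsto (fun e => L.act e x) l (𝓝 x) := by
  let _ := CStarAlgebra.spectralOrder B
  have _ := CStarAlgebra.spectralOrderedRing B
  have hu := CStarAlgebra.increasingApproximateUnit B
  refine ⟨CStarAlgebra.approximateUnit B, hu.neBot, hu.eventually_norm, fun x => ?_⟩
  let N : Submodule ℂ X :=
    { carrier := {x | Tendsto (fun e => L.act e x) (CStarAlgebra.approximateUnit B) (𝓝 x)}
      add_mem' := fun {x y} hx hy => by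
        change Tendsto (fun e => L.act e (x + y)) _ _
        simp only [map_add]
        exact hx.add hy
      zero_mem' := by
        change Tendsto (fun e => L.act e 0) _ _
        simp only [map_zero]
        exact tendsto_const_nhds
      smul_mem' := fun c x hx => by
        change Tendsto (fun e => L.act e (c • x)) _ _
        simp only [map_smul]
        exact hx.const_smul c }
  have hN : IsClosed (N : Set X) := by
    refine isClosed_of_closure_subset fun x hx => ?_
    refine Metric.tendsto_nhds.2 fun ε hε => ?_
    obtain ⟨y, hy, hxy⟩ := Metric.mem_closure_iff.1 hx (ε / 3) (by positivity)
    filter_upwards [Metric.tendsto_nhds.1 hy (ε / 3) (by positivity), hu.eventually_norm]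
      with e he he1
    rw [dist_eq_norm] at he hxy ⊢
    have h1 : ‖L.act e (x - y)‖ ≤ 1 * ‖x - y‖ :=
      (L.norm_act_le e _).trans (by gcongr)
    have h2 : L.act e x - x = L.act e (x - y) + (L.act e y - y) - (x - y) := by
      rw [map_sub]; abel
    rw [h2]
    calc _ ≤ ‖L.act e (x - y)‖ + ‖L.act e y - y‖ + ‖x - y‖ :=
          (norm_sub_le _ _).trans (by gcongr; exact norm_add_le _ _)
      _ < ε := by linarith
  refine closedSpan_le (N := N) hN ?_ (by rw [hL]; trivial : x ∈ closedSpan _)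
  rintro _ ⟨b, x, rfl⟩
  change Tendsto (fun e => L.act e (L.act b x)) _ _
  simp only [← L.mul_act]
  exact ((L.actCLM.flip x).continuous.tendsto b).comp (hu.tendsto_mul_right b)

theorem LeftAction.mem_of_forall_act_mem (L : LeftAction B A X)
    (hL : closedSpan {z | ∃ b x, z = L.act b x} = ⊤) {N : Submodule ℂ X}
    (hN : IsClosed (N : Set X)) {x : X} (h : ∀ b, L.act b x ∈ N) : x ∈ N := by
  obtain ⟨l, _, -, hl⟩ := L.exists_tendsto hL
  exact hN.mem_of_tendsto (hl x) (.of_forall h)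

theorem LeftAction.norm_le_of_forall_act (L : LeftAction B A X)
    (hL : closedSpan {z | ∃ b x, z = L.act b x} = ⊤) {x : X} {K : ℝ} (hK : 0 ≤ K)
    (h : ∀ b, ‖L.act b x‖ ≤ ‖b‖ * K) : ‖x‖ ≤ K := by
  obtain ⟨l, _, hl1, hl⟩ := L.exists_tendsto hL
  refine le_of_tendsto (hl x).norm ?_
  filter_upwards [hl1] with e he
  exact (h e).trans (mul_le_of_le_one_left hK he)

end Nondegenerate

/-! ### Ideals and submodules of tensor products -/

section TensorSpans

variable {B A X C : Type u} [NonUnitalCStarAlgebra B] [NonUnitalCStarAlgebra A]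
  [NormedAddCommGroup X] [NormedSpace ℂ X] [CompleteSpace X] [HilbertModule A X]
  [NonUnitalCStarAlgebra C]

theorem MinTensor.norm_tmul_le (a : A) (c : C) : ‖MinTensor.tmul a c‖ ≤ ‖a‖ * ‖c‖ := by
  rw [MinTensor.tmul, MinTensor.norm_of]
  refine minNorm_le (by positivity) ?_
  intro H K _ _ _ _ _ _ π σ v
  rw [repTensor_tmul]
  refine (norm_map_le _ _ _).trans (mul_le_mul_of_nonneg_right ?_ (norm_nonneg _))
  exact mul_le_mul (NonUnitalStarAlgHom.norm_apply_le π a) (NonUnitalStarAlgHom.norm_apply_le σ c)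
    (norm_nonneg _) (norm_nonneg _)

theorem HilbTensor.norm_tmul_le (x : X) (c : C) : ‖HilbTensor.tmul A x c‖ ≤ ‖x‖ * ‖c‖ := by
  refine le_of_sq_le_sq ?_ (by positivity)
  rw [HilbTensor.tmul, HilbTensor.norm_of, hNorm_sq, tInner_tmul, ← MinTensor.norm_of]
  refine (MinTensor.norm_tmul_le _ _).trans ?_
  rw [← HilbertModule.norm_sq, CStarRing.norm_star_mul_self, ← sq, mul_pow]

variable (A C) in
/-- The elementary tensors of `A ⊗ C` as a continuous bilinear map. -/
def tmulCLM : A →L[ℂ] C →L[ℂ] MinTensor A C :=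
  ((TensorProduct.mk ℂ A C).compr₂ MinTensor.of).mkContinuous₂ 1 fun a c => by
    rw [one_mul]; exact MinTensor.norm_tmul_le a c

variable (A X C) in
/-- The elementary tensors of `X ⊗ C` as a continuous bilinear map. -/
def hilbTmulCLM : X →L[ℂ] C →L[ℂ] HilbTensor A X C :=
  ((TensorProduct.mk ℂ X C).compr₂ (HilbTensor.of A)).mkContinuous₂ 1 fun x c => by
    rw [one_mul]; exact HilbTensor.norm_tmul_le x c

variable (A C) in
theorem closedSpan_tmul : closedSpan {z : MinTensor A C | ∃ a c, z = MinTensor.tmul a c} = ⊤ := by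
  refine (Submodule.eq_top_iff').2 fun z => ?_
  refine MinTensor.induction (p := fun z => z ∈ closedSpan {z | ∃ a c, z = MinTensor.tmul a c}) z
    (isClosed_closedSpan _) fun t => ?_
  induction t with
  | zero => rw [map_zero]; exact Submodule.zero_mem _
  | add s t hs ht => rw [map_add]; exact Submodule.add_mem _ hs ht
  | tmul a c => exact subset_closedSpan ⟨a, c, rfl⟩

variable (A X C) in
theorem closedSpan_hilbTmul :
    closedSpan {z : HilbTensor A X C | ∃ x c, z = HilbTensor.tmul A x c} = ⊤ := by
  refine (Submodule.eq_top_iff').2 fun z => ?_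
  refine HilbTensor.induction (p := fun z => z ∈ closedSpan {z | ∃ a c, z = HilbTensor.tmul A a c})
    z (isClosed_closedSpan _) fun t => ?_
  induction t with
  | zero => rw [map_zero]; exact Submodule.zero_mem _
  | add s t hs ht => rw [map_add]; exact Submodule.add_mem _ hs ht
  | tmul a c => exact subset_closedSpan ⟨a, c, rfl⟩

/-- A continuous (semi)linear map on `A ⊗ C` takes values in a closed subspace if it does so on
elementary tensors. -/
theorem MinTensor.map_mem {V : Type*} [NormedAddCommGroup V] [NormedSpace ℂ V] {σ : ℂ →+* ℂ}
    (f : MinTensor A C →SL[σ] V) {N : Submodule ℂ V} (hN : IsClosed (N : Set V))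
    (h : ∀ a c, f (MinTensor.tmul a c) ∈ N) (z : MinTensor A C) : f z ∈ N :=
  map_mem_of_mem_closedSpan f hN (by rintro _ ⟨a, c, rfl⟩; exact h a c)
    (by rw [closedSpan_tmul]; trivial : z ∈ closedSpan {z | ∃ a c, z = MinTensor.tmul a c})

/-- A continuous (semi)linear map on `X ⊗ C` takes values in a closed subspace if it does so on
elementary tensors. -/
theorem HilbTensor.map_mem {V : Type*} [NormedAddCommGroup V] [NormedSpace ℂ V] {σ : ℂ →+* ℂ}
    (f : HilbTensor A X C →SL[σ] V) {N : Submodule ℂ V} (hN : IsClosed (N : Set V))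
    (h : ∀ x c, f (HilbTensor.tmul A x c) ∈ N) (z : HilbTensor A X C) : f z ∈ N :=
  map_mem_of_mem_closedSpan f hN (by rintro _ ⟨a, c, rfl⟩; exact h a c)
    (by rw [closedSpan_hilbTmul]; trivial :
      z ∈ closedSpan {z | ∃ x c, z = HilbTensor.tmul A x c})

theorem MinTensor.tmul_mul_tmul (a b : A) (c d : C) :
    MinTensor.tmul a c * MinTensor.tmul b d = MinTensor.tmul (a * b) (c * d) := by
  rw [MinTensor.tmul, MinTensor.tmul, ← MinTensor.of_mul, Algebra.TensorProduct.tmul_mul_tmul]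
  rfl

theorem HilbTensor.act_tmul (x : X) (a : A) (c d : C) :
    HilbertModule.act (HilbTensor.tmul A x c) (MinTensor.tmul a d) =
      HilbTensor.tmul A (HilbertModule.act x a) (c * d) :=
  HilbTensor.actL_of _ _

theorem HilbTensor.inner_tmul (x y : X) (c d : C) :
    HilbertModule.inner (A := MinTensor A C) (HilbTensor.tmul A x c) (HilbTensor.tmul A y d) =
      MinTensor.tmul (HilbertModule.inner x y) (star c * d) :=
  HilbTensor.innerL_of _ _

theorem HilbTensor.leftAction_tmul (L : LeftAction B A X) (b : B) (x : X) (c d : C) :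
    (HilbTensor.leftAction C L).act (MinTensor.tmul b c) (HilbTensor.tmul A x d) =
      HilbTensor.tmul A (L.act b x) (c * d) :=
  HilbTensor.leftL_of L _ _

theorem HilbTensor.oneAct_tmul (x : X) (c d : C) :
    HilbTensor.oneAct c (HilbTensor.tmul A x d) = HilbTensor.tmul A x (c * d) :=
  HilbTensor.oneAct_of _ _

theorem idealTensor_top : idealTensor C (⊤ : Submodule ℂ A) = ⊤ := by
  rw [← closedSpan_tmul, idealTensor]
  simp

variable {I : Submodule ℂ A}

theorem tmul_mem_idealTensor {a : A} (ha : a ∈ I) (c : C) :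
    MinTensor.tmul a c ∈ idealTensor C I := subset_closedSpan ⟨a, ha, c, rfl⟩

theorem isClosedIdeal_idealTensor (hI : IsClosedIdeal I) : IsClosedIdeal (idealTensor C I) := by
  refine isClosedIdeal_closedSpan ?_ ?_
  · rintro t _ ⟨a, ha, c, rfl⟩
    refine MinTensor.map_mem ((ContinuousLinearMap.mul ℂ (MinTensor A C)).flip
      (MinTensor.tmul a c)) (isClosed_closedSpan _) (fun b d => ?_) t
    change MinTensor.tmul b d * MinTensor.tmul a c ∈ _
    rw [MinTensor.tmul_mul_tmul]
    exact tmul_mem_idealTensor (hI.mul_mem_left _ _ ha) _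
  · rintro t _ ⟨a, ha, c, rfl⟩
    refine MinTensor.map_mem (ContinuousLinearMap.mul ℂ (MinTensor A C)
      (MinTensor.tmul a c)) (isClosed_closedSpan _) (fun b d => ?_) t
    change MinTensor.tmul a c * MinTensor.tmul b d ∈ _
    rw [MinTensor.tmul_mul_tmul]
    exact tmul_mem_idealTensor (hI.mul_mem_right _ _ ha) _

variable (X C I) in
/-- The closed submodule `(X · I) ⊗ C` of `X ⊗ C`. -/
def moduleTensor : Submodule ℂ (HilbTensor A X C) :=
  closedSpan {z | ∃ x : X, ∃ a ∈ I, ∃ c : C, z = HilbTensor.tmul A (HilbertModule.act x a) c}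

theorem isClosed_moduleTensor : IsClosed (moduleTensor X C I : Set (HilbTensor A X C)) :=
  isClosed_closedSpan _

theorem tmul_mem_moduleTensor {x : X} (hx : x ∈ idealModule X I) (c : C) :
    HilbTensor.tmul A x c ∈ moduleTensor X C I := by
  refine map_mem_of_mem_closedSpan ((hilbTmulCLM A X C).flip c) isClosed_moduleTensor ?_ hx
  rintro _ ⟨y, a, ha, rfl⟩
  exact subset_closedSpan ⟨y, a, ha, c, rfl⟩

theorem act_mem_moduleTensor (z : HilbTensor A X C) {t : MinTensor A C}
    (ht : t ∈ idealTensor C I) : HilbertModule.act z t ∈ moduleTensor X C I := by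
  refine map_mem_of_mem_closedSpan (actCLM (MinTensor A C) (HilbTensor A X C) z)
    isClosed_moduleTensor ?_ ht
  rintro _ ⟨a, ha, c, rfl⟩
  refine HilbTensor.map_mem ((actCLM (MinTensor A C) (HilbTensor A X C)).flip (MinTensor.tmul a c))
    isClosed_moduleTensor (fun x d => ?_) z
  change HilbertModule.act (HilbTensor.tmul A x d) (MinTensor.tmul a c) ∈ _
  rw [HilbTensor.act_tmul]
  exact tmul_mem_moduleTensor (act_mem_idealModule x ha) _

theorem mem_closedSpan_act {z : HilbTensor A X C} (hz : z ∈ moduleTensor X C I) :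
    z ∈ closedSpan {w | ∃ y : HilbTensor A X C, ∃ t ∈ idealTensor C I,
      w = HilbertModule.act y t} := by
  refine closedSpan_le (isClosed_closedSpan _) ?_ hz
  rintro _ ⟨x, a, ha, c, rfl⟩
  refine mem_of_forall_mul_mem (a := c)
    (N := (closedSpan _).comap (hilbTmulCLM A X C (HilbertModule.act x a)).toLinearMap)
    ((isClosed_closedSpan _).preimage
      (hilbTmulCLM A X C (HilbertModule.act x a)).continuous) fun e => ?_
  refine subset_closedSpan ⟨HilbTensor.tmul A x c, MinTensor.tmul a e, tmul_mem_idealTensor ha e, ?_⟩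
  rw [HilbTensor.act_tmul]; rfl

theorem inner_mem_idealTensor (hI : IsClosedIdeal I) (w : HilbTensor A X C) {z : HilbTensor A X C}
    (hz : z ∈ moduleTensor X C I) :
    HilbertModule.inner (A := MinTensor A C) w z ∈ idealTensor C I := by
  refine map_mem_of_mem_closedSpan (innerCLM (MinTensor A C) (HilbTensor A X C) w)
    (isClosed_closedSpan _) ?_ hz
  rintro _ ⟨x, a, ha, c, rfl⟩
  refine HilbTensor.map_mem ((innerCLM (MinTensor A C) (HilbTensor A X C)).flip
    (HilbTensor.tmul A (HilbertModule.act x a) c))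
    (isClosed_closedSpan _) (fun y d => ?_) w
  change HilbertModule.inner (HilbTensor.tmul A y d) _ ∈ _
  rw [HilbTensor.inner_tmul, HilbertModule.inner_act]
  exact tmul_mem_idealTensor (hI.mul_mem_left _ _ ha) _

theorem oneAct_mem_moduleTensor (c : C) {z : HilbTensor A X C} (hz : z ∈ moduleTensor X C I) :
    HilbTensor.oneAct c z ∈ moduleTensor X C I := by
  refine map_mem_of_mem_closedSpan (HilbTensor.oneAct c) isClosed_moduleTensor ?_ hz
  rintro _ ⟨x, a, ha, d, rfl⟩
  rw [HilbTensor.oneAct_tmul]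
  exact tmul_mem_moduleTensor (act_mem_idealModule x ha) _

variable (M : ImprimitivityBimodule B A X)

theorem idealTensor_le_closedSpan_inner (M : ImprimitivityBimodule B A X) : idealTensor C I ≤
    closedSpan {t | ∃ w, ∃ z ∈ moduleTensor X C I,
      t = HilbertModule.inner (A := MinTensor A C) w z} := by
  refine closedSpan_le (isClosed_closedSpan _) ?_
  rintro _ ⟨a, ha, c, rfl⟩
  refine mem_of_forall_mul_left_mem (a := c)
    (N := (closedSpan _).comap (tmulCLM A C a).toLinearMap)
    ((isClosed_closedSpan _).preimage (tmulCLM A C a).continuous) fun e => ?_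
  refine map_mem_of_mem_closedSpan ((tmulCLM A C).flip (e * c)) (isClosed_closedSpan _) ?_
    (mem_closedSpan_inner_act M ha)
  rintro _ ⟨x, y, a, ha, rfl⟩
  refine subset_closedSpan ⟨HilbTensor.tmul A x (star e), HilbTensor.tmul A (HilbertModule.act y a) c,
    tmul_mem_moduleTensor (act_mem_idealModule y ha) c, ?_⟩
  rw [HilbTensor.inner_tmul, star_star]; rfl

theorem leftAction_mem_moduleTensor (hI : IsClosedIdeal I) {s : MinTensor B C}
    (hs : s ∈ idealTensor C (M.rieffel I)) (z : HilbTensor A X C) :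
    (HilbTensor.leftAction C M.toLeftAction).act s z ∈ moduleTensor X C I := by
  refine map_mem_of_mem_closedSpan ((HilbTensor.leftAction C M.toLeftAction).actCLM.flip z)
    isClosed_moduleTensor ?_ hs
  rintro _ ⟨b, hb, c, rfl⟩
  refine HilbTensor.map_mem ((HilbTensor.leftAction C M.toLeftAction).actCLM (MinTensor.tmul b c))
    isClosed_moduleTensor (fun x d => ?_) z
  rw [LeftAction.actCLM_apply, HilbTensor.leftAction_tmul]
  exact tmul_mem_moduleTensor (rieffel_act_mem M hI hb x) _

theorem mem_closedSpan_leftAction {z : HilbTensor A X C} (hz : z ∈ moduleTensor X C I) :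
    z ∈ closedSpan {w | ∃ s ∈ idealTensor C (M.rieffel I), ∃ y,
      w = (HilbTensor.leftAction C M.toLeftAction).act s y} := by
  refine closedSpan_le (isClosed_closedSpan _) ?_ hz
  rintro _ ⟨x, a, ha, c, rfl⟩
  refine map_mem_of_mem_closedSpan ((hilbTmulCLM A X C).flip c) (isClosed_closedSpan _) ?_
    (act_mem_closedSpan_rieffel M x ha)
  rintro _ ⟨b, hb, y, rfl⟩
  refine mem_of_forall_mul_mem (a := c)
    (N := (closedSpan _).comap (hilbTmulCLM A X C (M.act b y)).toLinearMap)
    ((isClosed_closedSpan _).preimage (hilbTmulCLM A X C (M.act b y)).continuous) fun e => ?_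
  refine subset_closedSpan ⟨MinTensor.tmul b c, tmul_mem_idealTensor hb c, HilbTensor.tmul A y e, ?_⟩
  rw [HilbTensor.leftAction_tmul]; rfl

variable (C) in
theorem closedSpan_leftAction : closedSpan {z | ∃ s y,
    z = (HilbTensor.leftAction C M.toLeftAction).act s y} = ⊤ := by
  refine (Submodule.eq_top_iff').2 fun z => ?_
  refine HilbTensor.map_mem (.id ℂ _) (isClosed_closedSpan _) (fun x c => ?_) z
  refine mem_of_forall_act_mem A (x := x)
    (N := (closedSpan _).comap ((hilbTmulCLM A X C).flip c).toLinearMap)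
    ((isClosed_closedSpan _).preimage ((hilbTmulCLM A X C).flip c).continuous) fun a => ?_
  refine map_mem_of_mem_closedSpan (S := {a : A | ∃ x y : X, a = HilbertModule.inner x y})
    (((hilbTmulCLM A X C).flip c).comp (actCLM A X x)) (isClosed_closedSpan _) ?_
    (by rw [M.full_right]; trivial)
  rintro _ ⟨y, y', rfl⟩
  change HilbTensor.tmul A (HilbertModule.act x (HilbertModule.inner y y')) c ∈ _
  rw [← M.leftInner_act_eq]
  refine mem_of_forall_mul_mem (a := c)
    (N := (closedSpan _).comap (hilbTmulCLM A X C (M.act (M.leftInner x y) y')).toLinearMap)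
    ((isClosed_closedSpan _).preimage
      (hilbTmulCLM A X C (M.act (M.leftInner x y) y')).continuous) fun e => ?_
  refine subset_closedSpan ⟨MinTensor.tmul (M.leftInner x y) c, HilbTensor.tmul A y' e, ?_⟩
  rw [HilbTensor.leftAction_tmul]; rfl

theorem tensorLeftInner_act (s : MinTensor B C) (z w : HilbTensor A X C) :
    tensorLeftInner C M ((HilbTensor.leftAction C M.toLeftAction).act s z) w =
      s * tensorLeftInner C M z w := by
  have hB := closedSpan_tmul B C
  have hX := closedSpan_hilbTmul A X C
  refine eq_on_of_closedSpan
    ((tensorLeftInnerFst C M w).comp ((HilbTensor.leftAction C M.toLeftAction).actCLM.flip z))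
    ((ContinuousLinearMap.mul ℂ (MinTensor B C)).flip (tensorLeftInner C M z w)) hB ?_ s
  rintro _ ⟨b, c, rfl⟩
  refine eq_on_of_closedSpan ((tensorLeftInnerFst C M w).comp
      ((HilbTensor.leftAction C M.toLeftAction).actCLM (MinTensor.tmul b c)))
    ((ContinuousLinearMap.mul ℂ (MinTensor B C) (MinTensor.tmul b c)).comp
      (tensorLeftInnerFst C M w)) hX ?_ z
  rintro _ ⟨x, d, rfl⟩
  refine eq_on_of_closedSpan (tensorLeftInnerSnd C M
      ((HilbTensor.leftAction C M.toLeftAction).act (MinTensor.tmul b c) (HilbTensor.tmul A x d)))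
    ((ContinuousLinearMap.mul ℂ (MinTensor B C) (MinTensor.tmul b c)).comp
      (tensorLeftInnerSnd C M (HilbTensor.tmul A x d))) hX ?_ w
  rintro _ ⟨y, e, rfl⟩
  change tensorLeftInner C M _ _ = MinTensor.tmul b c * tensorLeftInner C M _ _
  rw [HilbTensor.leftAction_tmul, tensorLeftInner_tmul, tensorLeftInner_tmul,
    MinTensor.tmul_mul_tmul, M.leftInner_act, mul_assoc]

theorem tensorLeftInner_mem {z : HilbTensor A X C} (hz : z ∈ moduleTensor X C I)
    (w : HilbTensor A X C) : tensorLeftInner C M z w ∈ idealTensor C (M.rieffel I) := by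
  refine map_mem_of_mem_closedSpan (tensorLeftInnerFst C M w) (isClosed_closedSpan _) ?_ hz
  rintro _ ⟨x, a, ha, c, rfl⟩
  refine HilbTensor.map_mem (tensorLeftInnerSnd C M (HilbTensor.tmul A (HilbertModule.act x a) c))
    (isClosed_closedSpan _) (fun y d => ?_) w
  rw [tensorLeftInnerSnd_apply, tensorLeftInner_tmul]
  exact tmul_mem_idealTensor (leftInner_mem_rieffel M x y ha) _

theorem idealTensor_rieffel_le : idealTensor C (M.rieffel I) ≤
    closedSpan {s | ∃ z ∈ moduleTensor X C I, ∃ w, s = tensorLeftInner C M z w} := by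
  refine closedSpan_le (isClosed_closedSpan _) ?_
  rintro _ ⟨b, hb, c, rfl⟩
  refine mem_of_forall_mul_mem (a := c)
    (N := (closedSpan _).comap (tmulCLM B C b).toLinearMap)
    ((isClosed_closedSpan _).preimage (tmulCLM B C b).continuous) fun e => ?_
  refine map_mem_of_mem_closedSpan ((tmulCLM B C).flip (c * e)) (isClosed_closedSpan _) ?_ hb
  rintro _ ⟨x, y, a, ha, rfl⟩
  refine subset_closedSpan ⟨HilbTensor.tmul A (HilbertModule.act x a) c,
    tmul_mem_moduleTensor (act_mem_idealModule x ha) c, HilbTensor.tmul A y (star e), ?_⟩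
  rw [tensorLeftInner_tmul, star_star]; rfl

variable (C) in
theorem closedSpan_tensorLeftInner :
    closedSpan {s | ∃ z w, s = tensorLeftInner C M z w} = ⊤ := by
  refine (Submodule.eq_top_iff').2 fun s => ?_
  refine MinTensor.map_mem (.id ℂ _) (isClosed_closedSpan _) (fun b c => ?_) s
  refine mem_of_forall_mul_mem (a := c)
    (N := (closedSpan _).comap (tmulCLM B C b).toLinearMap)
    ((isClosed_closedSpan _).preimage (tmulCLM B C b).continuous) fun e => ?_
  refine map_mem_of_mem_closedSpan ((tmulCLM B C).flip (c * e)) (isClosed_closedSpan _) ?_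
    (by rw [M.full_left]; trivial : b ∈ closedSpan {b | ∃ x y, b = M.leftInner x y})
  rintro _ ⟨x, y, rfl⟩
  refine subset_closedSpan ⟨HilbTensor.tmul A x c, HilbTensor.tmul A y (star e), ?_⟩
  rw [tensorLeftInner_tmul, star_star]; rfl

end TensorSpans

/-! ### Multipliers and spans under isometries -/

section Isometry

variable {V W : Type*} [NormedAddCommGroup V] [NormedSpace ℂ V] [CompleteSpace V]
  [NormedAddCommGroup W] [NormedSpace ℂ W]

/-- If the closed span of `S` is the image of `N` under an isometry `f`, then `N` is spanned by the
elements that `f` maps into `S`. -/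
theorem le_closedSpan_preimage (f : V →ₗᵢ[ℂ] W) {S : Set W} {N : Submodule ℂ V}
    (h : (closedSpan S : Set W) = f '' N) : N ≤ closedSpan {v | f v ∈ S} := by
  intro v hv
  have hcl : IsClosed (((closedSpan {v | f v ∈ S}).map f.toLinearMap : Submodule ℂ W) : Set W) :=
    f.isometry.isClosedEmbedding.isClosedMap _ (isClosed_closedSpan _)
  have hle : closedSpan S ≤ (closedSpan {v | f v ∈ S}).map f.toLinearMap := by
    refine closedSpan_le hcl fun s hs => ?_
    obtain ⟨w, -, rfl⟩ : s ∈ f '' N := h ▸ subset_closedSpan hs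
    exact ⟨w, subset_closedSpan hs, rfl⟩
  obtain ⟨w, hw, hwv⟩ := hle (h ▸ ⟨v, hv, rfl⟩ : f v ∈ (closedSpan S : Set W))
  exact f.injective hwv ▸ hw

theorem closedSpan_eq_image (f : V →ₗᵢ[ℂ] W) {S : Set W} {N : Submodule ℂ V}
    (hN : IsClosed (N : Set V)) (h1 : ∀ s ∈ S, ∃ v ∈ N, f v = s)
    (h2 : N ≤ closedSpan {v | f v ∈ S}) : (closedSpan S : Set W) = f '' N := by
  refine Set.Subset.antisymm ?_ ?_
  · have hcl : IsClosed ((N.map f.toLinearMap : Submodule ℂ W) : Set W) :=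
      f.isometry.isClosedEmbedding.isClosedMap _ hN
    exact closedSpan_le hcl h1
  · rintro _ ⟨v, hv, rfl⟩
    exact map_mem_of_mem_closedSpan f.toContinuousLinearMap (isClosed_closedSpan S)
      (fun w hw => subset_closedSpan hw) (h2 hv)

omit [CompleteSpace V] in
theorem exists_mem_span_norm_sub_lt {S : Set V} {v : V} (hv : v ∈ closedSpan S) {ε : ℝ}
    (hε : 0 < ε) : ∃ w ∈ Submodule.span ℂ S, ‖v - w‖ < ε := by
  obtain ⟨w, hw, h⟩ := Metric.mem_closure_iff.1
    (show v ∈ closure (Submodule.span ℂ S : Set V) from hv) ε hε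
  exact ⟨w, hw, by rwa [← dist_eq_norm]⟩

/-- The inclusion of a C*-algebra into its multiplier algebra. -/
def multCoe (E : Type*) [NonUnitalCStarAlgebra E] : E →ₗᵢ[ℂ] 𝓜(ℂ, E) where
  toFun e := e
  map_add' := map_add (DoubleCentralizer.coeHom (𝕜 := ℂ) (A := E))
  map_smul' := map_smul (DoubleCentralizer.coeHom (𝕜 := ℂ) (A := E))
  norm_map' e := by
    change ‖(e : 𝓜(ℂ, E))‖ = ‖e‖
    rw [← DoubleCentralizer.norm_fst, DoubleCentralizer.coe_fst]
    exact ContinuousLinearMap.opNorm_mul_apply ℂ E e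

theorem coe_multCoe (E : Type*) [NonUnitalCStarAlgebra E] :
    ⇑(multCoe E) = fun e : E => (e : 𝓜(ℂ, E)) := rfl

theorem multCoe_eq_iff {E : Type*} [NonUnitalCStarAlgebra E] {e : E} {m : 𝓜(ℂ, E)} :
    multCoe E e = m ↔ ∀ f, e * f = m.fst f := by
  constructor
  · rintro rfl f; rfl
  · exact fun h => multiplier_ext h

/-- The inclusion of `X ⊗ C` into its multiplier module is isometric: with `g = ⟨z, z⟩` one has
`‖z · g‖² = ‖g³‖`. -/
def moduleOpIsometry (A X C : Type u) [NonUnitalCStarAlgebra A] [NonUnitalCStarAlgebra C]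
    [NormedAddCommGroup X] [NormedSpace ℂ X] [CompleteSpace X] [HilbertModule A X] :
    HilbTensor A X C →ₗᵢ[ℂ] ModuleOp A X C where
  toLinearMap := (toModuleOp A X C).toLinearMap
  norm_map' z := by
    change ‖toModuleOp A X C z‖ = ‖z‖
    refine le_antisymm (ContinuousLinearMap.opNorm_le_bound _ (norm_nonneg z)
      fun t => norm_act_le z t) ?_
    set g := HilbertModule.inner (A := MinTensor A C) z z with hg
    have hgs : star g = g := HilbertModule.star_inner z z
    have hn : ‖z‖ ^ 2 = ‖g‖ := HilbertModule.norm_sq z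
    have h1 : ‖HilbertModule.act z g‖ ≤ ‖toModuleOp A X C z‖ * ‖g‖ :=
      (toModuleOp A X C z).le_opNorm g
    have h2 : ‖g * g * g‖ ≤ (‖toModuleOp A X C z‖ * ‖z‖) ^ 2 * ‖g‖ := by
      have h3 : ‖HilbertModule.act z g‖ ^ 2 = ‖g * g * g‖ := by
        rw [HilbertModule.norm_sq (A := MinTensor A C), inner_act_left, HilbertModule.inner_act,
          ← hg, hgs, mul_assoc]
      rw [← h3, mul_pow, hn, mul_assoc, ← sq, ← mul_pow]
      gcongr
    have h4 := norm_cube_le hgs h2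
    rw [abs_of_nonneg (by positivity), ← hn, sq] at h4
    rcases (norm_nonneg z).eq_or_lt with h0 | h0
    · rw [← h0]; exact norm_nonneg _
    · exact le_of_mul_le_mul_right h4 h0

end Isometry

/-! ### Invariant ideals of coactions -/

section Coaction

variable {G : Type u} [TopologicalSpace G] [Group G] [IsTopologicalGroup G]
  [LocallyCompactSpace G] {A : Type u} [NonUnitalCStarAlgebra A]
  {δ : A →⋆ₙₐ[ℂ] 𝓜(ℂ, MinTensor A (GroupCStar G))} {I : Submodule ℂ A}

theorem multiplier_fst_mul {E : Type*} [NonUnitalCStarAlgebra E] (m : 𝓜(ℂ, E))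
    (e f : E) : m.fst (e * f) = m.fst e * f :=
  eq_of_forall_mul_left fun s => by
    rw [← m.central, ← mul_assoc, ← mul_assoc, m.central]

/-- The map `(d, e) ↦ φ(d) e` of a homomorphism `φ : D → M(E)`, as a continuous bilinear map. -/
def multActCLM {D E : Type u} [NonUnitalCStarAlgebra D] [NonUnitalCStarAlgebra E]
    (φ : D →⋆ₙₐ[ℂ] 𝓜(ℂ, E)) : D →L[ℂ] E →L[ℂ] E := (actOfHom φ).actCLM

/-- Elements of `N ⊗ C` are limits of sums of elements `(1 ⊗ c) s` with `s ∈ N ⊗ C`. -/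
theorem mem_closedSpan_oneTensor {C : Type u} [NonUnitalCStarAlgebra C] {N : Submodule ℂ A}
    {t : MinTensor A C} (ht : t ∈ idealTensor C N) :
    t ∈ closedSpan {t | ∃ c : C, ∃ s ∈ idealTensor C N, t = (oneTensor A C c).fst s} := by
  refine closedSpan_le (isClosed_closedSpan _) ?_ ht
  rintro _ ⟨a, ha, c, rfl⟩
  refine mem_of_forall_mul_left_mem (a := c)
    (N := (closedSpan _).comap (tmulCLM A C a).toLinearMap)
    ((isClosed_closedSpan _).preimage (tmulCLM A C a).continuous) fun e => ?_
  refine subset_closedSpan ⟨e, MinTensor.tmul a c, tmul_mem_idealTensor ha c, ?_⟩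
  rw [oneTensor_tmul]; rfl

theorem IsCoactionOn.closedSpan_eq_image (hδ : IsCoactionOn δ I) :
    (closedSpan {m | ∃ a ∈ I, ∃ c, m = δ a * oneTensor A (GroupCStar G) c} :
      Set 𝓜(ℂ, MinTensor A (GroupCStar G))) =
    multCoe (MinTensor A (GroupCStar G)) '' (idealTensor (GroupCStar G) I) := by
  rw [coe_multCoe]
  exact hδ.span_eq

theorem IsCoactionOn.exists_mul_oneTensor (hδ : IsCoactionOn δ I) {a : A} (ha : a ∈ I)
    (c : GroupCStar G) : ∃ f ∈ idealTensor (GroupCStar G) I,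
      multCoe (MinTensor A (GroupCStar G)) f = δ a * oneTensor A (GroupCStar G) c := by
  have h : δ a * oneTensor A (GroupCStar G) c ∈ (closedSpan
      {m | ∃ a ∈ I, ∃ c, m = δ a * oneTensor A (GroupCStar G) c} :
      Set 𝓜(ℂ, MinTensor A (GroupCStar G))) :=
    subset_closedSpan ⟨a, ha, c, rfl⟩
  rw [hδ.closedSpan_eq_image] at h
  exact h

theorem IsCoactionOn.le_closedSpan (hδ : IsCoactionOn δ I) : idealTensor (GroupCStar G) I ≤
    closedSpan {f : MinTensor A (GroupCStar G) | ∃ a ∈ I, ∃ c,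
      multCoe (MinTensor A (GroupCStar G)) f = δ a * oneTensor A (GroupCStar G) c} := by
  have h := le_closedSpan_preimage (multCoe (MinTensor A (GroupCStar G)))
    (N := idealTensor (GroupCStar G) I) hδ.closedSpan_eq_image
  exact h

/-- The span condition of an invariant ideal phrased inside `A ⊗ C*(G)`: the closed linear span of
`δ(I)(A ⊗ C*(G))` is `I ⊗ C*(G)`. -/
def SpansIdeal (δ : A →⋆ₙₐ[ℂ] 𝓜(ℂ, MinTensor A (GroupCStar G))) (I : Submodule ℂ A) : Prop :=
  closedSpan {z | ∃ a ∈ I, ∃ t, z = (δ a).fst t} = idealTensor (GroupCStar G) I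

theorem SpansIdeal.fst_mem (h : SpansIdeal δ I) {a : A} (ha : a ∈ I)
    (t : MinTensor A (GroupCStar G)) : (δ a).fst t ∈ idealTensor (GroupCStar G) I :=
  h ▸ subset_closedSpan ⟨a, ha, t, rfl⟩

theorem SpansIdeal.mem_closedSpan (h : SpansIdeal δ I) {t : MinTensor A (GroupCStar G)}
    (ht : t ∈ idealTensor (GroupCStar G) I) :
    t ∈ closedSpan {z | ∃ a ∈ I, ∃ t, z = (δ a).fst t} := by
  rw [SpansIdeal] at h
  rw [h]
  exact ht

theorem IsCoactionOn.spansIdeal (hI : IsClosedIdeal I) (h : IsCoactionOn δ I) :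
    SpansIdeal δ I := by
  refine le_antisymm (closedSpan_le (isClosed_closedSpan _) ?_) ?_
  · rintro _ ⟨a, ha, t, rfl⟩
    refine map_mem_of_mem_closedSpan (δ a).fst (isClosed_closedSpan _) ?_
      (mem_closedSpan_oneTensor (N := ⊤) (by rw [idealTensor_top]; trivial))
    rintro _ ⟨c, s, -, rfl⟩
    obtain ⟨f, hf, hfm⟩ := h.exists_mul_oneTensor ha c
    have := multCoe_eq_iff.1 hfm s
    change f * s = (δ a).fst ((oneTensor A (GroupCStar G) c).fst s) at this
    rw [← this]
    exact (isClosedIdeal_idealTensor hI).mul_mem_right _ _ hf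
  · rw [← h.nondegenerate]
    refine closedSpan_le (isClosed_closedSpan _) ?_
    rintro _ ⟨a, ha, w, -, rfl⟩
    exact subset_closedSpan ⟨a, ha, w, rfl⟩

/-- For a coaction `δ` on `A`, an ideal `I` is invariant once `δ(I)(A ⊗ C*(G))` spans
`I ⊗ C*(G)`: an element `a ∈ I` with `δ(a)` vanishing on `I ⊗ C*(G)` satisfies
`δ(a a*)(1 ⊗ C*(G)) = 0`, and the remaining axioms are inherited from `A`. -/
theorem SpansIdeal.isCoactionOn (hI : IsClosedIdeal I) (hδ : IsCoaction δ) (h : SpansIdeal δ I) :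
    IsCoactionOn δ I := by
  have hT := isClosedIdeal_idealTensor (C := GroupCStar G) hI
  refine ⟨fun a ha h0 => ?_, ?_, ?_, ?_⟩
  · have h1 : a * star a = 0 := by
      refine hδ.injective _ trivial fun z _ => ?_
      rw [map_mul]
      exact h0 _ (h.fst_mem (hI.star_mem ha) z)
    exact (CStarRing.mul_star_self_eq_zero_iff a).1 h1
  · refine le_antisymm (closedSpan_le (isClosed_closedSpan _) ?_) fun z hz => ?_
    · rintro _ ⟨a, ha, w, -, rfl⟩
      exact h.fst_mem ha w
    · refine hT.mem_of_forall_mul_mem (isClosed_closedSpan _) hz fun e he => ?_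
      refine map_mem_of_mem_closedSpan 
        ((ContinuousLinearMap.mul ℂ (MinTensor A (GroupCStar G))).flip e) (isClosed_closedSpan _) ?_ (h.mem_closedSpan hz)
      rintro _ ⟨a, ha, t, rfl⟩
      change (δ a).fst t * e ∈ _
      rw [← multiplier_fst_mul]
      exact subset_closedSpan ⟨a, ha, _, hT.mul_mem_left _ _ he, rfl⟩
  · have h1 : ∀ m ∈ {m | ∃ a ∈ I, ∃ c, m = δ a * oneTensor A (GroupCStar G) c},
        ∃ f ∈ idealTensor (GroupCStar G) I, multCoe (MinTensor A (GroupCStar G)) f = m := by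
      rintro _ ⟨a, ha, c, rfl⟩
      obtain ⟨f, -, hf⟩ := IsCoactionOn.exists_mul_oneTensor hδ (Submodule.mem_top (x := a)) c
      refine ⟨f, mem_of_forall_mul_mem (isClosed_closedSpan _) fun e => ?_, hf⟩
      rw [multCoe_eq_iff.1 hf e]
      exact h.fst_mem ha _
    have h2 : idealTensor (GroupCStar G) I ≤ closedSpan {f : MinTensor A (GroupCStar G) |
        multCoe (MinTensor A (GroupCStar G)) f ∈
          {m | ∃ a ∈ I, ∃ c, m = δ a * oneTensor A (GroupCStar G) c}} := by
      rw [← h]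
      refine closedSpan_le (isClosed_closedSpan _) ?_
      rintro _ ⟨a, ha, t, rfl⟩
      refine map_mem_of_mem_closedSpan (δ a).fst (isClosed_closedSpan _) ?_
        (IsCoactionOn.le_closedSpan hδ (by rw [idealTensor_top]; trivial))
      rintro f ⟨b, -, c, hf⟩
      refine subset_closedSpan ⟨a * b, hI.mul_mem_right _ _ ha, c, ?_⟩
      refine multCoe_eq_iff.2 fun e => ?_
      rw [map_mul, ← multiplier_fst_mul, multCoe_eq_iff.1 hf e]
      rfl
    have key := closedSpan_eq_image (multCoe (MinTensor A (GroupCStar G)))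
      (isClosed_closedSpan _) h1 h2
    rw [coe_multCoe] at key
    exact key
  · obtain ⟨Δ, Ψ, hΔ, hΨ, h'⟩ := hδ.coaction_identity
    exact ⟨Δ, Ψ, hΔ, hΨ, fun a _ => h' a trivial⟩

/-- For an ideal of the algebra of a coaction, invariance amounts to the single span condition
`SpansIdeal`. -/
theorem isCoactionInvariant_iff (hI : IsClosedIdeal I) (hδ : IsCoaction δ) :
    IsCoactionInvariant δ I ↔ SpansIdeal δ I :=
  ⟨fun h => IsCoactionOn.spansIdeal hI h, fun h => h.isCoactionOn hI hδ⟩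

end Coaction

/-! ### Compatible coactions -/

section CompatibleCoaction

variable {G : Type u} [TopologicalSpace G] [Group G] [IsTopologicalGroup G]
  [LocallyCompactSpace G] {A B X : Type u} [NonUnitalCStarAlgebra A] [NonUnitalCStarAlgebra B]
  [NormedAddCommGroup X] [NormedSpace ℂ X] [CompleteSpace X] [HilbertModule A X]
  {M : ImprimitivityBimodule B A X} {I : Submodule ℂ A}
  {δ : A →⋆ₙₐ[ℂ] 𝓜(ℂ, MinTensor A (GroupCStar G))}
  {ε : B →⋆ₙₐ[ℂ] 𝓜(ℂ, MinTensor B (GroupCStar G))}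
  {ζ : X →ₗ[ℂ] ModuleOp A X (GroupCStar G)}

local notation "𝐂" => GroupCStar G

namespace IsCompatibleCoaction

variable (h : IsCompatibleCoaction M.toLeftAction ε δ ζ)

theorem apply_mul {L : LeftAction B A X} (h : IsCompatibleCoaction L ε δ ζ) (x : X)
    (t s : MinTensor A 𝐂) : ζ x (t * s) = HilbertModule.act (ζ x t) s := by
  obtain ⟨η, hη⟩ := h.adjointable x
  refine eq_of_forall_inner (MinTensor A 𝐂) fun z => ?_
  rw [hη, inner_act_left, hη, star_mul, mul_assoc]

theorem apply_mem {L : LeftAction B A X} (h : IsCompatibleCoaction L ε δ ζ)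
    (hI : IsClosedIdeal I) (x : X) {t : MinTensor A 𝐂} (ht : t ∈ idealTensor 𝐂 I) :
    ζ x t ∈ moduleTensor X 𝐂 I := by
  refine (isClosedIdeal_idealTensor hI).mem_of_forall_mul_mem
    (N := (moduleTensor X 𝐂 I).comap (ζ x).toLinearMap)
    (isClosed_moduleTensor.preimage (ζ x).continuous) ht fun e he => ?_
  change ζ x (t * e) ∈ moduleTensor X 𝐂 I
  rw [h.apply_mul]
  exact act_mem_moduleTensor _ he

theorem norm_apply_le {L : LeftAction B A X} (h : IsCompatibleCoaction L ε δ ζ) (x : X)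
    (t : MinTensor A 𝐂) : ‖ζ x t‖ ≤ ‖x‖ * ‖t‖ := by
  refine le_of_sq_le_sq ?_ (by positivity)
  rw [HilbertModule.norm_sq (A := MinTensor A 𝐂), h.map_inner]
  have h1 : ‖(δ (HilbertModule.inner x x)).fst t‖ ≤ ‖x‖ ^ 2 * ‖t‖ := by
    rw [HilbertModule.norm_sq (A := A) x]
    refine ((δ _).fst.le_opNorm t).trans ?_
    rw [DoubleCentralizer.norm_fst]
    exact mul_le_mul_of_nonneg_right (NonUnitalStarAlgHom.norm_apply_le δ _) (norm_nonneg t)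
  calc _ ≤ ‖star t‖ * (‖x‖ ^ 2 * ‖t‖) :=
        (norm_mul_le _ _).trans (mul_le_mul_of_nonneg_left h1 (norm_nonneg _))
    _ = _ := by rw [norm_star]; ring

/-- For `t ∈ A ⊗ C*(G)`, the continuous map `x ↦ ζ(x) t`. -/
def applyCLM {L : LeftAction B A X} (h : IsCompatibleCoaction L ε δ ζ) (t : MinTensor A 𝐂) :
    X →L[ℂ] HilbTensor A X 𝐂 :=
  LinearMap.mkContinuous
    { toFun := fun x => ζ x t
      map_add' := fun x y => by simp
      map_smul' := fun c x => by simp } ‖t‖ fun x => by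
        rw [mul_comm]; exact h.norm_apply_le x t

theorem applyCLM_apply {L : LeftAction B A X} (h : IsCompatibleCoaction L ε δ ζ)
    (t : MinTensor A 𝐂) (x : X) : h.applyCLM t x = ζ x t := rfl

include h

/-- `ε(b) · _{B ⊗ C}⟨ζ(x) t, w⟩ = _{B ⊗ C}⟨ζ(b · x) t, w⟩`. -/
theorem fst_tensorLeftInner (b : B) (x : X) (t : MinTensor A 𝐂) (w : HilbTensor A X 𝐂) :
    (ε b).fst (tensorLeftInner 𝐂 M (ζ x t) w) = tensorLeftInner 𝐂 M (ζ (M.act b x) t) w :=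
  eq_of_forall_mul_left fun s => by
    rw [← (ε b).central, ← tensorLeftInner_act, ← tensorLeftInner_act, h.map_left]

/-- To control a continuous linear map on `B ⊗ C*(G)` it suffices to evaluate it at the elements
`_{B ⊗ C}⟨ζ(x) t, w⟩`: the inner product is full and `ζ(X)(A ⊗ C*(G))` is dense. -/
theorem tensorLeftInner_induction {V : Type*} [NormedAddCommGroup V] [NormedSpace ℂ V]
    (f : MinTensor B 𝐂 →L[ℂ] V) {N : Submodule ℂ V} (hN : IsClosed (N : Set V))
    (hf : ∀ x t w, f (tensorLeftInner 𝐂 M (ζ x t) w) ∈ N) (s : MinTensor B 𝐂) : f s ∈ N := by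
  refine map_mem_of_mem_closedSpan f hN ?_
    (by rw [closedSpan_tensorLeftInner]; trivial :
      s ∈ closedSpan {s | ∃ z w, s = tensorLeftInner 𝐂 M z w})
  rintro _ ⟨z, w, rfl⟩
  refine map_mem_of_mem_closedSpan (f.comp (tensorLeftInnerFst 𝐂 M w)) hN ?_
    (by rw [h.dense_range]; trivial : z ∈ closedSpan {z | ∃ x t, z = ζ x t})
  rintro _ ⟨x, t, rfl⟩
  exact hf x t w

/-- Invariance passes from `I` to `J`. Since `ε(b) _{B ⊗ C}⟨ζ(x) t, w⟩ = _{B ⊗ C}⟨ζ(b · x) t, w⟩`,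
and `J · X` and `X · I` have the same closed span, everything reduces to
`ζ(x · a) t = ζ(x) δ(a) t` with `a ∈ I`. -/
theorem spansIdeal_rieffel (hI : IsClosedIdeal I) (hδ : SpansIdeal δ I) :
    SpansIdeal ε (M.rieffel I) := by
  refine le_antisymm (closedSpan_le (isClosed_closedSpan _) ?_) ?_
  · rintro _ ⟨b, hb, s, rfl⟩
    refine h.tensorLeftInner_induction (ε b).fst (isClosed_closedSpan _) (fun x t w => ?_) s
    rw [h.fst_tensorLeftInner]
    refine tensorLeftInner_mem M ?_ w
    refine map_mem_of_mem_closedSpan (h.applyCLM t) isClosed_moduleTensor ?_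
      (rieffel_act_mem M hI hb x)
    rintro _ ⟨y, a, ha, rfl⟩
    rw [applyCLM_apply, h.map_right]
    exact h.apply_mem hI y (hδ.fst_mem ha t)
  · refine (idealTensor_rieffel_le M).trans (closedSpan_le (isClosed_closedSpan _) ?_)
    rintro _ ⟨z, hz, w, rfl⟩
    refine map_mem_of_mem_closedSpan (tensorLeftInnerFst 𝐂 M w) (isClosed_closedSpan _) ?_
      (mem_closedSpan_act hz)
    rintro _ ⟨y, t, ht, rfl⟩
    refine map_mem_of_mem_closedSpan ((tensorLeftInnerFst 𝐂 M w).comp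
      ((actCLM (MinTensor A 𝐂) (HilbTensor A X 𝐂)).flip t)) (isClosed_closedSpan _) ?_
      (by rw [h.dense_range]; trivial : y ∈ closedSpan {z | ∃ x t, z = ζ x t})
    rintro _ ⟨x, s, rfl⟩
    change tensorLeftInner 𝐂 M (HilbertModule.act (ζ x s) t) w ∈ _
    rw [← h.apply_mul]
    refine map_mem_of_mem_closedSpan ((tensorLeftInnerFst 𝐂 M w).comp (ζ x))
      (isClosed_closedSpan _) ?_ 
      (hδ.mem_closedSpan ((isClosedIdeal_idealTensor hI).mul_mem_left s t ht))
    rintro _ ⟨a, ha, r, rfl⟩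
    change tensorLeftInner 𝐂 M (ζ x ((δ a).fst r)) w ∈ _
    rw [← h.map_right]
    refine map_mem_of_mem_closedSpan ((tensorLeftInnerFst 𝐂 M w).comp (h.applyCLM r))
      (isClosed_closedSpan _) ?_ (act_mem_closedSpan_rieffel M x ha)
    rintro _ ⟨b, hb, y, rfl⟩
    change tensorLeftInner 𝐂 M (ζ (M.act b y) r) w ∈ _
    rw [← h.fst_tensorLeftInner]
    exact subset_closedSpan ⟨b, hb, _, rfl⟩

/-- If `ε(b) u = v` in the sense that `s v = (s ε(b)) u` for all `s`, then `v` is a limit of sums of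
elements `ζ(b · y) t`: approximate `u` by sums of elements `ζ(y) t`. -/
theorem mem_closedSpan_of_leftAction_snd (b : B) {u v : HilbTensor A X 𝐂}
    (huv : ∀ s, (HilbTensor.leftAction 𝐂 M.toLeftAction).act s v =
      (HilbTensor.leftAction 𝐂 M.toLeftAction).act ((ε b).snd s) u) :
    v ∈ closedSpan {z | ∃ y t, z = ζ (M.act b y) t} := by
  refine (isClosed_closedSpan _).closure_subset (Metric.mem_closure_iff.2 fun r hr => ?_)
  obtain ⟨u', hu', hr'⟩ := exists_mem_span_norm_sub_lt
    (by rw [h.dense_range]; trivial : u ∈ closedSpan {z | ∃ x t, z = ζ x t})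
    (ε := r / (‖ε b‖ + 1)) (by positivity)
  obtain ⟨v', hv', huv'⟩ : ∃ v' ∈ Submodule.span ℂ {z | ∃ y t, z = ζ (M.act b y) t},
      ∀ s, (HilbTensor.leftAction 𝐂 M.toLeftAction).act s v' =
        (HilbTensor.leftAction 𝐂 M.toLeftAction).act ((ε b).snd s) u' := by
    clear hr'
    induction hu' using Submodule.span_induction with
    | mem z hz =>
      obtain ⟨y, t, rfl⟩ := hz
      exact ⟨_, Submodule.subset_span ⟨y, t, rfl⟩, fun s => h.map_left b y s t⟩
    | zero => exact ⟨0, Submodule.zero_mem _, fun s => by rw [map_zero, map_zero]⟩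
    | add x y _ _ hx hy =>
      obtain ⟨x', hx', hx⟩ := hx
      obtain ⟨y', hy', hy⟩ := hy
      exact ⟨x' + y', Submodule.add_mem _ hx' hy', fun s => by rw [map_add, map_add, hx, hy]⟩
    | smul c x _ hx =>
      obtain ⟨x', hx', hx⟩ := hx
      exact ⟨c • x', Submodule.smul_mem _ c hx', fun s => by rw [map_smul, map_smul, hx]⟩
  refine ⟨v', Submodule.le_topologicalClosure _ hv', ?_⟩
  rw [dist_eq_norm]
  have hle : ‖v - v'‖ ≤ ‖ε b‖ * ‖u - u'‖ := by
    refine (HilbTensor.leftAction 𝐂 M.toLeftAction).norm_le_of_forall_act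
      (closedSpan_leftAction 𝐂 M) (by positivity) fun s => ?_
    rw [map_sub, huv, huv', ← map_sub]
    refine (LeftAction.norm_act_le _ _ _).trans ?_
    have : ‖(ε b).snd s‖ ≤ ‖ε b‖ * ‖s‖ := by
      rw [← DoubleCentralizer.norm_snd]; exact (ε b).snd.le_opNorm s
    calc _ ≤ ‖ε b‖ * ‖s‖ * ‖u - u'‖ := by gcongr
      _ = _ := by ring
  have h1 : ‖ε b‖ * ‖u - u'‖ ≤ (‖ε b‖ + 1) * ‖u - u'‖ := by
    have := norm_nonneg (u - u'); linarith
  have h2 := (lt_div_iff₀' (by positivity)).1 hr'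
  linarith

/-- For `b ∈ J` the operator `ζ(b · x)` takes values in `(X · I) ⊗ C*(G)`, because
`s ζ(b · x) t = (s ε(b)) ζ(x) t` with `s ε(b) ∈ J ⊗ C*(G)`. -/
theorem apply_rieffel_mem (hI : IsClosedIdeal I) (hε : SpansIdeal ε (M.rieffel I)) {b : B}
    (hb : b ∈ M.rieffel I) (x : X) (t : MinTensor A 𝐂) :
    ζ (M.act b x) t ∈ moduleTensor X 𝐂 I := by
  refine (HilbTensor.leftAction 𝐂 M.toLeftAction).mem_of_forall_act_mem
    (closedSpan_leftAction 𝐂 M) isClosed_moduleTensor fun s => ?_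
  rw [h.map_left]
  refine leftAction_mem_moduleTensor M hI ?_ _
  have h1 := (isClosedIdeal_idealTensor (C := 𝐂) (isClosedIdeal_rieffel M)).star_mem
    (hε.fst_mem ((isClosedIdeal_rieffel M).star_mem hb) (star s))
  rwa [map_star ε, DoubleCentralizer.star_fst, star_star, star_star] at h1

theorem moduleTensor_le_closedSpan (hε : SpansIdeal ε (M.rieffel I)) :
    moduleTensor X 𝐂 I ≤ closedSpan {z | ∃ b ∈ M.rieffel I, ∃ y t, z = ζ (M.act b y) t} := by
  intro z hz
  refine closedSpan_le (isClosed_closedSpan _) ?_ (mem_closedSpan_leftAction M hz)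
  rintro _ ⟨s, hs, y, rfl⟩
  refine map_mem_of_mem_closedSpan ((HilbTensor.leftAction 𝐂 M.toLeftAction).actCLM.flip y)
    (isClosed_closedSpan _) ?_ (hε.mem_closedSpan hs)
  rintro _ ⟨b, hb, f, rfl⟩
  have h1 := h.mem_closedSpan_of_leftAction_snd b
    (u := (HilbTensor.leftAction 𝐂 M.toLeftAction).act f y)
    (v := (HilbTensor.leftAction 𝐂 M.toLeftAction).act ((ε b).fst f) y) fun s => by
      rw [← LeftAction.mul_act, ← LeftAction.mul_act, (ε b).central]
  refine closedSpan_le (isClosed_closedSpan _) ?_ h1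
  rintro _ ⟨y, t, rfl⟩
  exact subset_closedSpan ⟨b, hb, y, t, rfl⟩

omit h

/-- The adjoint `ζ(x)*` is automatically linear and bounded. -/
theorem exists_adjoint {L : LeftAction B A X} (h : IsCompatibleCoaction L ε δ ζ) (x : X) :
    ∃ η : HilbTensor A X 𝐂 →L[ℂ] MinTensor A 𝐂,
      ∀ t z, HilbertModule.inner (A := MinTensor A 𝐂) (ζ x t) z = star t * η z := by
  obtain ⟨η, hη⟩ := h.adjointable x
  have hη' : ∀ s z, s * η z = HilbertModule.inner (A := MinTensor A 𝐂) (ζ x (star s)) z :=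
    fun s z => by rw [hη, star_star]
  refine ⟨LinearMap.mkContinuous
    { toFun := η
      map_add' := fun y z => eq_of_forall_mul_left fun s => by
        rw [mul_add, hη', hη', hη', map_add]
      map_smul' := fun c z => eq_of_forall_mul_left fun s => by
        rw [RingHom.id_apply, mul_smul_comm, hη', hη', map_smul] } ‖ζ x‖ fun z => ?_, hη⟩
  change ‖η z‖ ≤ _
  rcases (norm_nonneg (η z)).eq_or_lt with h0 | h0
  · rw [← h0]; positivity
  have h1 : ‖η z‖ * ‖η z‖ ≤ ‖ζ x‖ * ‖η z‖ * ‖z‖ := by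
    rw [← CStarRing.norm_star_mul_self, ← hη]
    refine (norm_inner_le _ _ _).trans ?_
    gcongr
    exact (ζ x).le_opNorm _
  refine le_of_mul_le_mul_right (h1.trans_eq ?_) h0
  ring

include h

theorem fst_inner_eq {x : X} {η : HilbTensor A X 𝐂 →L[ℂ] MinTensor A 𝐂}
    (hη : ∀ t z, HilbertModule.inner (A := MinTensor A 𝐂) (ζ x t) z = star t * η z) (y : X)
    (t : MinTensor A 𝐂) : η (ζ y t) = (δ (HilbertModule.inner x y)).fst t :=
  eq_of_forall_mul_left fun s => by
    rw [← star_star s, ← hη, h.map_inner]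

/-- Invariance passes from `J` to `I`. The operators `ζ(x)* ζ(b · y) = δ(⟨x, b · y⟩_A)` with `b ∈ J`
give `δ(I)`, and `ζ(J · X)(A ⊗ C*(G))` spans `(X · I) ⊗ C*(G)`. Nondegeneracy of `ζ` is what allows
to replace an arbitrary `w ∈ X ⊗ C*(G)` in `⟨w, z⟩` by `(1 ⊗ c) ζ(x)`. -/
theorem spansIdeal_of_rieffel (hI : IsClosedIdeal I) (hζ : IsNondegenerateCoaction ζ)
    (hε : SpansIdeal ε (M.rieffel I)) : SpansIdeal δ I := by
  refine le_antisymm (closedSpan_le (isClosed_closedSpan _) ?_) ?_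
  · rintro _ ⟨a, ha, t, rfl⟩
    refine map_mem_of_mem_closedSpan ((multActCLM δ).flip t) (isClosed_closedSpan _) ?_
      (mem_closedSpan_inner_rieffel M ha)
    rintro _ ⟨x, y, b, hb, rfl⟩
    change (δ _).fst t ∈ _
    refine mem_of_forall_mul_left_mem (isClosed_closedSpan _) fun s => ?_
    rw [← star_star s, ← h.map_inner]
    exact inner_mem_idealTensor hI _ (h.apply_rieffel_mem hI hε hb y t)
  · refine (idealTensor_le_closedSpan_inner M).trans (closedSpan_le (isClosed_closedSpan _) ?_)
    rintro _ ⟨w, z, hz, rfl⟩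
    have hw : w ∈ closedSpan {w | moduleOpIsometry A X 𝐂 w ∈
        {T | ∃ (c : 𝐂) (x : X), T = HilbTensor.oneAct c ∘L ζ x}} :=
      le_closedSpan_preimage (moduleOpIsometry A X 𝐂) (N := ⊤)
        (by rw [Submodule.top_coe, Set.image_univ]; exact hζ) trivial
    refine map_mem_of_mem_closedSpan ((innerCLM (MinTensor A 𝐂) (HilbTensor A X 𝐂)).flip z)
      (isClosed_closedSpan _) ?_ hw
    rintro w ⟨c, x, hw⟩
    obtain ⟨η, hη⟩ := h.exists_adjoint x
    -- `⟨w, z⟩ = ζ(x)* (1 ⊗ c*) z` since `w = (1 ⊗ c) ζ(x)` as an operator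
    have e : HilbertModule.inner (A := MinTensor A 𝐂) w z = η (HilbTensor.oneAct (star c) z) := by
      refine eq_of_forall_mul_left fun s => ?_
      have h1 : HilbertModule.act w (star s) = HilbTensor.oneAct c (ζ x (star s)) :=
        DFunLike.congr_fun hw (star s)
      have h2 := (HilbTensor.oneAction A X 𝐂).inner_act_left c (ζ x (star s)) z
      change HilbertModule.inner (HilbTensor.oneAct c (ζ x (star s))) z =
        HilbertModule.inner (ζ x (star s)) (HilbTensor.oneAct (star c) z) at h2
      rw [← h1, hη, inner_act_left, star_star] at h2
      exact h2
    change HilbertModule.inner w z ∈ _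
    rw [e]
    refine map_mem_of_mem_closedSpan η (isClosed_closedSpan _) ?_
      (h.moduleTensor_le_closedSpan hε (oneAct_mem_moduleTensor (star c) hz))
    rintro _ ⟨b, hb, y, t, rfl⟩
    rw [h.fst_inner_eq hη]
    exact subset_closedSpan ⟨_, inner_mem_of_mem_idealModule hI x (rieffel_act_mem M hI hb y), t,
      rfl⟩

theorem invariant_iff (hI : IsClosedIdeal I) (hζ : IsNondegenerateCoaction ζ)
    (hδ : IsCoaction δ) (hε : IsCoaction ε) :
    IsCoactionInvariant δ I ↔ IsCoactionInvariant ε (M.rieffel I) := by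
  rw [isCoactionInvariant_iff hI hδ, isCoactionInvariant_iff (isClosedIdeal_rieffel M) hε]
  exact ⟨h.spansIdeal_rieffel hI, h.spansIdeal_of_rieffel hI hζ⟩

end IsCompatibleCoaction

end CompatibleCoaction

end CStarCoaction

end

theorem lemma2p4 {G : Type u} [TopologicalSpace G] [Group G] [IsTopologicalGroup G]
    [LocallyCompactSpace G] [T2Space G]
    {A B X : Type u} [NonUnitalCStarAlgebra A] [NonUnitalCStarAlgebra B]
    [NormedAddCommGroup X] [NormedSpace ℂ X] [CompleteSpace X]
    [CStarCoaction.HilbertModule A X] (M : CStarCoaction.ImprimitivityBimodule B A X)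
    (I : Submodule ℂ A) (hI : CStarCoaction.IsClosedIdeal I) :
    (∀ (α : G →* (A ≃⋆ₐ[ℂ] A)) (β : G →* (B ≃⋆ₐ[ℂ] B)),
      CStarCoaction.IsAction α → CStarCoaction.IsAction β →
      (∃ γ : G →* (X ≃ₗ[ℂ] X), CStarCoaction.IsCompatibleAction M.toLeftAction β α γ) →
      (CStarCoaction.IsActionInvariant α I ↔ CStarCoaction.IsActionInvariant β (M.rieffel I))) ∧
    (∀ (δ : A →⋆ₙₐ[ℂ] 𝓜(ℂ, CStarCoaction.MinTensor A (CStarCoaction.GroupCStar G)))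
      (ε : B →⋆ₙₐ[ℂ] 𝓜(ℂ, CStarCoaction.MinTensor B (CStarCoaction.GroupCStar G))),
      CStarCoaction.IsCoaction δ → CStarCoaction.IsCoaction ε →
      (∃ ζ : X →ₗ[ℂ] CStarCoaction.ModuleOp A X (CStarCoaction.GroupCStar G),
        CStarCoaction.IsCompatibleCoaction M.toLeftAction ε δ ζ ∧
        CStarCoaction.IsNondegenerateCoaction ζ) →
      (CStarCoaction.IsCoactionInvariant δ I ↔
        CStarCoaction.IsCoactionInvariant ε (M.rieffel I))) :=
  ⟨fun _ _ _ _ ⟨_, hγ⟩ => hγ.invariant_iff hI,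
    fun _ _ hδ hε ⟨_, hζ, hn⟩ => hζ.invariant_iff hI hn hδ hε⟩
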